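/- **Setting.** Let $(\Omega_1\times\Omega_2,\mathcal A_1\otimes\mathcal A_2,Q_1\otimes Q_2)$ be a product probability space; $\Omega_1$ carries the data $\mathbf X_n:\Omega_1\to\chi_{1n}$ (arbitrary maps, not necessarily measurable), and $\Omega_2$ carries the additional randomness, in particular measurable maps $\mathbf M_n:\Omega_2\to\chi_{2n}$ (for example random permutations). Let $r\ge 1$ and let $\boldsymbol\Sigma,\boldsymbol\Sigma^\pi\in\mathbb R^{r\times r}$ be symmetric and positive semidefinite. Let $\widehat{\boldsymbol\theta}^\pi\in\mathbb R^r$ and $\widehat{\boldsymbol\Sigma}^\pi\in\mathbb R^{r\times r}$ be functions of $(\mathbf X_n,\mathbf M_n)$ and let $\widehat{\boldsymbol\Sigma}\in\mathbb R^{r\times r}$ be a function of $\mathbf X_n$, where $\widehat{\boldsymbol\Sigma},\widehat{\boldsymbol\Sigma}^\pi$ take values in the symmetric positive semidefinite matrices. Let $\widehat{\boldsymbol\Sigma}=\widehat{\mathbf U}\widehat{\mathbf D}\widehat{\mathbf U}'$ and $\widehat{\boldsymbol\Sigma}^\pi=\widehat{\mathbf U}^\pi\widehat{\mathbf D}^\pi\widehat{\mathbf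 U}^{\pi\prime}$ be eigenvalue decompositions with $\widehat{\mathbf U},\widehat{\mathbf U}^\pi$ orthogonal and $\widehat{\mathbf D},\widehat{\mathbf D}^\pi$ diagonal with decreasing (i.e. non-increasing) diagonal entries, where $\widehat{\mathbf U},\widehat{\mathbf D}$ are functions of $\mathbf X_n$ and $\widehat{\mathbf U}^\pi,\widehat{\mathbf D}^\pi$ are functions of $(\mathbf X_n,\mathbf M_n)$. For fixed data, $\widehat{\boldsymbol\theta}^\pi$ and $\widehat{\mathbf U}^\pi$ are measurable functions of $\mathbf M_n$. **Notions.** $\xrightarrow{P}$ denotes convergence in outer probability. Write $\mathrm E_2$ for the expectation over $\Omega_2$ with the first coordinate held fixed, $BL_1(\mathbb R^r)$ for the set of all $h:\mathbb R^r\to[-1,1]$ that are Lipschitz with constant $1$, and $f^*$, $f_*$ for the minimal measurable majorant and the maximal measurable minorant of $f$ with respect to $Q_1\otimes Q_2$. For $\mathbb R^r$-valued $\mathbf Y_n$ on $\Omega_1\times\Omega_2$ that are measurable in the second coordinate, $\mathbf Y_n\xrightarrow{d^*}\nu$ (conditional weak convergence in outer probability) means that $$\sup_{h\in BL_1(\mathbb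 R^r)}\Big|\mathrm E_2[h(\mathbf Y_n)]-\int h\,d\nu\Big|\to 0\quad\text{and}\quad \mathrm E_2[h(\mathbf Y_n)^*]-\mathrm E_2[h(\mathbf Y_n)_*]\to 0\ \text{ for all } h\in BL_1(\mathbb R^r),$$ both in outer $Q_1$-probability. Maps $\mathbf V_n$ into a metric space, defined on a probability space, are asymptotically measurable if the outer and the inner expectation of $f(\mathbf V_n)$ differ by $o(1)$ for every bounded continuous $f$. $\|\cdot\|$ is the spectral norm and $\mathbf A^+$ the Moore–Penrose inverse. **Assumptions.** (1) $\sqrt n\,\widehat{\boldsymbol\theta}^\pi\xrightarrow{d^*}\mathcal N_r(\mathbf 0,\boldsymbol\Sigma^\pi)$. (2) $\widehat{\boldsymbol\Sigma}\xrightarrow{P}\boldsymbol\Sigma$ and $\widehat{\boldsymbol\Sigma}^\pi\xrightarrow{P}\boldsymbol\Sigma^\pi$. (3) $\mathrm{rank}(\boldsymbol\Sigma)\le\mathrm{rank}(\boldsymbol\Sigma^\pi)$. (4) $(r_n)$ is a real sequence with $r_n\to\infty$ and $r_n\|\widehat{\boldsymbol\Sigma}^\pi-\boldsymbol\Sigma^\pi\|\xrightarrow{P}0$.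 (5) $\widehat{\mathbf U}$ and $\widehat{\mathbf U}^\pi$ are asymptotically measurable. **Construction.** Fix $\varepsilon>0$. Let $I:=\{i\in\{2,\dots,r\}: r_n(\widehat{\mathbf D}^\pi_{(i-1)(i-1)}-\widehat{\mathbf D}^\pi_{ii})>\varepsilon\}$, let $i_1<\dots<i_J$ be its $J=|I|$ elements, and put $i_0:=1$, $i_{J+1}:=r+1$. Let $\mathbf R_{i;j}:\Omega_2\to O(i)$, $1\le i\le r$, $0\le j\le r-1$, be mutually independent random matrices, $\mathbf R_{i;j}$ being distributed according to the normalized Haar measure on the group $O(i)$ of orthogonal $i\times i$ matrices, and let the whole family be independent of $\mathbf M_n$ for every $n$. Define $$\mathbf R_\varepsilon:=\begin{cases}\bigoplus_{j=0}^{J}\mathbf R_{i_{j+1}-i_j;j}&\text{if } r_n\widehat{\mathbf D}^\pi_{rr}>\varepsilon,\\ \Big(\bigoplus_{j=0}^{J-1}\mathbf R_{i_{j+1}-i_j;j}\Big)\oplus\mathbf 0_{\hat\imath\times\hat\imath}&\text{if } r_n\widehat{\mathbf D}^\pi_{rr}\le\varepsilon,\end{cases}\qquad \hat\imath:=r+1-i_J,$$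 $$\widetilde{\boldsymbol\theta}^\pi:=\widehat{\mathbf U}\,\widehat{\mathbf D}^{1/2}\big((\widehat{\mathbf D}^\pi)^{1/2}\big)^+\,\mathbf R_\varepsilon\,\widehat{\mathbf U}^{\pi\prime}\,\widehat{\boldsymbol\theta}^\pi ,$$ and suppose that, for fixed data, $\widetilde{\boldsymbol\theta}^\pi$ is a measurable function on $\Omega_2$. **Theorem.** Under these assumptions, $\sqrt n\,\widetilde{\boldsymbol\theta}^\pi\xrightarrow{d^*}\mathcal N_r(\mathbf 0,\boldsymbol\Sigma)$ as $n\to\infty$. -/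

import Mathlib

open MeasureTheory ProbabilityTheory Filter Topology
open scoped BoundedContinuousFunction

namespace PermCorr

/-! ### Real matrices as a Borel space -/

/-- Real matrices carry the product (equivalently, the Borel) sigma-algebra. -/
instance instMeasurableSpaceMatrix {m k : Type*} : MeasurableSpace (Matrix m k ℝ) :=
  inferInstanceAs (MeasurableSpace (m → k → ℝ))

instance instBorelSpaceMatrix {m k : Type*} [Countable m] [Countable k] :
    BorelSpace (Matrix m k ℝ) :=
  inferInstanceAs (BorelSpace (m → k → ℝ))

/-- The spectral norm of a real square matrix: the operator norm with respect to the
Euclidean norm. -/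
noncomputable def specNorm {r : ℕ} (A : Matrix (Fin r) (Fin r) ℝ) : ℝ :=
  ‖Matrix.toEuclideanCLM (𝕜 := ℝ) A‖

/-! ### Measurable majorants and minorants, asymptotic measurability -/

section Majorant

variable {α : Type*} [MeasurableSpace α]

/-- `g` is a minimal measurable majorant of the (arbitrary) function `f` with respect to `μ`. -/
structure IsMeasMajorant (μ : Measure α) (f g : α → ℝ) : Prop where
  measurable : Measurable g
  le : ∀ x, f x ≤ g x
  minimal : ∀ u : α → ℝ, Measurable u → (∀ᵐ x ∂μ, f x ≤ u x) → ∀ᵐ x ∂μ, g x ≤ u x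

/-- Bounded functions have a minimal measurable majorant. -/
theorem exists_isMeasMajorant (μ : Measure α) [IsFiniteMeasure μ] (f : α → ℝ) (C : ℝ)
    (hC : ∀ x, |f x| ≤ C) : ∃ g, IsMeasMajorant μ f g := by
  classical
  let s : ℚ → Set α := fun q => toMeasurable μ {x | (q : ℝ) < f x}
  let G : α → EReal := fun x => ⨆ q : ℚ, if x ∈ s q then ((q : ℝ) : EReal) else ⊥
  have hG : Measurable G := by
    refine Measurable.iSup fun q => ?_
    exact Measurable.ite (measurableSet_toMeasurable _ _) measurable_const measurable_const
  have hfG : ∀ x, (f x : EReal) ≤ G x := by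
    intro x
    refine le_of_forall_lt fun c hc => ?_
    obtain ⟨q, hq1, hq2⟩ := EReal.lt_iff_exists_rat_btwn.1 hc
    have hx : x ∈ s q := subset_toMeasurable _ _ (by
      simpa using (EReal.coe_lt_coe_iff.1 (by simpa using hq2) : ((q : ℝ)) < f x))
    refine lt_of_lt_of_le hq1 ?_
    have := le_iSup (fun q : ℚ => if x ∈ s q then ((q : ℝ) : EReal) else ⊥) q
    simpa [hx] using this
  have hfm : ∀ x, (f x : EReal) ≤ min (G x) (C : EReal) := fun x =>
    le_min (hfG x) (EReal.coe_le_coe_iff.2 ((le_abs_self _).trans (hC x)))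
  have htop : ∀ x, min (G x) (C : EReal) ≠ ⊤ := fun x =>
    ne_top_of_le_ne_top (EReal.coe_ne_top C) (min_le_right _ _)
  have hbot : ∀ x, min (G x) (C : EReal) ≠ ⊥ := fun x =>
    ne_bot_of_le_ne_bot (EReal.coe_ne_bot (f x)) (hfm x)
  refine ⟨fun x => (min (G x) (C : EReal)).toReal, ?_, ?_, ?_⟩
  · exact (hG.min measurable_const).ereal_toReal
  · intro x
    have := hfm x
    rw [← EReal.coe_toReal (htop x) (hbot x)] at this
    exact EReal.coe_le_coe_iff.1 this
  · intro u hu hfu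
    have key : ∀ q : ℚ, ∀ᵐ x ∂μ, x ∈ s q → (q : ℝ) ≤ u x := by
      intro q
      have hms : MeasurableSet {x | u x < (q : ℝ)} := measurableSet_lt hu measurable_const
      have h1 := Measure.measure_toMeasurable_inter_of_sFinite (μ := μ) hms {x | (q : ℝ) < f x}
      have h2 : μ ({x | (q : ℝ) < f x} ∩ {x | u x < (q : ℝ)}) = 0 := by
        refine measure_mono_null ?_ (ae_iff.1 hfu)
        rintro x ⟨h3, h4⟩
        simp only [Set.mem_ofPred_eq] at h3 h4 ⊢
        linarith
      rw [h2] at h1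
      rw [ae_iff]
      refine measure_mono_null ?_ h1
      intro x hx
      simp only [Set.mem_ofPred_eq, Classical.not_imp, not_le] at hx
      exact ⟨hx.1, hx.2⟩
    filter_upwards [ae_all_iff.2 key] with x hx
    have hGu : G x ≤ (u x : EReal) := by
      refine iSup_le fun q => ?_
      split_ifs with h
      · exact EReal.coe_le_coe_iff.2 (hx q h)
      · exact bot_le
    have h5 : min (G x) (C : EReal) ≤ (u x : EReal) := (min_le_left _ _).trans hGu
    rw [← EReal.coe_toReal (htop x) (hbot x)] at h5
    exact EReal.coe_le_coe_iff.1 h5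

open Classical in
/-- The minimal measurable majorant of `f` with respect to `μ` (a version of it, unique up to
`μ`-null sets). The value in the `else` branch is never used for a bounded function `f`
and a finite measure `μ`. -/
noncomputable def majorant (μ : Measure α) (f : α → ℝ) : α → ℝ :=
  if h : ∃ g, IsMeasMajorant μ f g then h.choose else f

/-- The maximal measurable minorant of `f` with respect to `μ`. -/
noncomputable def minorant (μ : Measure α) (f : α → ℝ) : α → ℝ :=
  fun x => - majorant μ (fun y => - f y) x

theorem isMeasMajorant_majorant (μ : Measure α) [IsFiniteMeasure μ] (f : α → ℝ) (C : ℝ)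
    (hC : ∀ x, |f x| ≤ C) : IsMeasMajorant μ f (majorant μ f) := by
  have h := exists_isMeasMajorant μ f C hC
  rw [majorant, dif_pos h]
  exact h.choose_spec

/-- Asymptotic measurability of a sequence of arbitrary maps: the outer and the inner
expectation of `f (X n)` differ by `o(1)`, for every bounded continuous `f`. -/
def AsympMeasurable {S : Type*} [TopologicalSpace S] (μ : Measure α) (X : ℕ → α → S) : Prop :=
  ∀ f : S →ᵇ ℝ, Tendsto
    (fun n => ∫ a, majorant μ (fun y => f (X n y)) a ∂μ -
      ∫ a, minorant μ (fun y => f (X n y)) a ∂μ) atTop (𝓝 0)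

end Majorant

/-! ### Conditional weak convergence in outer probability -/

/-- The functions that are bounded by `1` and Lipschitz continuous with constant `1`. -/
def BL1 (E : Type*) [PseudoEMetricSpace E] : Set (E → ℝ) :=
  {h | LipschitzWith 1 h ∧ ∀ x, |h x| ≤ 1}

/-- Conditional weak convergence in outer probability of `Y n` to the law `ν`, where the first
coordinate (with law `Q₁`) carries the data and the second one (with law `Q₂`) the additional
randomness. `TendstoInMeasure Q₁` is convergence in outer `Q₁`-probability, since a measure is
evaluated at an arbitrary set as the outer measure; the majorants and minorants are taken with
respect to both coordinates jointly. -/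
structure CondWeakConv {Ω₁ Ω₂ E : Type*} [MeasurableSpace Ω₁] [MeasurableSpace Ω₂]
    [PseudoEMetricSpace E] [MeasurableSpace E] (Q₁ : Measure Ω₁) (Q₂ : Measure Ω₂)
    (Y : ℕ → Ω₁ → Ω₂ → E) (ν : Measure E) : Prop where
  sup_tendsto : TendstoInMeasure Q₁
    (fun n ω₁ => ⨆ h : BL1 E, |∫ ω₂, h.1 (Y n ω₁ ω₂) ∂Q₂ - ∫ z, h.1 z ∂ν|) atTop (fun _ => 0)
  asymp_meas : ∀ h ∈ BL1 E, TendstoInMeasure Q₁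
    (fun n ω₁ =>
      ∫ ω₂, majorant (Q₁.prod Q₂) (fun ω => h (Y n ω.1 ω.2)) (ω₁, ω₂) ∂Q₂ -
      ∫ ω₂, minorant (Q₁.prod Q₂) (fun ω => h (Y n ω.1 ω.2)) (ω₁, ω₂) ∂Q₂) atTop (fun _ => 0)

/-! ### Eigenvalue decompositions -/

/-- `S = U D U'` with `U` orthogonal and `D` diagonal with decreasing diagonal entries `d`. -/
structure IsEigDecomp {r : ℕ} (S U : Matrix (Fin r) (Fin r) ℝ) (d : Fin r → ℝ) : Prop where
  orthogonal : U ∈ Matrix.orthogonalGroup (Fin r) ℝ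
  antitone : Antitone d
  eq : S = U * Matrix.diagonal d * U.transpose

/-- `D^{1/2}` for the diagonal matrix `D` with nonnegative diagonal entries `d`. -/
noncomputable def diagSqrt {r : ℕ} (d : Fin r → ℝ) : Matrix (Fin r) (Fin r) ℝ :=
  Matrix.diagonal fun i => √(d i)

/-- `(D^{1/2})^+`, the Moore-Penrose inverse of `D^{1/2}` (recall that `0⁻¹ = 0`). -/
noncomputable def diagSqrtPinv {r : ℕ} (d : Fin r → ℝ) : Matrix (Fin r) (Fin r) ℝ :=
  Matrix.diagonal fun i => (√(d i))⁻¹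

theorem diagSqrt_mul_self {r : ℕ} (d : Fin r → ℝ) (hd : ∀ i, 0 ≤ d i) :
    diagSqrt d * diagSqrt d = Matrix.diagonal d := by
  simp [diagSqrt, Real.mul_self_sqrt, hd]

/-- The four Penrose conditions. -/
theorem diagSqrtPinv_spec {r : ℕ} (d : Fin r → ℝ) :
    diagSqrt d * diagSqrtPinv d * diagSqrt d = diagSqrt d ∧
    diagSqrtPinv d * diagSqrt d * diagSqrtPinv d = diagSqrtPinv d ∧
    (diagSqrt d * diagSqrtPinv d).transpose = diagSqrt d * diagSqrtPinv d ∧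
    (diagSqrtPinv d * diagSqrt d).transpose = diagSqrtPinv d * diagSqrt d := by
  have key : ∀ x : ℝ, x⁻¹ * x * x⁻¹ = x⁻¹ := fun x => by
    by_cases hx : x = 0 <;> simp [hx]
  simp [diagSqrt, diagSqrtPinv, key]

/-! ### The random block rotation -/

open Classical in
/-- The set of all indices at which a new group of eigenvalues starts: `i` such that
`c (d_{i-1} - d_i) > ε` (indices start at `0` here). -/
noncomputable def splitSet {r : ℕ} (c ε : ℝ) (d : Fin r → ℝ) : Finset (Fin r) :=
  Finset.univ.filter fun i => ∃ k : Fin r, (k : ℕ) + 1 = (i : ℕ) ∧ ε < c * (d k - d i)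

/-- The break points: `breakPt I 0 = 0`, then the elements of `I` in increasing order,
then `r`. -/
def breakPt {r : ℕ} (I : Finset (Fin r)) : ℕ → ℕ
  | 0 => 0
  | j + 1 => if h : j < I.card then ((I.orderEmbOfFin rfl ⟨j, h⟩ : Fin r) : ℕ) else r

/-- The smallest eigenvalue `d_r` satisfies `c d_r ≤ ε`. -/
def LastSmall {r : ℕ} (c ε : ℝ) (d : Fin r → ℝ) : Prop :=
  ∃ k : Fin r, (k : ℕ) + 1 = r ∧ c * d k ≤ ε

/-- The entry of `R i j` in row `a` and column `b` (with indices starting at `0`). -/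
def rotEntry (R : (i : ℕ) → ℕ → Matrix.orthogonalGroup (Fin i) ℝ) (i j a b : ℕ) : ℝ :=
  if h : a < i ∧ b < i then (R i j).1 ⟨a, h.1⟩ ⟨b, h.2⟩ else 0

open Classical in
/-- The block diagonal matrix whose `j`th diagonal block, for `j = 0, …, J = |I|`, occupies the
rows and columns from `breakPt I j` to `breakPt I (j + 1) - 1` and equals `R i j`, where `i` is the
length of the block; the last block is replaced by zero if `z` holds. -/
noncomputable def blockMatrix {r : ℕ} (I : Finset (Fin r)) (z : Prop)
    (R : (i : ℕ) → ℕ → Matrix.orthogonalGroup (Fin i) ℝ) : Matrix (Fin r) (Fin r) ℝ :=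
  Matrix.of fun a b => ∑ j ∈ Finset.range (I.card + 1),
    if (breakPt I j ≤ a ∧ (a : ℕ) < breakPt I (j + 1)) ∧
        (breakPt I j ≤ b ∧ (b : ℕ) < breakPt I (j + 1)) ∧ ¬ (j = I.card ∧ z) then
      rotEntry R (breakPt I (j + 1) - breakPt I j) j (a - breakPt I j) (b - breakPt I j)
    else 0

/-- The random rotation `R_ε`: a block diagonal matrix with one block for each group of close
eigenvalues; the block of the smallest eigenvalues is zero if the smallest one is too small. -/
noncomputable def blockRotation {r : ℕ} (c ε : ℝ) (d : Fin r → ℝ)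
    (R : (i : ℕ) → ℕ → Matrix.orthogonalGroup (Fin i) ℝ) : Matrix (Fin r) (Fin r) ℝ :=
  blockMatrix (splitSet c ε d) (LastSmall c ε d) R

/-- The index set of the random rotations: sizes `i = 1, …, r` and labels `j = 0, …, r - 1`. -/
abbrev RotIndex (r : ℕ) : Type := {p : ℕ × ℕ // 1 ≤ p.1 ∧ p.1 ≤ r ∧ p.2 < r}

/-- The random matrices `R i j`, for `1 ≤ i ≤ r` and `j < r`, are mutually independent, and `R i j`
is distributed according to the Haar (probability) measure on the orthogonal group `O(i)`. -/
structure IsHaarFamily {Ω : Type*} [MeasurableSpace Ω] (Q : Measure Ω) (r : ℕ)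
    (R : (i : ℕ) → ℕ → Ω → Matrix.orthogonalGroup (Fin i) ℝ) : Prop where
  measurable : ∀ p : RotIndex r, Measurable (R p.1.1 p.1.2)
  haar : ∀ p : RotIndex r, (Q.map (R p.1.1 p.1.2)).IsHaarMeasure
  indep : iIndepFun (fun (p : RotIndex r) => R p.1.1 p.1.2) Q

/-- The corrected estimator
`U D^{1/2} ((D^π)^{1/2})^+ R_ε (U^π)' θ^π` (all quantities being estimators). -/
noncomputable def corrected {r : ℕ} (c ε : ℝ) (U : Matrix (Fin r) (Fin r) ℝ) (d : Fin r → ℝ)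
    (Uπ : Matrix (Fin r) (Fin r) ℝ) (dπ : Fin r → ℝ)
    (R : (i : ℕ) → ℕ → Matrix.orthogonalGroup (Fin i) ℝ) (θπ : EuclideanSpace ℝ (Fin r)) :
    EuclideanSpace ℝ (Fin r) :=
  Matrix.toEuclideanCLM (𝕜 := ℝ)
    (U * diagSqrt d * diagSqrtPinv dπ * blockRotation c ε dπ R * Uπ.transpose) θπ

end PermCorr

/-! Let `l` and `D` be the decreasing eigenvalues of `Sigπ` and `Sig`, and let `V` hold eigenvectors
of `Sigπ`. The obstacle is that eigenvectors of an estimated covariance need not converge: at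
repeated eigenvalues they are determined only up to an orthogonal factor `B` commuting with
`diagonal l`. Haar rotations on the eigenspaces remove this ambiguity in law.

With probability tending to one, the rate recovers the true blocks of equal eigenvalues exactly
(`eventually_blockRotation_eq`). The estimated eigenvalues may then be replaced by their limits at
small cost, so that the corrected estimator is close to `A T W'` applied to the permutation
estimator, where `A = U D^{1/2} (l^{1/2})^+` is `frontMatrix`, `T` is `trueRotation` and `W` is the
estimated eigenvector matrix. By compactness, `W` is close to some `V B` (`exists_commute_near`).

Since the rotations are independent of the resampling, `T` can be integrated out first. This turns a
test function `h` into `rotAverage`, which is Lipschitz and invariant under every such `B`, because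
right translation by the blocks of `B` preserves Haar measure (`exists_rotation_mul`,
`rotAverage_commute`). Hence `W` may be replaced by the fixed matrix `V`, and the assumed limit law
applies. Under that law each rotation leaves `N(0, diagonal l)` unchanged up to coordinates of zero
variance, as `T diagonal l T' = diagonal l`; the result is `N(0, A diagonal l A')`. The rank
condition gives `A diagonal l A' = U diagonal D U'`, and this Gaussian is close to `N(0, Sig)`
because `U D^{1/2} U'` is insensitive to the choice of eigenvectors (`exists_sqrt_near`). All errors
are uniform over bounded Lipschitz test functions (`blDist_corrected_le`), which gives the supremum
part.

For the measurability part, the same approximation exhibits the estimator as a continuous function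
of the entries of `U`, `W`, `T` and a truncated permutation estimator. Each entry is approximable by
measurable functions in outer probability (`AsympApprox`), continuous functions preserve this on
bounded sets, and tightness (`CondWeakConv.exists_tight`) makes the truncation harmless. -/

namespace PermCorr

/-! ### Orthogonal matrices and perturbation of eigenvalue decompositions. -/

section LinearAlgebra

open Matrix
open scoped Matrix.Norms.L2Operator

variable {r : ℕ}

theorem mul_transpose_of_mem {U : Matrix (Fin r) (Fin r) ℝ}
    (hU : U ∈ Matrix.orthogonalGroup (Fin r) ℝ) : U * Uᵀ = 1 := by
  simpa [star_eq_conjTranspose] using (Matrix.mem_orthogonalGroup_iff _ _).1 hU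

theorem transpose_mul_of_mem {U : Matrix (Fin r) (Fin r) ℝ}
    (hU : U ∈ Matrix.orthogonalGroup (Fin r) ℝ) : Uᵀ * U = 1 := by
  simpa [star_eq_conjTranspose] using (Matrix.mem_orthogonalGroup_iff' _ _).1 hU

theorem mem_orthogonalGroup_of_mul_transpose {U : Matrix (Fin r) (Fin r) ℝ}
    (hU : U * Uᵀ = 1) : U ∈ Matrix.orthogonalGroup (Fin r) ℝ := by
  rw [Matrix.mem_orthogonalGroup_iff]
  simpa [star_eq_conjTranspose] using hU

theorem transpose_mem {U : Matrix (Fin r) (Fin r) ℝ}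
    (hU : U ∈ Matrix.orthogonalGroup (Fin r) ℝ) : Uᵀ ∈ Matrix.orthogonalGroup (Fin r) ℝ :=
  mem_orthogonalGroup_of_mul_transpose (by simpa using transpose_mul_of_mem hU)

theorem specNorm_eq (A : Matrix (Fin r) (Fin r) ℝ) : specNorm A = ‖A‖ := rfl

theorem norm_diagonal_le {v : Fin r → ℝ} {C : ℝ} (hC : 0 ≤ C) (h : ∀ i, |v i| ≤ C) :
    ‖(diagonal v : Matrix (Fin r) (Fin r) ℝ)‖ ≤ C := by
  rw [l2_opNorm_diagonal]
  exact (pi_norm_le_iff_of_nonneg hC).2 h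

theorem norm_transpose_eq (A : Matrix (Fin r) (Fin r) ℝ) : ‖Aᵀ‖ = ‖A‖ := by
  rw [← conjTranspose_eq_transpose_of_trivial, l2_opNorm_conjTranspose]

theorem norm_le_one_of_mem {U : Matrix (Fin r) (Fin r) ℝ}
    (hU : U ∈ Matrix.orthogonalGroup (Fin r) ℝ) : ‖U‖ ≤ 1 := by
  have h1 : ‖U‖ * ‖U‖ ≤ 1 := by
    rw [← l2_opNorm_conjTranspose_mul_self, conjTranspose_eq_transpose_of_trivial,
      transpose_mul_of_mem hU, ← diagonal_one]
    exact norm_diagonal_le zero_le_one (by simp)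
  nlinarith [norm_nonneg U]

theorem norm_toEuclideanCLM_apply_le (A : Matrix (Fin r) (Fin r) ℝ) (x : EuclideanSpace ℝ (Fin r)) :
    ‖toEuclideanCLM (𝕜 := ℝ) A x‖ ≤ ‖A‖ * ‖x‖ :=
  (toEuclideanCLM (𝕜 := ℝ) A).le_opNorm x

theorem toEuclideanCLM_mul_apply (A B : Matrix (Fin r) (Fin r) ℝ) (x : EuclideanSpace ℝ (Fin r)) :
    toEuclideanCLM (𝕜 := ℝ) (A * B) x = toEuclideanCLM (𝕜 := ℝ) A (toEuclideanCLM (𝕜 := ℝ) B x) := by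
  rw [map_mul]; rfl

theorem dotProduct_mulVec_le_norm (A : Matrix (Fin r) (Fin r) ℝ) (x : Fin r → ℝ) :
    x ⬝ᵥ A *ᵥ x ≤ ‖A‖ * (x ⬝ᵥ x) := by
  set y : EuclideanSpace ℝ (Fin r) := WithLp.toLp 2 x
  have h1 : x ⬝ᵥ A *ᵥ x = inner ℝ y (toEuclideanCLM (𝕜 := ℝ) A y) :=
    (inner_toEuclideanCLM A y y).symm
  have h2 : x ⬝ᵥ x = ‖y‖ * ‖y‖ := by
    rw [← sq, EuclideanSpace.real_norm_sq_eq]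
    simp [y, dotProduct, sq]
  rw [h1, h2]
  calc _ ≤ ‖y‖ * ‖toEuclideanCLM (𝕜 := ℝ) A y‖ := real_inner_le_norm _ _
    _ ≤ ‖y‖ * (‖A‖ * ‖y‖) := by gcongr; exact norm_toEuclideanCLM_apply_le A y
    _ = _ := by ring

theorem IsEigDecomp.dotProduct_mulVec {S U : Matrix (Fin r) (Fin r) ℝ} {d : Fin r → ℝ}
    (h : IsEigDecomp S U d) (x : Fin r → ℝ) :
    x ⬝ᵥ S *ᵥ x = ∑ k, d k * ((Uᵀ *ᵥ x) k) ^ 2 := by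
  rw [h.eq, ← mulVec_mulVec, ← mulVec_mulVec, Matrix.dotProduct_mulVec, ← mulVec_transpose]
  simp only [dotProduct, mulVec_diagonal]
  exact Finset.sum_congr rfl fun k _ => by ring

theorem dotProduct_transpose_mulVec {U : Matrix (Fin r) (Fin r) ℝ}
    (hU : U ∈ Matrix.orthogonalGroup (Fin r) ℝ) (x : Fin r → ℝ) :
    x ⬝ᵥ x = ∑ k, ((Uᵀ *ᵥ x) k) ^ 2 := by
  have : x ⬝ᵥ x = (Uᵀ *ᵥ x) ⬝ᵥ (Uᵀ *ᵥ x) := by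
    rw [Matrix.dotProduct_mulVec, vecMul_transpose, mulVec_mulVec, mul_transpose_of_mem hU,
      one_mulVec]
  rw [this]
  simp [dotProduct, sq]

/-- Courant–Fischer argument: by dimension count some nonzero `x` lies in the span of the leading
eigenvectors of `S` up to index `i` and is orthogonal to those of `S'` before `i`. Comparing the two
quadratic forms at `x` gives the bound. -/
theorem IsEigDecomp.sub_le {S U S' U' : Matrix (Fin r) (Fin r) ℝ} {d d' : Fin r → ℝ}
    (h : IsEigDecomp S U d) (h' : IsEigDecomp S' U' d') (i : Fin r) :
    d i - d' i ≤ ‖S - S'‖ := by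
  -- A kernel vector `y` of `N` holds the coordinates of `x` in the basis `U`. Rows before `i` force
  -- orthogonality to the columns of `U'`, rows after `i` kill the trailing coordinates, and the
  -- zero row `i` makes `N` singular.
  let N : Matrix (Fin r) (Fin r) ℝ := Matrix.of fun k l =>
    if k < i then (U'ᵀ * U) k l else if i < k then (1 : Matrix (Fin r) (Fin r) ℝ) k l else 0
  have hN : N.det = 0 := det_eq_zero_of_row_eq_zero i fun j => by simp [N]
  obtain ⟨y, hy, hNy⟩ := (Matrix.exists_mulVec_eq_zero_iff (M := N)).2 hN
  have hy1 : ∀ k, i < k → y k = 0 := by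
    intro k hk
    have := congrFun hNy k
    simpa [N, mulVec, dotProduct, hk, hk.not_gt, one_apply] using this
  have hy2 : ∀ k, k < i → (U'ᵀ *ᵥ (U *ᵥ y)) k = 0 := by
    intro k hk
    have := congrFun hNy k
    rw [mulVec_mulVec]
    simpa [N, mulVec, dotProduct, hk] using this
  set x := U *ᵥ y
  have hxy : Uᵀ *ᵥ x = y := by
    simp [x, mulVec_mulVec, transpose_mul_of_mem h.orthogonal]
  have e1 := h.dotProduct_mulVec x
  have e2 := h'.dotProduct_mulVec x
  have e3 := dotProduct_transpose_mulVec h.orthogonal x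
  have e4 := dotProduct_transpose_mulVec h'.orthogonal x
  rw [hxy] at e1 e3
  have hpos : 0 < x ⬝ᵥ x := by
    rw [e3]
    obtain ⟨k, hk⟩ := Function.ne_iff.1 hy
    exact Finset.sum_pos' (fun _ _ => sq_nonneg _) ⟨k, Finset.mem_univ _, by
      have : y k ≠ 0 := hk
      positivity⟩
  have i1 : d i * (x ⬝ᵥ x) ≤ x ⬝ᵥ S *ᵥ x := by
    rw [e1, e3, Finset.mul_sum]
    refine Finset.sum_le_sum fun k _ => ?_
    rcases le_or_gt k i with hk | hk
    · exact mul_le_mul_of_nonneg_right (h.antitone hk) (sq_nonneg _)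
    · simp [hy1 k hk]
  have i2 : x ⬝ᵥ S' *ᵥ x ≤ d' i * (x ⬝ᵥ x) := by
    rw [e2, e4, Finset.mul_sum]
    refine Finset.sum_le_sum fun k _ => ?_
    rcases lt_or_ge k i with hk | hk
    · simp [hy2 k hk]
    · exact mul_le_mul_of_nonneg_right (h'.antitone hk) (sq_nonneg _)
  have i3 := dotProduct_mulVec_le_norm (S - S') x
  rw [sub_mulVec, dotProduct_sub] at i3
  nlinarith

/-- Weyl's inequality. -/
theorem IsEigDecomp.abs_sub_le {S U S' U' : Matrix (Fin r) (Fin r) ℝ} {d d' : Fin r → ℝ}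
    (h : IsEigDecomp S U d) (h' : IsEigDecomp S' U' d') (i : Fin r) :
    |d i - d' i| ≤ ‖S - S'‖ := by
  rw [abs_sub_le_iff]
  exact ⟨h.sub_le h' i, by rw [norm_sub_rev]; exact h'.sub_le h i⟩

theorem isCompact_orthogonalGroup (r : ℕ) :
    IsCompact (Matrix.orthogonalGroup (Fin r) ℝ : Set (Matrix (Fin r) (Fin r) ℝ)) := by
  have : ProperSpace (Matrix (Fin r) (Fin r) ℝ) := FiniteDimensional.proper_real _
  refine Metric.isCompact_of_isClosed_isBounded ?_ ?_
  · have : (Matrix.orthogonalGroup (Fin r) ℝ : Set (Matrix (Fin r) (Fin r) ℝ)) =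
        {U | U * Uᵀ = 1} := by
      ext U
      exact ⟨mul_transpose_of_mem, mem_orthogonalGroup_of_mul_transpose⟩
    rw [this]
    exact isClosed_eq (by fun_prop) continuous_const
  · refine (Metric.isBounded_closedBall (x := (0 : Matrix (Fin r) (Fin r) ℝ)) (r := 1)).subset ?_
    intro U hU
    simpa using norm_le_one_of_mem hU

/-- Eigenvectors of a matrix close to `V Λ V'` with the same eigenvalues `Λ` are close to those
of `V Λ V'`, up to an orthogonal matrix that commutes with `Λ`. -/
theorem exists_commute_near {V : Matrix (Fin r) (Fin r) ℝ}
    (hV : V ∈ Matrix.orthogonalGroup (Fin r) ℝ) (l : Fin r → ℝ) {η : ℝ} (hη : 0 < η) :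
    ∃ δ > 0, ∀ W ∈ Matrix.orthogonalGroup (Fin r) ℝ,
      ‖W * diagonal l * Wᵀ - V * diagonal l * Vᵀ‖ < δ →
      ∃ B ∈ Matrix.orthogonalGroup (Fin r) ℝ, Commute B (diagonal l) ∧ ‖W - V * B‖ < η := by
  -- `K` collects the bad `W`. It is compact, and the perturbation norm is positive on it, since
  -- vanishing would make `V' W` an admissible `B` with error zero; `δ` is the minimum over `K`.
  set K : Set (Matrix (Fin r) (Fin r) ℝ) :=
    (Matrix.orthogonalGroup (Fin r) ℝ : Set (Matrix (Fin r) (Fin r) ℝ)) ∩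
      ⋂ B ∈ {B | B ∈ Matrix.orthogonalGroup (Fin r) ℝ ∧ Commute B (diagonal l)},
        {W | η ≤ ‖W - V * B‖} with hK
  have hKc : IsCompact K := by
    refine (isCompact_orthogonalGroup r).inter_right ?_
    refine isClosed_biInter fun B _ => isClosed_le continuous_const ?_
    fun_prop
  have hpos : ∀ W ∈ K, 0 < ‖W * diagonal l * Wᵀ - V * diagonal l * Vᵀ‖ := by
    rintro W ⟨hW, hWB⟩
    rw [norm_pos_iff, sub_ne_zero]
    intro heq
    have hB : Vᵀ * W ∈ Matrix.orthogonalGroup (Fin r) ℝ := mul_mem (transpose_mem hV) hW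
    have hcomm : Commute (Vᵀ * W) (diagonal l) := by
      show Vᵀ * W * diagonal l = diagonal l * (Vᵀ * W)
      have := congrArg (fun A => Vᵀ * A * W) heq
      simp only [Matrix.mul_assoc, transpose_mul_of_mem (show W ∈ _ from hW), Matrix.mul_one] at this
      rw [Matrix.mul_assoc, this, ← Matrix.mul_assoc Vᵀ V, transpose_mul_of_mem hV, Matrix.one_mul]
    have h1 := Set.mem_iInter₂.1 hWB (Vᵀ * W) ⟨hB, hcomm⟩
    simp only [Set.mem_ofPred_eq, ← Matrix.mul_assoc, mul_transpose_of_mem hV, Matrix.one_mul,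
      sub_self, norm_zero] at h1
    linarith
  have key : ∃ δ > 0, ∀ W ∈ K, δ ≤ ‖W * diagonal l * Wᵀ - V * diagonal l * Vᵀ‖ := by
    rcases K.eq_empty_or_nonempty with h0 | h0
    · exact ⟨1, one_pos, by simp [h0]⟩
    · obtain ⟨W, hW, hmin⟩ := hKc.exists_isMinOn h0
        (f := fun W => ‖W * diagonal l * Wᵀ - V * diagonal l * Vᵀ‖) (by fun_prop)
      exact ⟨_, hpos W hW, fun W' hW' => hmin hW'⟩
  obtain ⟨δ, hδ, hδK⟩ := key
  refine ⟨δ, hδ, fun W hW hlt => ?_⟩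
  by_contra! hcon
  exact absurd (hδK W ⟨hW, Set.mem_iInter₂.2 fun B hB => hcon B hB.1 hB.2⟩) (not_le.2 hlt)

theorem IsEigDecomp.nonneg {S U : Matrix (Fin r) (Fin r) ℝ} {d : Fin r → ℝ}
    (h : IsEigDecomp S U d) (hS : S.PosSemidef) (i : Fin r) : 0 ≤ d i := by
  have h1 := hS.dotProduct_mulVec_nonneg (U *ᵥ Pi.single i 1)
  simp only [star_trivial] at h1
  rw [h.dotProduct_mulVec, mulVec_mulVec, transpose_mul_of_mem h.orthogonal, one_mulVec,
    Finset.sum_eq_single i] at h1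
  · simpa using h1
  · intro k _ hk
    simp [hk]
  · simp

theorem exists_isEigDecomp {S : Matrix (Fin r) (Fin r) ℝ} (hS : S.PosSemidef) :
    ∃ U d, IsEigDecomp S U d := by
  have hH := hS.isHermitian
  set σ : Equiv.Perm (Fin r) := Tuple.sort fun i => - hH.eigenvalues i
  have hσ : Monotone ((fun i => - hH.eigenvalues i) ∘ σ) := Tuple.monotone_sort _
  set U : Matrix (Fin r) (Fin r) ℝ := hH.eigenvectorUnitary.1
  have hU : U ∈ Matrix.orthogonalGroup (Fin r) ℝ := hH.eigenvectorUnitary.2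
  have hsp : S = U * diagonal hH.eigenvalues * Uᵀ := by
    have := hH.spectral_theorem
    rw [Unitary.conjStarAlgAut_apply] at this
    simpa [star_eq_conjTranspose, U, Function.comp_def] using this
  refine ⟨U.submatrix id σ, hH.eigenvalues ∘ σ, ?_, ?_, ?_⟩
  · apply mem_orthogonalGroup_of_mul_transpose
    rw [transpose_submatrix, submatrix_mul_equiv, mul_transpose_of_mem hU]
    simp
  · intro i j hij
    have := hσ hij
    simpa using this
  · have : diagonal (hH.eigenvalues ∘ σ) = (diagonal hH.eigenvalues).submatrix σ σ := by
      rw [submatrix_diagonal_equiv]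
    rw [this, transpose_submatrix, submatrix_mul_equiv, submatrix_mul_equiv, ← hsp]
    simp

theorem IsEigDecomp.rank_eq {S U : Matrix (Fin r) (Fin r) ℝ} {d : Fin r → ℝ}
    (h : IsEigDecomp S U d) : S.rank = Fintype.card {i // d i ≠ 0} := by
  have hdet : ∀ {W : Matrix (Fin r) (Fin r) ℝ}, W ∈ Matrix.orthogonalGroup (Fin r) ℝ →
      IsUnit W.det := fun {W} hW => by
    have := congrArg det (mul_transpose_of_mem hW)
    rw [det_mul, det_one] at this
    exact IsUnit.of_mul_eq_one _ this
  rw [h.eq, rank_mul_eq_left_of_isUnit_det _ _ (hdet (transpose_mem h.orthogonal)),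
    rank_mul_eq_right_of_isUnit_det _ _ (hdet h.orthogonal), rank_diagonal]

/-- With decreasing nonnegative eigenvalues, a nonzero one at `i` forces rank at least `i + 1`,
while a zero one at `i` forces rank at most `i`. -/
theorem eigenvalue_ne_zero_of_rank_le {S U S' U' : Matrix (Fin r) (Fin r) ℝ} {d d' : Fin r → ℝ}
    (h : IsEigDecomp S U d) (h' : IsEigDecomp S' U' d') (hS : S.PosSemidef) (hS' : S'.PosSemidef)
    (hrank : S.rank ≤ S'.rank) (i : Fin r) (hi : d i ≠ 0) : d' i ≠ 0 := by
  intro hi'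
  rw [h.rank_eq, h'.rank_eq, Fintype.card_subtype, Fintype.card_subtype] at hrank
  have h1 : Finset.Iic i ⊆ Finset.univ.filter fun k => d k ≠ 0 := by
    intro k hk
    have hk' := h.antitone (Finset.mem_Iic.1 hk)
    have : 0 < d i := lt_of_le_of_ne (h.nonneg hS i) hi.symm
    simpa using (this.trans_le hk').ne'
  have h2 : (Finset.univ.filter fun k => d' k ≠ 0) ⊆ Finset.Iio i := by
    intro k hk
    by_contra hcon
    have hk' := h'.antitone (not_lt.1 (by simpa using hcon) : i ≤ k)
    have := h'.nonneg hS' k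
    exact (Finset.mem_filter.1 hk).2 (by linarith)
  have := (Finset.card_le_card h1).trans (hrank.trans (Finset.card_le_card h2))
  simp at this

end LinearAlgebra

/-! ### Algebra of block diagonal matrices with orthogonal blocks. -/

section Blocks

open Matrix

variable {r : ℕ} {I : Finset (Fin r)}

theorem breakPt_zero (I : Finset (Fin r)) : breakPt I 0 = 0 := rfl

theorem breakPt_card_succ (I : Finset (Fin r)) : breakPt I (I.card + 1) = r := by
  simp [breakPt]

theorem breakPt_succ_of_lt {j : ℕ} (h : j < I.card) :
    breakPt I (j + 1) = (I.orderEmbOfFin rfl ⟨j, h⟩ : Fin r) := by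
  simp [breakPt, h]

theorem breakPt_lt_succ (hr : 1 ≤ r) (hI : ∀ i ∈ I, (i : ℕ) ≠ 0) {j : ℕ} (hj : j ≤ I.card) :
    breakPt I j < breakPt I (j + 1) := by
  rcases j with _ | j
  · rw [breakPt_zero]
    by_cases h : 0 < I.card
    · rw [breakPt_succ_of_lt h]
      exact Nat.pos_of_ne_zero (hI _ (Finset.orderEmbOfFin_mem _ _ _))
    · simp only [breakPt, h, dite_false]
      omega
  · rw [breakPt_succ_of_lt (by omega : j < I.card)]
    by_cases h : j + 1 < I.card
    · rw [breakPt_succ_of_lt h]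
      exact (I.orderEmbOfFin rfl).strictMono (by simp)
    · simp only [breakPt, h, dite_false]
      exact Fin.isLt _

theorem breakPt_le_of_le (hr : 1 ≤ r) (hI : ∀ i ∈ I, (i : ℕ) ≠ 0) {j k : ℕ} (hjk : j ≤ k)
    (hk : k ≤ I.card + 1) : breakPt I j ≤ breakPt I k := by
  induction k, hjk using Nat.le_induction with
  | base => exact le_rfl
  | succ k hjk ih => exact (ih (by omega)).trans (breakPt_lt_succ hr hI (by omega)).le

theorem breakPt_le (hr : 1 ≤ r) (hI : ∀ i ∈ I, (i : ℕ) ≠ 0) {j : ℕ} (hj : j ≤ I.card + 1) :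
    breakPt I j ≤ r :=
  (breakPt_le_of_le hr hI hj le_rfl).trans (breakPt_card_succ I).le

theorem exists_breakPt_eq {i : Fin r} (hi : i ∈ I) :
    ∃ j < I.card, breakPt I (j + 1) = i := by
  have : i ∈ Set.range (I.orderEmbOfFin rfl) := by simpa using hi
  obtain ⟨j, rfl⟩ := this
  exact ⟨j, j.2, breakPt_succ_of_lt j.2⟩

/-- The index `a` belongs to the `j`th block. -/
def InBlock (I : Finset (Fin r)) (j : ℕ) (a : Fin r) : Prop :=
  breakPt I j ≤ a ∧ (a : ℕ) < breakPt I (j + 1)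

theorem exists_inBlock (I : Finset (Fin r)) (a : Fin r) : ∃ j ≤ I.card, InBlock I j a := by
  have key : ∀ m ≤ I.card + 1, (a : ℕ) < breakPt I m → ∃ j < m, InBlock I j a := by
    intro m
    induction m with
    | zero => intro _ h; simp [breakPt_zero] at h
    | succ m ih =>
      intro hm h
      by_cases h' : (a : ℕ) < breakPt I m
      · obtain ⟨j, hj, hj'⟩ := ih (by omega) h'
        exact ⟨j, by omega, hj'⟩
      · exact ⟨m, by omega, not_lt.1 h', h⟩
  obtain ⟨j, hj, hj'⟩ := key _ le_rfl (by rw [breakPt_card_succ]; exact a.2)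
  exact ⟨j, by omega, hj'⟩

theorem inBlock_unique (hr : 1 ≤ r) (hI : ∀ i ∈ I, (i : ℕ) ≠ 0) {a : Fin r} {j k : ℕ}
    (hj : j ≤ I.card) (hk : k ≤ I.card) (hja : InBlock I j a) (hka : InBlock I k a) : j = k := by
  rcases lt_trichotomy j k with h | h | h
  · have := breakPt_le_of_le hr hI (Nat.succ_le_of_lt h) (by omega)
    have := hja.2
    have := hka.1
    simp only [Nat.succ_eq_add_one] at *
    omega
  · exact h
  · have := breakPt_le_of_le hr hI (Nat.succ_le_of_lt h) (by omega)
    have := hja.1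
    have := hka.2
    simp only [Nat.succ_eq_add_one] at *
    omega

-- The blocks partition the indices, so only the block containing the row contributes to the
-- defining sum.
open Classical in
theorem blockMatrix_apply (hr : 1 ≤ r) (hI : ∀ i ∈ I, (i : ℕ) ≠ 0) (z : Prop)
    (R : (i : ℕ) → ℕ → Matrix.orthogonalGroup (Fin i) ℝ) {a : Fin r} (b : Fin r) {j : ℕ}
    (hj : j ≤ I.card) (ha : InBlock I j a) :
    blockMatrix I z R a b = if InBlock I j b ∧ ¬ (j = I.card ∧ z) then
      rotEntry R (breakPt I (j + 1) - breakPt I j) j (a - breakPt I j) (b - breakPt I j) else 0 := by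
  simp only [blockMatrix, of_apply]
  rw [Finset.sum_eq_single j]
  · have ha' : breakPt I j ≤ a ∧ (a : ℕ) < breakPt I (j + 1) := ha
    simp only [InBlock, ha', and_self, true_and]
    congr
  · intro k hk hkj
    rw [if_neg]
    intro h
    exact hkj (inBlock_unique hr hI (by simpa [Nat.lt_succ_iff] using hk) hj h.1 ha)
  · intro h
    simp at h
    omega

theorem rotEntry_mul (R R' : (i : ℕ) → ℕ → Matrix.orthogonalGroup (Fin i) ℝ) {i j a b : ℕ}
    (ha : a < i) (hb : b < i) :
    rotEntry (R * R') i j a b = ∑ k : Fin i, rotEntry R i j a k * rotEntry R' i j k b := by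
  simp [rotEntry, ha, hb, Matrix.mul_apply]

theorem rotEntry_inv (R : (i : ℕ) → ℕ → Matrix.orthogonalGroup (Fin i) ℝ) (i j a b : ℕ) :
    rotEntry R⁻¹ i j a b = rotEntry R i j b a := by
  by_cases h : a < i ∧ b < i
  · simp [rotEntry, h]
  · have h' : ¬ (b < i ∧ a < i) := fun h' => h h'.symm
    simp only [rotEntry, h, h', dite_false]

theorem InBlock.sub_lt {j : ℕ} {a : Fin r} (h : InBlock I j a) :
    (a : ℕ) - breakPt I j < breakPt I (j + 1) - breakPt I j := by
  have := h.1
  have := h.2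
  omega

/-- A sum over the indices in a block. -/
theorem sum_inBlock (hr : 1 ≤ r) (hI : ∀ i ∈ I, (i : ℕ) ≠ 0) {j : ℕ} (hj : j ≤ I.card)
    (f : Fin r → ℝ) (hf : ∀ c, ¬ InBlock I j c → f c = 0) :
    ∑ c, f c = ∑ k : Fin (breakPt I (j + 1) - breakPt I j), f ⟨breakPt I j + k, by
      have := breakPt_le hr hI (by omega : j + 1 ≤ I.card + 1); omega⟩ := by
  symm
  refine Fintype.sum_of_injective (fun k : Fin (breakPt I (j + 1) - breakPt I j) =>
    (⟨breakPt I j + k, by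
      have := breakPt_le hr hI (by omega : j + 1 ≤ I.card + 1); omega⟩ : Fin r)) ?_ _ _ ?_ ?_
  · intro k k' h
    simp only [Fin.mk.injEq] at h
    exact Fin.ext (by omega)
  · intro c hc
    refine hf c fun hcb => hc ⟨⟨c - breakPt I j, hcb.sub_lt⟩, ?_⟩
    have := hcb.1
    exact Fin.ext (by simp only; omega)
  · intro k
    rfl

/-- Both factors share the same partition, so blocks multiply separately; the last block of the
product is zero as soon as one factor has it zero. -/
theorem blockMatrix_mul (hr : 1 ≤ r) (hI : ∀ i ∈ I, (i : ℕ) ≠ 0) (z z' : Prop)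
    (R R' : (i : ℕ) → ℕ → Matrix.orthogonalGroup (Fin i) ℝ) :
    blockMatrix I z R * blockMatrix I z' R' = blockMatrix I (z ∨ z') (R * R') := by
  classical
  ext a b
  obtain ⟨j, hj, ha⟩ := exists_inBlock I a
  rw [blockMatrix_apply hr hI _ _ b hj ha, Matrix.mul_apply]
  by_cases hz : j = I.card ∧ z
  · rw [if_neg (by tauto)]
    refine Finset.sum_eq_zero fun c _ => ?_
    rw [blockMatrix_apply hr hI _ _ c hj ha, if_neg (by tauto), zero_mul]
  by_cases hz' : (j = I.card ∧ z') ∨ ¬ InBlock I j b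
  · rw [if_neg (by tauto)]
    refine Finset.sum_eq_zero fun c _ => ?_
    by_cases hc : InBlock I j c
    · rw [blockMatrix_apply hr hI z' _ b hj hc, if_neg (by tauto), mul_zero]
    · rw [blockMatrix_apply hr hI _ _ c hj ha, if_neg (by tauto), zero_mul]
  push Not at hz'
  have hb := hz'.2
  rw [if_pos (by tauto), rotEntry_mul _ _ ha.sub_lt hb.sub_lt, sum_inBlock hr hI hj]
  · refine Finset.sum_congr rfl fun k _ => ?_
    have hk : InBlock I j ⟨breakPt I j + k, by
        have := breakPt_le hr hI (by omega : j + 1 ≤ I.card + 1); omega⟩ :=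
      ⟨by simp, by simp only; omega⟩
    rw [blockMatrix_apply hr hI _ _ _ hj ha, blockMatrix_apply hr hI _ _ _ hj hk,
      if_pos ⟨hk, hz⟩, if_pos ⟨hb, by tauto⟩]
    simp
  · intro c hc
    rw [blockMatrix_apply hr hI _ _ c hj ha, if_neg (by tauto), zero_mul]

theorem blockMatrix_transpose (I : Finset (Fin r)) (z : Prop)
    (R : (i : ℕ) → ℕ → Matrix.orthogonalGroup (Fin i) ℝ) :
    (blockMatrix I z R)ᵀ = blockMatrix I z R⁻¹ := by
  classical
  ext a b
  simp only [blockMatrix, transpose_apply, of_apply, rotEntry_inv]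
  refine Finset.sum_congr rfl fun j _ => ?_
  congr 1
  exact propext ⟨fun h => ⟨h.2.1, h.1, h.2.2⟩, fun h => ⟨h.2.1, h.1, h.2.2⟩⟩

open Classical in
theorem blockMatrix_one (hr : 1 ≤ r) (hI : ∀ i ∈ I, (i : ℕ) ≠ 0) (z : Prop) :
    blockMatrix I z 1 =
      diagonal fun a => if InBlock I I.card a ∧ z then (0 : ℝ) else 1 := by
  ext a b
  obtain ⟨j, hj, ha⟩ := exists_inBlock I a
  rw [blockMatrix_apply hr hI _ _ b hj ha]
  have hlast : InBlock I I.card a ↔ j = I.card :=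
    ⟨fun h => inBlock_unique hr hI hj le_rfl ha h, fun h => h ▸ ha⟩
  by_cases hab : a = b
  · subst hab
    rw [diagonal_apply_eq]
    have := ha.sub_lt
    by_cases hz : j = I.card ∧ z
    · simp [hlast, hz]
    · simp [hlast, hz, ha, rotEntry, this]
  · rw [diagonal_apply_ne _ hab]
    split_ifs with h
    · have h1 := ha.sub_lt
      have h2 := h.1.sub_lt
      have h3 := ha.1
      have h4 := h.1.1
      have h5 : (a : ℕ) - breakPt I j ≠ b - breakPt I j := fun h6 => hab (Fin.ext (by omega))
      simp [rotEntry, h1, h2, one_apply, h5]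
    · rfl

/-- Extension of a family of rotations by the identity. -/
noncomputable def extendRot (ρ : (p : RotIndex r) → Matrix.orthogonalGroup (Fin p.1.1) ℝ) :
    (i : ℕ) → ℕ → Matrix.orthogonalGroup (Fin i) ℝ := fun i j =>
  if h : 1 ≤ i ∧ i ≤ r ∧ j < r then ρ ⟨(i, j), h⟩ else 1

theorem card_lt (hr : 1 ≤ r) (hI : ∀ i ∈ I, (i : ℕ) ≠ 0) : I.card < r := by
  have : I ⊂ Finset.univ := by
    refine Finset.ssubset_univ_iff.2 fun h => ?_
    exact hI ⟨0, hr⟩ (h ▸ Finset.mem_univ _) rfl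
  simpa using Finset.card_lt_card this

/-- No break point in `I` is `0`, so there are at most `r` blocks, each nonempty. Hence only sizes
from `1` to `r` and labels below `r` are ever read. -/
theorem blockMatrix_congr (hr : 1 ≤ r) (hI : ∀ i ∈ I, (i : ℕ) ≠ 0) (z : Prop)
    {R R' : (i : ℕ) → ℕ → Matrix.orthogonalGroup (Fin i) ℝ}
    (h : ∀ p : RotIndex r, R p.1.1 p.1.2 = R' p.1.1 p.1.2) :
    blockMatrix I z R = blockMatrix I z R' := by
  classical
  ext a b
  obtain ⟨j, hj, ha⟩ := exists_inBlock I a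
  rw [blockMatrix_apply hr hI _ _ b hj ha, blockMatrix_apply hr hI _ _ b hj ha]
  have h1 := ha.sub_lt
  have h2 := breakPt_le hr hI (by omega : j + 1 ≤ I.card + 1)
  have h3 := card_lt hr hI
  have := h ⟨(breakPt I (j + 1) - breakPt I j, j), by omega, by omega, by omega⟩
  simp only at this
  simp only [rotEntry, this]

theorem blockMatrix_extendRot (hr : 1 ≤ r) (hI : ∀ i ∈ I, (i : ℕ) ≠ 0) (z : Prop)
    (R : (i : ℕ) → ℕ → Matrix.orthogonalGroup (Fin i) ℝ) :
    blockMatrix I z (extendRot fun p : RotIndex r => R p.1.1 p.1.2) = blockMatrix I z R :=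
  blockMatrix_congr hr hI z fun p => by simp [extendRot, p.2.1, p.2.2.1, p.2.2.2]

theorem measurable_matrix {α m k : Type*} [MeasurableSpace α] {f : α → Matrix m k ℝ}
    (hf : ∀ i j, Measurable fun x => f x i j) : Measurable f :=
  measurable_pi_iff.2 fun i => measurable_pi_iff.2 fun j => hf i j

theorem measurable_matrix_entry {m k : Type*} (i : m) (j : k) :
    Measurable fun A : Matrix m k ℝ => A i j :=
  (measurable_pi_apply j).comp (measurable_pi_apply (X := fun _ : m => k → ℝ) i)

theorem measurable_blockMatrix_extendRot (I : Finset (Fin r)) (z : Prop) :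
    Measurable fun ρ : (p : RotIndex r) → Matrix.orthogonalGroup (Fin p.1.1) ℝ =>
      blockMatrix I z (extendRot ρ) := by
  classical
  refine measurable_matrix fun a b => ?_
  simp only [blockMatrix, of_apply]
  refine Finset.measurable_sum _ fun j _ => ?_
  refine Measurable.ite (MeasurableSet.const _) ?_ measurable_const
  unfold rotEntry
  split_ifs with h
  · unfold extendRot
    split_ifs with h'
    · exact (measurable_matrix_entry _ _).comp (measurable_subtype_coe.comp (measurable_pi_apply _))
    · exact measurable_const
  · exact measurable_const

theorem abs_blockMatrix_le (hr : 1 ≤ r) (hI : ∀ i ∈ I, (i : ℕ) ≠ 0) (z : Prop)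
    (R : (i : ℕ) → ℕ → Matrix.orthogonalGroup (Fin i) ℝ) (a b : Fin r) :
    |blockMatrix I z R a b| ≤ 1 := by
  classical
  obtain ⟨j, hj, ha⟩ := exists_inBlock I a
  rw [blockMatrix_apply hr hI _ _ b hj ha]
  split_ifs with h
  · rw [rotEntry, dif_pos ⟨ha.sub_lt, h.1.sub_lt⟩]
    exact entry_norm_bound_of_unitary (R _ j).2 _ _
  · simp

end Blocks

/-! ### The block structure of the limiting eigenvalues. -/

section TrueSplits

open Matrix

variable {r : ℕ}

open Classical in
/-- The indices at which the decreasing sequence `l` jumps. -/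
noncomputable def jumpSet (l : Fin r → ℝ) : Finset (Fin r) :=
  Finset.univ.filter fun i => ∃ k : Fin r, (k : ℕ) + 1 = (i : ℕ) ∧ l i < l k

/-- The last entry of `l` vanishes. -/
def LastZero (l : Fin r → ℝ) : Prop := ∃ k : Fin r, (k : ℕ) + 1 = r ∧ l k = 0

variable {l : Fin r → ℝ}

theorem jumpSet_ne_zero : ∀ i ∈ jumpSet l, (i : ℕ) ≠ 0 := by
  intro i hi
  obtain ⟨k, hk, -⟩ := (Finset.mem_filter.1 hi).2
  omega

theorem eq_of_inBlock_jumpSet_of_le (hr : 1 ≤ r) (hl : Antitone l) {j : ℕ} {a b : Fin r}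
    (hj : j ≤ (jumpSet l).card) (ha : InBlock (jumpSet l) j a) (hb : InBlock (jumpSet l) j b)
    (hab : a ≤ b) : l a = l b := by
  -- A strict drop between neighbours would be a jump, hence a break point after `a` and no later
  -- than `b`, which a common block excludes.
  have key : ∀ m : ℕ, ∀ hm : m < r, (a : ℕ) ≤ m → m ≤ b → l a = l ⟨m, hm⟩ := by
    intro m hm ham
    induction m, ham using Nat.le_induction with
    | base => intro _; rfl
    | succ m ham ih =>
      intro hmb
      rw [ih (by omega) (by omega)]
      refine le_antisymm ?_ (hl (by simp))
      by_contra! hcon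
      have hmem : (⟨m + 1, hm⟩ : Fin r) ∈ jumpSet l :=
        Finset.mem_filter.2 ⟨Finset.mem_univ _, ⟨m, by omega⟩, rfl, hcon⟩
      obtain ⟨k, hk, hkm⟩ := exists_breakPt_eq hmem
      simp only at hkm
      have h1 := ha.1
      have h2 := hb.2
      rcases le_or_gt (k + 1) j with h | h
      · have := breakPt_le_of_le hr (jumpSet_ne_zero (l := l)) h (by omega)
        omega
      · have := breakPt_le_of_le hr (jumpSet_ne_zero (l := l)) (Nat.succ_le_of_lt h) (by omega)
        simp only [Nat.succ_eq_add_one] at this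
        omega
  exact key b b.2 hab le_rfl

theorem eq_of_inBlock_jumpSet (hr : 1 ≤ r) (hl : Antitone l) {j : ℕ} {a b : Fin r}
    (hj : j ≤ (jumpSet l).card) (ha : InBlock (jumpSet l) j a) (hb : InBlock (jumpSet l) j b) :
    l a = l b := by
  rcases le_total a b with h | h
  · exact eq_of_inBlock_jumpSet_of_le hr hl hj ha hb h
  · exact (eq_of_inBlock_jumpSet_of_le hr hl hj hb ha h).symm

theorem lt_of_inBlock_jumpSet (hr : 1 ≤ r) (hl : Antitone l) {j k : ℕ} {a b : Fin r}
    (hk : k ≤ (jumpSet l).card) (ha : InBlock (jumpSet l) j a) (hb : InBlock (jumpSet l) k b)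
    (hjk : j < k) : l b < l a := by
  have hj' : j < (jumpSet l).card := by omega
  set i := (jumpSet l).orderEmbOfFin rfl ⟨j, hj'⟩ with hi
  have hib : breakPt (jumpSet l) (j + 1) = i := breakPt_succ_of_lt hj'
  have hmem : i ∈ jumpSet l := Finset.orderEmbOfFin_mem _ _ _
  obtain ⟨m, hm, hlt⟩ := (Finset.mem_filter.1 hmem).2
  have h1 := ha.2
  have h2 := breakPt_le_of_le hr (jumpSet_ne_zero (l := l)) (Nat.succ_le_of_lt hjk) (by omega)
  have h3 := hb.1
  simp only [Nat.succ_eq_add_one] at h2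
  have h4 : l m ≤ l a := hl (Fin.le_def.2 (by omega))
  have h5 : l b ≤ l i := hl (Fin.le_def.2 (by omega))
  linarith

theorem inBlock_jumpSet_of_eq (hr : 1 ≤ r) (hl : Antitone l) {j : ℕ} {a b : Fin r}
    (hj : j ≤ (jumpSet l).card) (ha : InBlock (jumpSet l) j a) (hab : l a = l b) :
    InBlock (jumpSet l) j b := by
  obtain ⟨k, hk, hb⟩ := exists_inBlock (jumpSet l) b
  rcases lt_trichotomy j k with h | h | h
  · exact absurd hab (lt_of_inBlock_jumpSet hr hl hk ha hb h).ne'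
  · exact h ▸ hb
  · exact absurd hab (lt_of_inBlock_jumpSet hr hl hj hb ha h).ne

/-- For a decreasing nonnegative sequence the zeros, if any, form exactly the last block. Zeroing
that block in the rotation therefore removes precisely the kernel directions. -/
theorem inBlock_last_and_lastZero_iff (hr : 1 ≤ r) (hl : Antitone l) (hl0 : ∀ i, 0 ≤ l i)
    (a : Fin r) : (InBlock (jumpSet l) (jumpSet l).card a ∧ LastZero l) ↔ l a = 0 := by
  set m : Fin r := ⟨r - 1, by omega⟩ with hm
  have hmb : InBlock (jumpSet l) (jumpSet l).card m := by
    refine ⟨?_, by rw [breakPt_card_succ]; exact m.2⟩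
    have h1 := breakPt_lt_succ hr (jumpSet_ne_zero (l := l)) (le_refl _)
    rw [breakPt_card_succ] at h1
    simp only [hm]
    omega
  have hlz : LastZero l ↔ l m = 0 := by
    constructor
    · rintro ⟨k, hk, hk0⟩
      have : k = m := Fin.ext (by simp only [hm]; omega)
      exact this ▸ hk0
    · exact fun h => ⟨m, by simp only [hm]; omega, h⟩
  rw [hlz]
  constructor
  · rintro ⟨ha, h0⟩
    rw [eq_of_inBlock_jumpSet hr hl le_rfl ha hmb, h0]
  · intro h0
    have hm0 : l m = 0 := le_antisymm ((hl (Fin.le_def.2 (by simp only [hm]; omega))).trans h0.le)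
      (hl0 m)
    exact ⟨inBlock_jumpSet_of_eq hr hl le_rfl hmb (hm0.trans h0.symm), hm0⟩

/-- The block rotation that belongs to the true eigenvalues `l`. -/
noncomputable def trueRotation (l : Fin r → ℝ)
    (R : (i : ℕ) → ℕ → Matrix.orthogonalGroup (Fin i) ℝ) : Matrix (Fin r) (Fin r) ℝ :=
  blockMatrix (jumpSet l) (LastZero l) R

theorem trueRotation_ne_zero (hr : 1 ≤ r) (hl : Antitone l) (hl0 : ∀ i, 0 ≤ l i)
    (R : (i : ℕ) → ℕ → Matrix.orthogonalGroup (Fin i) ℝ) {a b : Fin r}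
    (h : trueRotation l R a b ≠ 0) : l a = l b ∧ l a ≠ 0 := by
  classical
  obtain ⟨j, hj, ha⟩ := exists_inBlock (jumpSet l) a
  rw [trueRotation, blockMatrix_apply hr jumpSet_ne_zero _ _ b hj ha] at h
  split_ifs at h with h'
  · refine ⟨eq_of_inBlock_jumpSet hr hl hj ha h'.1, fun h0 => ?_⟩
    obtain ⟨h1, h2⟩ := (inBlock_last_and_lastZero_iff hr hl hl0 a).2 h0
    exact h'.2 ⟨inBlock_unique hr jumpSet_ne_zero hj le_rfl ha h1, h2⟩
  · exact absurd rfl h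

/-- The rotation mixes only equal eigenvalues, so it commutes with `diagonal l`. Its product with
its transpose is the projection onto the nonzero eigenvalues, which does not change `diagonal l`. -/
theorem trueRotation_mul_diagonal_mul_transpose (hr : 1 ≤ r) (hl : Antitone l)
    (hl0 : ∀ i, 0 ≤ l i) (R : (i : ℕ) → ℕ → Matrix.orthogonalGroup (Fin i) ℝ) :
    trueRotation l R * diagonal l * (trueRotation l R)ᵀ = diagonal l := by
  classical
  have hcomm : trueRotation l R * diagonal l = diagonal l * trueRotation l R := by
    ext a b
    rw [mul_diagonal, diagonal_mul]
    by_cases h : trueRotation l R a b = 0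
    · simp [h]
    · rw [(trueRotation_ne_zero hr hl hl0 R h).1, mul_comm]
  rw [hcomm, Matrix.mul_assoc, trueRotation, blockMatrix_transpose,
    blockMatrix_mul hr jumpSet_ne_zero, mul_inv_cancel, blockMatrix_one hr jumpSet_ne_zero,
    diagonal_mul_diagonal]
  congr 1
  ext a
  simp only [or_self, inBlock_last_and_lastZero_iff hr hl hl0 a]
  split_ifs with h <;> simp [h]

/-- An orthogonal matrix that commutes with `diagonal l` can be absorbed into the rotations. -/
theorem exists_rotation_mul (hr : 1 ≤ r) (hl : Antitone l) {B : Matrix (Fin r) (Fin r) ℝ}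
    (hB : B ∈ Matrix.orthogonalGroup (Fin r) ℝ) (hBl : Commute B (diagonal l)) :
    ∃ O : (i : ℕ) → ℕ → Matrix.orthogonalGroup (Fin i) ℝ, ∀ R,
      trueRotation l R * B = trueRotation l (R * O) := by
  classical
  set I := jumpSet l with hIdef
  have hI : ∀ i ∈ I, (i : ℕ) ≠ 0 := jumpSet_ne_zero
  -- Commuting with `diagonal l` makes `B` block diagonal with respect to the jumps of `l`; its
  -- diagonal blocks are then orthogonal.
  have hB0 : ∀ a b, l a ≠ l b → B a b = 0 := by
    intro a b hab
    have := congrFun (congrFun hBl.eq a) b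
    rw [mul_diagonal, diagonal_mul] at this
    have h2 : B a b * (l b - l a) = 0 := by linarith
    exact (mul_eq_zero.1 h2).resolve_right (sub_ne_zero.2 hab.symm)
  have hbound : ∀ {j : ℕ}, j ≤ I.card → ∀ k : Fin (breakPt I (j + 1) - breakPt I j),
      breakPt I j + k < r := fun {j} hj k => by
    have := breakPt_le hr hI (by omega : j + 1 ≤ I.card + 1); omega
  let sub : (j : ℕ) → j ≤ I.card → Matrix (Fin (breakPt I (j + 1) - breakPt I j))
      (Fin (breakPt I (j + 1) - breakPt I j)) ℝ := fun j hj =>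
    Matrix.of fun a b => B ⟨breakPt I j + a, hbound hj a⟩ ⟨breakPt I j + b, hbound hj b⟩
  have hin : ∀ {j : ℕ} (hj : j ≤ I.card) (k : Fin (breakPt I (j + 1) - breakPt I j)),
      InBlock I j ⟨breakPt I j + k, hbound hj k⟩ := fun {j} hj k => ⟨by simp, by simp only; omega⟩
  have hsub : ∀ (j : ℕ) (hj : j ≤ I.card), sub j hj ∈ Matrix.orthogonalGroup _ ℝ := by
    intro j hj
    apply mem_orthogonalGroup_of_mul_transpose
    ext a b
    have h1 := congrFun (congrFun (mul_transpose_of_mem hB) ⟨breakPt I j + a, hbound hj a⟩)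
      ⟨breakPt I j + b, hbound hj b⟩
    rw [Matrix.mul_apply, sum_inBlock hr hI hj] at h1
    · rw [Matrix.mul_apply]
      simp only [transpose_apply, sub, of_apply] at h1 ⊢
      rw [h1]
      simp [one_apply, Fin.ext_iff]
    · intro c hc
      rw [hB0 _ c, zero_mul]
      exact fun h => hc (inBlock_jumpSet_of_eq hr hl hj (hin hj a) h)
  -- The family is indexed by size and label, so the `j`th block of `B` is stored at its own size
  -- and transported along the size equality; unused entries are the identity.
  let O : (i : ℕ) → ℕ → Matrix.orthogonalGroup (Fin i) ℝ := fun i j =>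
    if h : ∃ hj : j ≤ I.card, breakPt I (j + 1) - breakPt I j = i then
      h.2 ▸ ⟨sub j h.1, hsub j h.1⟩ else 1
  have hO : ∀ (j : ℕ) (hj : j ≤ I.card), O (breakPt I (j + 1) - breakPt I j) j =
      ⟨sub j hj, hsub j hj⟩ := by
    intro j hj
    simp only [O]
    rw [dif_pos ⟨hj, trivial⟩]
  -- `False` keeps the last block: `B` is invertible even when the rotation has a zero block.
  have hBO : B = blockMatrix I False O := by
    ext a b
    obtain ⟨j, hj, ha⟩ := exists_inBlock I a
    rw [blockMatrix_apply hr hI _ _ b hj ha]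
    split_ifs with h
    · rw [rotEntry, dif_pos ⟨ha.sub_lt, h.1.sub_lt⟩, hO j hj]
      simp only [sub, of_apply]
      have h1 := ha.1
      have h2 := h.1.1
      congr 1 <;> exact Fin.ext (by simp only; omega)
    · refine hB0 a b fun hab => h ⟨?_, by tauto⟩
      exact inBlock_jumpSet_of_eq hr hl hj ha hab
  refine ⟨O, fun R => ?_⟩
  rw [trueRotation, trueRotation]
  conv_lhs => rw [hBO]
  rw [← hIdef, blockMatrix_mul hr hI, or_false]

end TrueSplits

/-! ### Invariance of the joint law of the rotations. -/

section Haar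

variable {r : ℕ}

instance instCompactSpaceOrthogonalGroup (i : ℕ) :
    CompactSpace (Matrix.orthogonalGroup (Fin i) ℝ) :=
  isCompact_iff_compactSpace.1 (isCompact_orthogonalGroup i)

/-- A right translate of a Haar measure is again a Haar measure, and on a compact group the Haar
probability measure is unique. -/
theorem measurePreserving_mul_right_of_compact {G : Type*} [Group G] [TopologicalSpace G]
    [IsTopologicalGroup G] [CompactSpace G] [MeasurableSpace G] [BorelSpace G]
    (μ : Measure G) [IsProbabilityMeasure μ] [μ.IsHaarMeasure] (g : G) :
    MeasurePreserving (· * g) μ μ := by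
  have hm : Measurable fun x : G => x * g := (continuous_mul_const g).measurable
  have := Measure.isProbabilityMeasure_map (μ := μ) hm.aemeasurable
  have : (μ.map (· * g)).IsHaarMeasure := inferInstance
  exact ⟨hm, Measure.isHaarMeasure_eq_of_isProbabilityMeasure _ _⟩

instance instFiniteRotIndex (r : ℕ) : Finite (RotIndex r) := by
  have : Set.Finite {p : ℕ × ℕ | 1 ≤ p.1 ∧ p.1 ≤ r ∧ p.2 < r} :=
    ((Set.finite_Iic r).prod (Set.finite_Iio r)).subset fun p hp => ⟨hp.2.1, hp.2.2⟩
  exact this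

/-- The joint law of the rotations. -/
noncomputable def rotLaw {Ω : Type*} [MeasurableSpace Ω] (Q : Measure Ω) (r : ℕ)
    (R : (i : ℕ) → ℕ → Ω → Matrix.orthogonalGroup (Fin i) ℝ) :
    Measure ((p : RotIndex r) → Matrix.orthogonalGroup (Fin p.1.1) ℝ) :=
  Q.map fun ω p => R p.1.1 p.1.2 ω

variable {Ω : Type*} [MeasurableSpace Ω] {Q : Measure Ω}
  {R : (i : ℕ) → ℕ → Ω → Matrix.orthogonalGroup (Fin i) ℝ}

theorem IsHaarFamily.measurable_family (hR : IsHaarFamily Q r R) :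
    Measurable fun ω (p : RotIndex r) => R p.1.1 p.1.2 ω :=
  measurable_pi_iff.2 hR.measurable

/-- By independence the joint law is a product of Haar measures, and right translation acts on each
factor separately. -/
theorem IsHaarFamily.measurePreserving_mul [IsProbabilityMeasure Q] (hR : IsHaarFamily Q r R)
    (O : (p : RotIndex r) → Matrix.orthogonalGroup (Fin p.1.1) ℝ) :
    MeasurePreserving (fun ρ => ρ * O) (rotLaw Q r R) (rotLaw Q r R) := by
  have := Fintype.ofFinite (RotIndex r)
  have hprob : ∀ p : RotIndex r, IsProbabilityMeasure (Q.map (R p.1.1 p.1.2)) := fun p =>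
    Measure.isProbabilityMeasure_map (hR.measurable p).aemeasurable
  have hlaw : rotLaw Q r R = Measure.pi fun p : RotIndex r => Q.map (R p.1.1 p.1.2) :=
    (iIndepFun_iff_map_fun_eq_pi_map fun p => (hR.measurable p).aemeasurable).1 hR.indep
  rw [hlaw]
  refine measurePreserving_pi (fun p : RotIndex r => Q.map (R p.1.1 p.1.2)) _
    (f := fun p x => x * O p) fun p => ?_
  have := hR.haar p
  exact measurePreserving_mul_right_of_compact _ (O p)

/-- This is where the eigenvector ambiguity disappears: `T` and `T B` have the same law, for every
fixed `B` that respects the eigenspaces. -/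
theorem IsHaarFamily.integral_trueRotation_mul [IsProbabilityMeasure Q] (hr : 1 ≤ r) (hR : IsHaarFamily Q r R)
    {l : Fin r → ℝ} (hl : Antitone l) {B : Matrix (Fin r) (Fin r) ℝ}
    (hB : B ∈ Matrix.orthogonalGroup (Fin r) ℝ) (hBl : Commute B (Matrix.diagonal l))
    {F : Matrix (Fin r) (Fin r) ℝ → ℝ} (hF : Measurable F) :
    ∫ ρ, F (trueRotation l (extendRot ρ) * B) ∂(rotLaw Q r R) =
      ∫ ρ, F (trueRotation l (extendRot ρ)) ∂(rotLaw Q r R) := by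
  obtain ⟨O, hO⟩ := exists_rotation_mul hr hl hB hBl
  have hmp := hR.measurePreserving_mul fun p : RotIndex r => O p.1.1 p.1.2
  have hmeas : Measurable fun ρ : (p : RotIndex r) → Matrix.orthogonalGroup (Fin p.1.1) ℝ =>
      F (trueRotation l (extendRot ρ)) := hF.comp (measurable_blockMatrix_extendRot _ _)
  have key : ∀ ρ : (p : RotIndex r) → Matrix.orthogonalGroup (Fin p.1.1) ℝ,
      trueRotation l (extendRot ρ) * B =
        trueRotation l (extendRot (ρ * fun p : RotIndex r => O p.1.1 p.1.2)) := by
    intro ρ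
    rw [hO]
    refine blockMatrix_congr hr jumpSet_ne_zero _ fun p => ?_
    simp [extendRot, p.2.1, p.2.2.1, p.2.2.2]
  simp_rw [key]
  conv_rhs => rw [← hmp.map_eq]
  rw [integral_map hmp.measurable.aemeasurable hmeas.aestronglyMeasurable]

end Haar

/-! ### Gaussian laws as linear images of the standard one. -/

section Gaussian

open Matrix

variable {r : ℕ}

/-- Any factorization `B B' = S` will do, not only the symmetric square root. This lets rotated
factors be compared freely; the identity is checked on characteristic functions. -/
theorem map_stdGaussian_eq {B S : Matrix (Fin r) (Fin r) ℝ} (h : B * Bᵀ = S) :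
    (stdGaussian (EuclideanSpace ℝ (Fin r))).map (toEuclideanCLM (𝕜 := ℝ) B) =
      multivariateGaussian 0 S := by
  have hS : S.PosSemidef := by
    rw [← h, ← conjTranspose_eq_transpose_of_trivial]
    exact posSemidef_self_mul_conjTranspose B
  have hm : AEMeasurable (toEuclideanCLM (𝕜 := ℝ) B) (stdGaussian (EuclideanSpace ℝ (Fin r))) :=
    (toEuclideanCLM (𝕜 := ℝ) B).continuous.aemeasurable
  have := Measure.isProbabilityMeasure_map hm
  apply Measure.ext_of_charFun
  ext t
  have h1 : charFun ((stdGaussian (EuclideanSpace ℝ (Fin r))).map (toEuclideanCLM (𝕜 := ℝ) B)) t =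
      charFun (stdGaussian (EuclideanSpace ℝ (Fin r))) (toEuclideanCLM (𝕜 := ℝ) Bᵀ t) := by
    rw [charFun_apply, charFun_apply, integral_map hm (by fun_prop)]
    refine integral_congr_ae (Eventually.of_forall fun x => ?_)
    have : inner ℝ (toEuclideanCLM (𝕜 := ℝ) B x) t = inner ℝ x (toEuclideanCLM (𝕜 := ℝ) Bᵀ t) := by
      rw [inner_toEuclideanCLM, real_inner_comm, inner_toEuclideanCLM, dotProduct_comm,
        ← vecMul_transpose, ← Matrix.dotProduct_mulVec]
    simp only [this]
  rw [h1, charFun_stdGaussian, charFun_multivariateGaussian hS]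
  have h2 : ‖toEuclideanCLM (𝕜 := ℝ) Bᵀ t‖ ^ 2 = t ⬝ᵥ S *ᵥ t := by
    rw [← real_inner_self_eq_norm_sq, inner_toEuclideanCLM, ofLp_toEuclideanCLM,
      ← h, ← mulVec_mulVec, Matrix.dotProduct_mulVec t.ofLp, mulVec_transpose]
  rw [← Complex.ofReal_pow, h2]
  simp [neg_div]

end Gaussian

/-! ### Deterministic approximation on the good event. -/

section Deterministic

open Matrix
open scoped Matrix.Norms.L2Operator

variable {r : ℕ} {l D : Fin r → ℝ}

theorem diagonal_pi_sub (a b : Fin r → ℝ) : diagonal (a - b) = diagonal a - diagonal b :=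
  (diagonal_sub a b).symm

/-- When the eigenvalues are estimated with precision `o(1 / c)`, the estimated block structure
is the true one. -/
theorem eventually_blockRotation_eq {ε : ℝ} (hε : 0 < ε) (hl : Antitone l) (hl0 : ∀ i, 0 ≤ l i) :
    ∀ᶠ c : ℝ in atTop, ∀ d : Fin r → ℝ, (∀ i, c * |d i - l i| ≤ ε / 4) →
      ∀ R, blockRotation c ε d R = trueRotation l R := by
  -- For large `c` the scaled true gaps are either zero or at least `2ε`. Scaled eigenvalue errors
  -- of `ε / 4` move a gap by at most `ε / 2`, so the threshold `ε` separates the two cases.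
  have h1 : ∀ᶠ c : ℝ in atTop, ∀ i k, l i < l k → 2 * ε ≤ c * (l k - l i) := by
    refine eventually_all.2 fun i => eventually_all.2 fun k => ?_
    by_cases h : l i < l k
    · filter_upwards [(tendsto_id.atTop_mul_const (sub_pos.2 h)).eventually_ge_atTop (2 * ε)]
        with c hc _ using hc
    · exact Eventually.of_forall fun c h' => absurd h' h
  have h2 : ∀ᶠ c : ℝ in atTop, ∀ k, 0 < l k → 2 * ε ≤ c * l k := by
    refine eventually_all.2 fun k => ?_
    by_cases h : 0 < l k
    · filter_upwards [(tendsto_id.atTop_mul_const h).eventually_ge_atTop (2 * ε)] with c hc _ using hc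
    · exact Eventually.of_forall fun c h' => absurd h' h
  filter_upwards [h1, h2, eventually_ge_atTop 0] with c hc1 hc2 hc0 d hd R
  have hd' : ∀ i, c * (d i - l i) ≤ ε / 4 ∧ c * (l i - d i) ≤ ε / 4 := by
    intro i
    have := hd i
    rcases abs_cases (d i - l i) with ⟨h, _⟩ | ⟨h, _⟩ <;> rw [h] at this <;> constructor <;>
      nlinarith
  have hsplit : splitSet c ε d = jumpSet l := by
    unfold splitSet jumpSet
    refine Finset.filter_congr fun i _ => exists_congr fun k => and_congr_right fun hk => ?_
    have hik := hd' i
    have hkk := hd' k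
    have hle : l i ≤ l k := hl (Fin.le_def.2 (by omega))
    constructor
    · intro h
      refine lt_of_le_of_ne hle fun heq => ?_
      rw [← heq] at hkk
      nlinarith
    · intro h
      have := hc1 i k h
      nlinarith
  have hlast : LastSmall c ε d ↔ LastZero l := by
    unfold LastSmall LastZero
    refine exists_congr fun k => and_congr_right fun hk => ?_
    have hkk := hd' k
    constructor
    · intro h
      by_contra h0
      have := hc2 k (lt_of_le_of_ne (hl0 k) (Ne.symm h0))
      nlinarith
    · intro h
      rw [h] at hkk
      nlinarith
  unfold blockRotation trueRotation
  rw [hsplit, propext hlast]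

theorem norm_trueRotation_le (hr : 1 ≤ r) (R : (i : ℕ) → ℕ → Matrix.orthogonalGroup (Fin i) ℝ) :
    ‖trueRotation l R‖ ≤ 1 := by
  classical
  have h1 : ‖(trueRotation l R)‖ * ‖(trueRotation l R)‖ ≤ 1 := by
    rw [← norm_transpose_eq, ← l2_opNorm_conjTranspose_mul_self,
      conjTranspose_eq_transpose_of_trivial, transpose_transpose, trueRotation,
      blockMatrix_transpose, blockMatrix_mul hr jumpSet_ne_zero, mul_inv_cancel,
      blockMatrix_one hr jumpSet_ne_zero]
    refine norm_diagonal_le zero_le_one fun i => ?_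
    split_ifs <;> simp
  nlinarith [norm_nonneg (trueRotation l R)]

/-- The matrix in front of the rotation, with the true instead of the estimated eigenvalues. -/
noncomputable def frontMatrix (U : Matrix (Fin r) (Fin r) ℝ) (D l : Fin r → ℝ) :
    Matrix (Fin r) (Fin r) ℝ := U * diagSqrt D * diagSqrtPinv l

theorem norm_frontMatrix_le {U : Matrix (Fin r) (Fin r) ℝ}
    (hU : U ∈ Matrix.orthogonalGroup (Fin r) ℝ) :
    ‖frontMatrix U D l‖ ≤ ‖diagSqrt D‖ * ‖diagSqrtPinv l‖ := by
  refine (norm_mul_le _ _).trans ?_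
  gcongr
  refine (norm_mul_le _ _).trans ?_
  nlinarith [norm_le_one_of_mem hU, norm_nonneg (diagSqrt D)]

/-- The pseudo-inverse loses the directions with `l i = 0`. Nothing is lost in the product, since `D
i` vanishes there too. -/
theorem frontMatrix_mul_diagonal_mul_transpose (U : Matrix (Fin r) (Fin r) ℝ)
    (hD0 : ∀ i, 0 ≤ D i) (hl0 : ∀ i, 0 ≤ l i) (hDl : ∀ i, D i ≠ 0 → l i ≠ 0) :
    frontMatrix U D l * diagonal l * (frontMatrix U D l)ᵀ = U * diagonal D * Uᵀ := by
  have : diagSqrt D * diagSqrtPinv l * diagonal l * (diagSqrtPinv l * diagSqrt D) =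
      diagonal D := by
    simp only [diagSqrt, diagSqrtPinv, diagonal_mul_diagonal]
    congr 1
    ext i
    by_cases h : D i = 0
    · simp [h]
    · have h1 : 0 < l i := lt_of_le_of_ne (hl0 i) (hDl i h).symm
      have h2 : √(l i) ≠ 0 := (Real.sqrt_pos.2 h1).ne'
      have h3 : √(l i) ^ 2 = l i := Real.sq_sqrt h1.le
      have h4 : √(D i) ^ 2 = D i := Real.sq_sqrt (hD0 i)
      field_simp
      rw [h3, h4, mul_comm]
  rw [← this]
  simp only [frontMatrix, transpose_mul, diagSqrt, diagSqrtPinv, diagonal_transpose,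
    Matrix.mul_assoc]

/-- Rows of the rotation at zero eigenvalues vanish, so the factor in front does not matter there.
This hides the discontinuity of the pseudo-inverse at zero. -/
theorem diagonal_mul_trueRotation_congr (hr : 1 ≤ r) (hl : Antitone l) (hl0 : ∀ i, 0 ≤ l i)
    (v : Fin r → ℝ) (R : (i : ℕ) → ℕ → Matrix.orthogonalGroup (Fin i) ℝ) :
    diagonal v * trueRotation l R =
      diagonal (fun i => if l i = 0 then 0 else v i) * trueRotation l R := by
  ext a b
  simp only [diagonal_mul]
  by_cases h : trueRotation l R a b = 0
  · simp [h]
  · simp [(trueRotation_ne_zero hr hl hl0 R h).2]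

/-- Once the coordinates with `l i = 0` are masked, the diagonal factor `G` is continuous at the
true eigenvalues. The other factors have norm at most one, so `δ` is uniform in `U`, `W` and the
rotation. -/
theorem exists_front_near (hr : 1 ≤ r) (hl : Antitone l) (hl0 : ∀ i, 0 ≤ l i) {η : ℝ}
    (hη : 0 < η) : ∃ δ > 0, ∀ (U W : Matrix (Fin r) (Fin r) ℝ) (d dπ : Fin r → ℝ),
      U ∈ Matrix.orthogonalGroup (Fin r) ℝ → W ∈ Matrix.orthogonalGroup (Fin r) ℝ →
      (∀ i, |d i - D i| < δ) → (∀ i, |dπ i - l i| < δ) → ∀ R,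
      ‖U * diagSqrt d * diagSqrtPinv dπ * trueRotation l R * Wᵀ -
        frontMatrix U D l * trueRotation l R * Wᵀ‖ ≤ η := by
  let G : (Fin r → ℝ) × (Fin r → ℝ) → Fin r → ℝ := fun p i =>
    if l i = 0 then 0 else √(p.1 i) * (√(p.2 i))⁻¹
  have hG : ContinuousAt G (D, l) := by
    refine continuousAt_pi.2 fun i => ?_
    by_cases h : l i = 0
    · simp only [G, h, if_true]
      exact continuousAt_const
    · simp only [G, h, if_false]
      have h1 : 0 < l i := lt_of_le_of_ne (hl0 i) (Ne.symm h)
      have h2 : √(l i) ≠ 0 := (Real.sqrt_pos.2 h1).ne'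
      refine ContinuousAt.mul (by fun_prop) (ContinuousAt.inv₀ (by fun_prop) h2)
  obtain ⟨δ, hδ, hδG⟩ := Metric.continuousAt_iff.1 hG η hη
  refine ⟨δ, hδ, fun U W d dπ hU hW hd hdπ R => ?_⟩
  have h1 : dist (d, dπ) (D, l) < δ := by
    rw [Prod.dist_eq, max_lt_iff, dist_pi_lt_iff hδ, dist_pi_lt_iff hδ]
    exact ⟨hd, hdπ⟩
  have h2 := (hδG h1).le
  rw [dist_eq_norm, ← l2_opNorm_diagonal] at h2
  have h3 : U * diagSqrt d * diagSqrtPinv dπ * trueRotation l R * Wᵀ -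
        frontMatrix U D l * trueRotation l R * Wᵀ =
      U * ((diagonal (G (d, dπ)) - diagonal (G (D, l))) * trueRotation l R) * Wᵀ := by
    have e : ∀ x y : Fin r → ℝ, diagSqrt x * diagSqrtPinv y * trueRotation l R =
        diagonal (G (x, y)) * trueRotation l R := by
      intro x y
      rw [diagSqrt, diagSqrtPinv, diagonal_mul_diagonal, diagonal_mul_trueRotation_congr hr hl hl0]
    rw [Matrix.sub_mul, ← e, ← e, Matrix.mul_sub, Matrix.sub_mul, frontMatrix]
    simp only [Matrix.mul_assoc]
  rw [h3, ← diagonal_pi_sub]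
  calc _ ≤ ‖U‖ * (‖diagonal (G (d, dπ) - G (D, l))‖ * ‖trueRotation l R‖) * ‖Wᵀ‖ := by
        refine (norm_mul_le _ _).trans ?_
        gcongr
        refine (norm_mul_le _ _).trans ?_
        gcongr
        exact norm_mul_le _ _
    _ ≤ 1 * (η * 1) * 1 := by
        gcongr
        · exact norm_le_one_of_mem hU
        · exact norm_trueRotation_le hr R
        · rw [norm_transpose_eq]; exact norm_le_one_of_mem hW
    _ = η := by ring

/-- Replacing the eigenvalues by those of the limit changes the matrix only a little. -/
theorem IsEigDecomp.norm_sub_le {S U S' U' : Matrix (Fin r) (Fin r) ℝ} {d d' : Fin r → ℝ}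
    (h : IsEigDecomp S U d) (h' : IsEigDecomp S' U' d') :
    ‖U * diagonal d' * Uᵀ - U' * diagonal d' * U'ᵀ‖ ≤ 2 * ‖S - S'‖ := by
  rw [← h'.eq]
  have h1 : U * diagonal d' * Uᵀ - S' = - (U * diagonal (d - d') * Uᵀ) + (S - S') := by
    rw [diagonal_pi_sub, Matrix.mul_sub, Matrix.sub_mul, ← h.eq]
    abel
  rw [h1]
  refine (norm_add_le _ _).trans ?_
  rw [norm_neg, two_mul]
  gcongr
  calc _ ≤ ‖U‖ * ‖diagonal (d - d')‖ * ‖Uᵀ‖ := by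
        refine (norm_mul_le _ _).trans ?_
        gcongr
        exact norm_mul_le _ _
    _ ≤ 1 * ‖S - S'‖ * 1 := by
        gcongr
        · exact norm_le_one_of_mem h.orthogonal
        · exact norm_diagonal_le (norm_nonneg _) (h.abs_sub_le h')
        · rw [norm_transpose_eq]; exact norm_le_one_of_mem h.orthogonal
    _ = _ := by ring

theorem IsEigDecomp.exists_commute_near {S' V : Matrix (Fin r) (Fin r) ℝ}
    (hV : IsEigDecomp S' V l) {η : ℝ} (hη : 0 < η) :
    ∃ δ > 0, ∀ S W d, IsEigDecomp S W d → ‖S - S'‖ < δ →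
      ∃ B ∈ Matrix.orthogonalGroup (Fin r) ℝ, Commute B (diagonal l) ∧ ‖W - V * B‖ < η := by
  obtain ⟨δ, hδ, h⟩ := PermCorr.exists_commute_near hV.orthogonal l hη
  refine ⟨δ / 2, by positivity, fun S W d hW hS => h W hW.orthogonal ?_⟩
  have := hW.norm_sub_le hV
  linarith

/-- A matrix `B` commuting with `diagonal D` also commutes with its square root, so `V` and `V B`
give the same symmetric root. Unlike `U` itself, this expression is thus stable. -/
theorem IsEigDecomp.exists_sqrt_near {S' V : Matrix (Fin r) (Fin r) ℝ}
    (hV : IsEigDecomp S' V D) {η : ℝ} (hη : 0 < η) :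
    ∃ δ > 0, ∀ S U d, IsEigDecomp S U d → ‖S - S'‖ < δ →
      ‖U * diagSqrt D * Uᵀ - V * diagSqrt D * Vᵀ‖ ≤ η := by
  set C := ‖diagSqrt D‖ with hC
  have hC0 : 0 ≤ C := norm_nonneg _
  -- Two error terms arise, each at most `C` times the distance of `U` from `V B`; the `+ 1` guards
  -- against `C = 0`.
  obtain ⟨δ, hδ, h⟩ := hV.exists_commute_near (η := η / (2 * (C + 1))) (by positivity)
  refine ⟨δ, hδ, fun S U d hU hS => ?_⟩
  obtain ⟨B, hB, hBD, hUB⟩ := h S U d hU hS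
  have hBs : B * diagSqrt D = diagSqrt D * B := by
    ext a b
    have := congrFun (congrFun hBD.eq a) b
    rw [mul_diagonal, diagonal_mul] at this
    rw [diagSqrt, mul_diagonal, diagonal_mul]
    by_cases h0 : B a b = 0
    · simp [h0]
    · have : D b = D a := mul_left_cancel₀ h0 (by linarith)
      rw [this, mul_comm]
  have hVB : V * diagSqrt D * Vᵀ = V * B * diagSqrt D * (V * B)ᵀ := by
    rw [Matrix.mul_assoc V B, hBs, transpose_mul, ← Matrix.mul_assoc V, Matrix.mul_assoc _ B,
      ← Matrix.mul_assoc B, mul_transpose_of_mem hB, Matrix.one_mul]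
  have e : U * diagSqrt D * Uᵀ - V * B * diagSqrt D * (V * B)ᵀ =
      (U - V * B) * diagSqrt D * Uᵀ + V * B * diagSqrt D * (U - V * B)ᵀ := by
    rw [transpose_sub, Matrix.sub_mul, Matrix.sub_mul, Matrix.mul_sub]
    abel
  rw [hVB, e]
  have hU1 := norm_le_one_of_mem hU.orthogonal
  have hVB1 := norm_le_one_of_mem (mul_mem hV.orthogonal hB)
  calc _ ≤ ‖U - V * B‖ * C * ‖Uᵀ‖ + ‖V * B‖ * C * ‖(U - V * B)ᵀ‖ := by
        refine (norm_add_le _ _).trans ?_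
        gcongr <;> refine (norm_mul_le _ _).trans ?_ <;> gcongr <;> exact norm_mul_le _ _
    _ ≤ η / (2 * (C + 1)) * C * 1 + 1 * C * (η / (2 * (C + 1))) := by
        rw [norm_transpose_eq, norm_transpose_eq]
        gcongr
    _ = η * (C / (C + 1)) := by field_simp; ring
    _ ≤ η * 1 := by
        gcongr
        rw [div_le_one (by positivity)]
        linarith
    _ = η := mul_one η

end Deterministic

/-! ### Bounded Lipschitz distance and tails. -/

section BoundedLipschitz

variable {Ω E : Type*} [MeasurableSpace Ω]

theorem abs_integral_sub_le_of_close {Q : Measure Ω} [IsProbabilityMeasure Q] {u v : Ω → ℝ}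
    (hu : Measurable u) (hv : Measurable v) (hu1 : ∀ ω, |u ω| ≤ 1) (hv1 : ∀ ω, |v ω| ≤ 1)
    {N : Set Ω} (hN : MeasurableSet N) {κ : ℝ} (hκ : 0 ≤ κ) (h : ∀ ω ∉ N, |u ω - v ω| ≤ κ) :
    |∫ ω, u ω ∂Q - ∫ ω, v ω ∂Q| ≤ κ + 2 * Q.real N := by
  have hui : Integrable u Q := .of_bound hu.aestronglyMeasurable 1 (Eventually.of_forall hu1)
  have hvi : Integrable v Q := .of_bound hv.aestronglyMeasurable 1 (Eventually.of_forall hv1)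
  have hNi : Integrable (N.indicator fun _ => (2 : ℝ)) Q := (integrable_const _).indicator hN
  rw [← integral_sub hui hvi]
  calc |∫ ω, (u ω - v ω) ∂Q| ≤ ∫ ω, |u ω - v ω| ∂Q := abs_integral_le_integral_abs
    _ ≤ ∫ ω, (κ + N.indicator (fun _ => (2 : ℝ)) ω) ∂Q := by
        refine integral_mono (hui.sub hvi).abs ((integrable_const _).add hNi) fun ω => ?_
        by_cases hω : ω ∈ N
        · simp only [Set.indicator_of_mem hω]
          have := abs_sub (u ω) (v ω)
          linarith [hu1 ω, hv1 ω]
        · simp only [Set.indicator_of_notMem hω, add_zero]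
          exact h ω hω
    _ = κ + 2 * Q.real N := by
        rw [integral_add (integrable_const _) hNi, integral_indicator hN]
        simp [mul_comm]

/-- The bounded Lipschitz distance between the law of `T` and `ν`. -/
noncomputable def blDist [PseudoEMetricSpace E] [MeasurableSpace E] (Q : Measure Ω) (T : Ω → E)
    (ν : Measure E) : ℝ := ⨆ h : BL1 E, |∫ ω, h.1 (T ω) ∂Q - ∫ z, h.1 z ∂ν|

theorem abs_integral_le_one_of_bound {Q : Measure Ω} [IsProbabilityMeasure Q] {u : Ω → ℝ}
    (hu : ∀ ω, |u ω| ≤ 1) : |∫ ω, u ω ∂Q| ≤ 1 := by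
  simpa using norm_integral_le_of_norm_le_const (μ := Q) (f := u) (C := 1)
    (Eventually.of_forall hu)

section

variable [PseudoEMetricSpace E] [MeasurableSpace E] {Q : Measure Ω} {ν : Measure E}
  [IsProbabilityMeasure Q] [IsProbabilityMeasure ν]

theorem abs_integral_sub_le_blDist (T : Ω → E) {h : E → ℝ} (hh : h ∈ BL1 E) :
    |∫ ω, h (T ω) ∂Q - ∫ z, h z ∂ν| ≤ blDist Q T ν := by
  refine le_ciSup (f := fun h : BL1 E => |∫ ω, h.1 (T ω) ∂Q - ∫ z, h.1 z ∂ν|) ⟨2, ?_⟩ ⟨h, hh⟩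
  rintro _ ⟨g, rfl⟩
  have h1 := abs_integral_le_one_of_bound (Q := Q) (u := fun ω => g.1 (T ω)) fun ω => g.2.2 _
  have h2 := abs_integral_le_one_of_bound (Q := ν) (u := fun z => g.1 z) fun ω => g.2.2 _
  have := abs_sub (∫ ω, g.1 (T ω) ∂Q) (∫ z, g.1 z ∂ν)
  simp only
  linarith

omit [IsProbabilityMeasure Q] [IsProbabilityMeasure ν] in
theorem blDist_nonneg (T : Ω → E) : 0 ≤ blDist Q T ν :=
  Real.iSup_nonneg fun _ => abs_nonneg _

omit [IsProbabilityMeasure Q] [IsProbabilityMeasure ν] in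
theorem blDist_le {T : Ω → E} {c : ℝ}
    (hc : ∀ h ∈ BL1 E, |∫ ω, h (T ω) ∂Q - ∫ z, h z ∂ν| ≤ c) : blDist Q T ν ≤ c := by
  have : Nonempty (BL1 E) := ⟨⟨fun _ => 0, (LipschitzWith.const _).weaken zero_le_one, by simp⟩⟩
  exact ciSup_le fun h => hc h.1 h.2

end

section Tail

variable [NormedAddCommGroup E]

/-- A Lipschitz function that detects values outside of the ball of radius `L`. -/
noncomputable def tailFn (L : ℝ) (x : E) : ℝ := max 0 (min 1 (‖x‖ - L))

theorem tailFn_nonneg (L : ℝ) (x : E) : 0 ≤ tailFn L x := le_max_left _ _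

theorem tailFn_le_one (L : ℝ) (x : E) : tailFn L x ≤ 1 :=
  max_le zero_le_one (min_le_left _ _)

theorem one_le_tailFn {L : ℝ} {x : E} (h : L + 1 < ‖x‖) : 1 ≤ tailFn L x :=
  le_max_of_le_right (le_min le_rfl (by linarith))

theorem lipschitzWith_tailFn (L : ℝ) : LipschitzWith 1 (tailFn (E := E) L) := by
  have h : LipschitzWith 1 fun x : E => ‖x‖ - L := by
    refine LipschitzWith.of_dist_le_mul fun x y => ?_
    rw [Real.dist_eq, dist_eq_norm, sub_sub_sub_cancel_right, NNReal.coe_one, one_mul]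
    exact abs_norm_sub_norm_le x y
  exact (h.const_min 1).const_max 0

theorem tailFn_mem_BL1 (L : ℝ) : tailFn (E := E) L ∈ BL1 E :=
  ⟨lipschitzWith_tailFn L, fun x => by
    rw [abs_of_nonneg (tailFn_nonneg L x)]; exact tailFn_le_one L x⟩

variable [MeasurableSpace E] [BorelSpace E]

theorem exists_integral_tailFn_le (ν : Measure E) [IsProbabilityMeasure ν] {e : ℝ} (he : 0 < e) :
    ∃ L : ℝ, 0 ≤ L ∧ ∫ x, tailFn L x ∂ν ≤ e := by
  have h : Tendsto (fun n : ℕ => ∫ x, tailFn (n : ℝ) x ∂ν) atTop (𝓝 (∫ _, (0 : ℝ) ∂ν)) := by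
    refine tendsto_integral_of_dominated_convergence (fun _ => 1)
      (fun n => (lipschitzWith_tailFn _).continuous.measurable.aestronglyMeasurable)
      (integrable_const _) (fun n => Eventually.of_forall fun x => (tailFn_mem_BL1 _).2 x)
      (Eventually.of_forall fun x => ?_)
    refine tendsto_const_nhds.congr' ?_
    filter_upwards [tendsto_natCast_atTop_atTop.eventually_ge_atTop ‖x‖] with n hn
    rw [tailFn, max_eq_left]
    exact (min_le_right _ _).trans (by linarith)
  rw [integral_zero] at h
  obtain ⟨n, hn⟩ := (h.eventually (gt_mem_nhds he)).exists
  exact ⟨n, n.cast_nonneg, hn.le⟩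

/-- The tail function is itself a bounded Lipschitz test function dominating the indicator, so
tightness passes from `ν` to `T`. -/
theorem measureReal_norm_gt_le {Q : Measure Ω} [IsProbabilityMeasure Q] {ν : Measure E}
    [IsProbabilityMeasure ν] {T : Ω → E} (hT : Measurable T) (L : ℝ) :
    Q.real {ω | L + 1 < ‖T ω‖} ≤ ∫ x, tailFn L x ∂ν + blDist Q T ν := by
  have h1 := abs_integral_sub_le_blDist (Q := Q) (ν := ν) T (tailFn_mem_BL1 L)
  have hm : MeasurableSet {ω | L + 1 < ‖T ω‖} := measurableSet_lt measurable_const hT.norm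
  have hti : Integrable (fun ω => tailFn L (T ω)) Q :=
    .of_bound (((lipschitzWith_tailFn L).continuous.measurable.comp hT).aestronglyMeasurable) 1
      (Eventually.of_forall fun ω => (tailFn_mem_BL1 L).2 _)
  have h2 : Q.real {ω | L + 1 < ‖T ω‖} ≤ ∫ ω, tailFn L (T ω) ∂Q := by
    rw [← integral_indicator_one hm]
    refine integral_mono ((integrable_const _).indicator hm) hti fun ω => ?_
    by_cases hω : L + 1 < ‖T ω‖
    · rw [Set.indicator_of_mem (by exact hω)]
      exact one_le_tailFn hω
    · rw [Set.indicator_of_notMem (by exact hω)]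
      exact tailFn_nonneg _ _
  have := (abs_le.1 h1).2
  linarith

omit [BorelSpace E] in
theorem abs_integral_sub_le_mul_blDist {Q : Measure Ω} [IsProbabilityMeasure Q] {ν : Measure E}
    [IsProbabilityMeasure ν] (T : Ω → E) {g : E → ℝ} {K : NNReal} (hK : 1 ≤ K)
    (hg : LipschitzWith K g) (hg1 : ∀ x, |g x| ≤ 1) :
    |∫ ω, g (T ω) ∂Q - ∫ z, g z ∂ν| ≤ K * blDist Q T ν := by
  have hK0 : (0 : ℝ) < K := lt_of_lt_of_le one_pos (by exact_mod_cast hK)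
  have hK1 : (1 : ℝ) ≤ K := by exact_mod_cast hK
  have hmem : (fun x => (K : ℝ)⁻¹ * g x) ∈ BL1 E := by
    refine ⟨LipschitzWith.of_dist_le_mul fun x y => ?_, fun x => ?_⟩
    · rw [Real.dist_eq, ← mul_sub, abs_mul, abs_of_pos (inv_pos.2 hK0), NNReal.coe_one, one_mul,
        inv_mul_le_iff₀ hK0, ← Real.dist_eq]
      exact hg.dist_le_mul x y
    · rw [abs_mul, abs_of_pos (inv_pos.2 hK0), inv_mul_le_iff₀ hK0]
      linarith [hg1 x]
  have := abs_integral_sub_le_blDist (Q := Q) (ν := ν) T hmem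
  simp only [integral_const_mul] at this
  rw [← mul_sub, abs_mul, abs_of_pos (inv_pos.2 hK0), inv_mul_le_iff₀ hK0] at this
  exact this

end Tail

end BoundedLipschitz

/-! ### Measurability of matrix operations. -/

section MatrixMeasurability

open Matrix

variable {α : Type*} [MeasurableSpace α] {r : ℕ}

theorem measurable_matrix_mul {f g : α → Matrix (Fin r) (Fin r) ℝ} (hf : Measurable f)
    (hg : Measurable g) : Measurable fun x => f x * g x := by
  refine measurable_matrix fun i j => ?_
  simp only [Matrix.mul_apply]
  exact Finset.measurable_sum _ fun k _ => ((measurable_matrix_entry i k).comp hf).mul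
    ((measurable_matrix_entry k j).comp hg)

theorem measurable_matrix_transpose {f : α → Matrix (Fin r) (Fin r) ℝ} (hf : Measurable f) :
    Measurable fun x => (f x)ᵀ :=
  measurable_matrix fun i j => (measurable_matrix_entry j i).comp hf

theorem measurable_toEuclideanCLM_apply {f : α → Matrix (Fin r) (Fin r) ℝ}
    {g : α → EuclideanSpace ℝ (Fin r)} (hf : Measurable f) (hg : Measurable g) :
    Measurable fun x => toEuclideanCLM (𝕜 := ℝ) (f x) (g x) := by
  have h : ∀ x, toEuclideanCLM (𝕜 := ℝ) (f x) (g x) =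
      WithLp.toLp 2 fun i => ∑ j, f x i j * (g x).ofLp j := fun x => rfl
  simp only [h]
  refine (WithLp.measurable_toLp 2 _).comp (measurable_pi_iff.2 fun i => ?_)
  refine Finset.measurable_sum _ fun j _ => ((measurable_matrix_entry i j).comp hf).mul ?_
  exact (measurable_pi_apply j).comp ((WithLp.measurable_ofLp 2 _).comp hg)

end MatrixMeasurability

/-! ### Averaging test functions over the rotations. -/

section Averaging

open Matrix
open scoped Matrix.Norms.L2Operator

variable {r : ℕ} {Ω : Type*} [MeasurableSpace Ω] {Q : Measure Ω} [IsProbabilityMeasure Q]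
  {R : (i : ℕ) → ℕ → Ω → Matrix.orthogonalGroup (Fin i) ℝ} {l : Fin r → ℝ}
  {h : EuclideanSpace ℝ (Fin r) → ℝ}

/-- The average of `h (A R z)` over the random rotation `R`. -/
noncomputable def rotAverage (Q : Measure Ω) (R : (i : ℕ) → ℕ → Ω → Matrix.orthogonalGroup (Fin i) ℝ)
    (l : Fin r → ℝ) (A : Matrix (Fin r) (Fin r) ℝ) (h : EuclideanSpace ℝ (Fin r) → ℝ)
    (z : EuclideanSpace ℝ (Fin r)) : ℝ :=
  ∫ ρ, h (toEuclideanCLM (𝕜 := ℝ) (A * trueRotation l (extendRot ρ)) z) ∂(rotLaw Q r R)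

theorem isProbabilityMeasure_rotLaw (hR : IsHaarFamily Q r R) :
    IsProbabilityMeasure (rotLaw Q r R) :=
  Measure.isProbabilityMeasure_map hR.measurable_family.aemeasurable

theorem measurable_rot_apply {α : Type*} [MeasurableSpace α] (hh : Measurable h)
    (A : Matrix (Fin r) (Fin r) ℝ)
    {f : α → (p : RotIndex r) → Matrix.orthogonalGroup (Fin p.1.1) ℝ} (hf : Measurable f)
    {g : α → EuclideanSpace ℝ (Fin r)} (hg : Measurable g) :
    Measurable fun x => h (toEuclideanCLM (𝕜 := ℝ) (A * trueRotation l (extendRot (f x))) (g x)) :=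
  hh.comp (measurable_toEuclideanCLM_apply (measurable_matrix_mul measurable_const
    ((measurable_blockMatrix_extendRot _ _).comp hf)) hg)

theorem abs_rotAverage_le (hR : IsHaarFamily Q r R) (hh : ∀ x, |h x| ≤ 1)
    (A : Matrix (Fin r) (Fin r) ℝ) (z : EuclideanSpace ℝ (Fin r)) :
    |rotAverage Q R l A h z| ≤ 1 := by
  have := isProbabilityMeasure_rotLaw hR
  exact abs_integral_le_one_of_bound fun ρ => hh _

theorem abs_rotAverage_sub_le (hr : 1 ≤ r) (hR : IsHaarFamily Q r R)
    (hh : h ∈ BL1 (EuclideanSpace ℝ (Fin r)))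
    (A : Matrix (Fin r) (Fin r) ℝ) (z z' : EuclideanSpace ℝ (Fin r)) :
    |rotAverage Q R l A h z - rotAverage Q R l A h z'| ≤ ‖A‖ * ‖z - z'‖ := by
  have := isProbabilityMeasure_rotLaw hR
  have hm := fun z => measurable_rot_apply (l := l) hh.1.continuous.measurable A measurable_id
    (measurable_const (a := z))
  have h1 := abs_integral_sub_le_of_close (Q := rotLaw Q r R)
    (u := fun ρ => h (toEuclideanCLM (𝕜 := ℝ) (A * trueRotation l (extendRot ρ)) z))
    (v := fun ρ => h (toEuclideanCLM (𝕜 := ℝ) (A * trueRotation l (extendRot ρ)) z'))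
    (hm z) (hm z')
    (fun ρ => hh.2 _) (fun ρ => hh.2 _) MeasurableSet.empty (κ := ‖A‖ * ‖z - z'‖) (by positivity) ?_
  · rw [measureReal_empty, mul_zero, add_zero] at h1
    exact h1
  · intro ρ _
    rw [← Real.dist_eq]
    refine (hh.1.dist_le_mul _ _).trans ?_
    rw [NNReal.coe_one, one_mul, dist_eq_norm, ← map_sub]
    refine (norm_toEuclideanCLM_apply_le _ _).trans ?_
    gcongr
    refine (norm_mul_le _ _).trans ?_
    have := norm_trueRotation_le (l := l) hr (extendRot ρ)
    nlinarith [norm_nonneg A]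

theorem rotAverage_commute (hr : 1 ≤ r) (hR : IsHaarFamily Q r R) (hl : Antitone l)
    (hh : Measurable h) {B : Matrix (Fin r) (Fin r) ℝ}
    (hB : B ∈ Matrix.orthogonalGroup (Fin r) ℝ) (hBl : Commute B (diagonal l))
    (A : Matrix (Fin r) (Fin r) ℝ) (z : EuclideanSpace ℝ (Fin r)) :
    rotAverage Q R l A h (toEuclideanCLM (𝕜 := ℝ) B z) = rotAverage Q R l A h z := by
  unfold rotAverage
  rw [← hR.integral_trueRotation_mul hr hl hB hBl
    (F := fun X => h (toEuclideanCLM (𝕜 := ℝ) (A * X) z))]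
  · simp only [← toEuclideanCLM_mul_apply, Matrix.mul_assoc]
  · exact hh.comp (measurable_toEuclideanCLM_apply (measurable_matrix_mul measurable_const
      measurable_id) measurable_const)

/-- The averaged function hardly depends on whether `V` or a matrix that is close to `V` up to
a block rotation is used. -/
theorem abs_rotAverage_sub_le_of_near (hr : 1 ≤ r) (hR : IsHaarFamily Q r R) (hl : Antitone l)
    (hh : h ∈ BL1 (EuclideanSpace ℝ (Fin r)))
    {V W B : Matrix (Fin r) (Fin r) ℝ} (hB : B ∈ Matrix.orthogonalGroup (Fin r) ℝ)
    (hBl : Commute B (diagonal l)) {η : ℝ} (hW : ‖W - V * B‖ ≤ η)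
    (A : Matrix (Fin r) (Fin r) ℝ) (t : EuclideanSpace ℝ (Fin r)) :
    |rotAverage Q R l A h (toEuclideanCLM (𝕜 := ℝ) Wᵀ t) -
      rotAverage Q R l A h (toEuclideanCLM (𝕜 := ℝ) Vᵀ t)| ≤ ‖A‖ * (η * ‖t‖) := by
  have hBl' : Commute Bᵀ (diagonal l) := by
    have := congrArg transpose hBl.eq
    simp only [transpose_mul, diagonal_transpose] at this
    exact this.symm
  rw [← rotAverage_commute hr hR hl hh.1.continuous.measurable (transpose_mem hB) hBl' A
    (toEuclideanCLM (𝕜 := ℝ) Vᵀ t), ← toEuclideanCLM_mul_apply, ← transpose_mul]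
  refine (abs_rotAverage_sub_le hr hR hh A _ _).trans ?_
  gcongr
  rw [← _root_.sub_apply, ← map_sub, ← transpose_sub]
  refine (norm_toEuclideanCLM_apply_le _ _).trans ?_
  rw [norm_transpose_eq]
  gcongr

/-- After exchanging the integrals the rotation is fixed: `V'` turns the law into `N(0, diagonal
l)`, the rotation preserves this covariance, and `A` is applied last. The inner integral no longer
depends on the rotation. -/
theorem integral_rotAverage_gaussian (hr : 1 ≤ r) (hR : IsHaarFamily Q r R) (hl : Antitone l)
    (hl0 : ∀ i, 0 ≤ l i) (hh : Measurable h) (hh1 : ∀ x, |h x| ≤ 1)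
    {S V A : Matrix (Fin r) (Fin r) ℝ} (hV : IsEigDecomp S V l) :
    ∫ z, rotAverage Q R l A h (toEuclideanCLM (𝕜 := ℝ) Vᵀ z) ∂(multivariateGaussian 0 S) =
      ∫ z, h z ∂(multivariateGaussian 0 (A * diagonal l * Aᵀ)) := by
  have := isProbabilityMeasure_rotLaw hR
  have hCm : ∀ X : Matrix (Fin r) (Fin r) ℝ, Measurable (toEuclideanCLM (𝕜 := ℝ) X) := fun X =>
    (toEuclideanCLM (𝕜 := ℝ) X).continuous.measurable
  have hm : Measurable fun p : EuclideanSpace ℝ (Fin r) ×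
        ((p : RotIndex r) → Matrix.orthogonalGroup (Fin p.1.1) ℝ) =>
      h (toEuclideanCLM (𝕜 := ℝ) (A * trueRotation l (extendRot p.2))
        (toEuclideanCLM (𝕜 := ℝ) Vᵀ p.1)) :=
    measurable_rot_apply hh A measurable_snd ((hCm Vᵀ).comp measurable_fst)
  unfold rotAverage
  rw [integral_integral_swap (.of_bound hm.aestronglyMeasurable 1
    (Eventually.of_forall fun p => hh1 _))]
  have key : ∀ ρ : (p : RotIndex r) → Matrix.orthogonalGroup (Fin p.1.1) ℝ,
      ∫ z, h (toEuclideanCLM (𝕜 := ℝ) (A * trueRotation l (extendRot ρ))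
        (toEuclideanCLM (𝕜 := ℝ) Vᵀ z)) ∂(multivariateGaussian 0 S) =
      ∫ z, h z ∂(multivariateGaussian 0 (A * diagonal l * Aᵀ)) := by
    intro ρ
    set T := trueRotation l (extendRot ρ) with hT
    have hsq : diagSqrt l * (diagSqrt l)ᵀ = diagonal l := by
      rw [← diagSqrt_mul_self l hl0, diagSqrt, diagonal_transpose]
    have e1 : V * diagSqrt l * (V * diagSqrt l)ᵀ = S := by
      rw [hV.eq, ← hsq, transpose_mul]
      simp only [Matrix.mul_assoc]
    have e2 : A * T * diagSqrt l * (A * T * diagSqrt l)ᵀ = A * diagonal l * Aᵀ := by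
      rw [← trueRotation_mul_diagonal_mul_transpose hr hl hl0 (extendRot ρ), ← hT, ← hsq]
      simp only [transpose_mul, Matrix.mul_assoc]
    have e3 : A * T * Vᵀ * (V * diagSqrt l) = A * T * diagSqrt l := by
      rw [Matrix.mul_assoc (A * T), ← Matrix.mul_assoc Vᵀ, transpose_mul_of_mem hV.orthogonal,
        Matrix.one_mul]
    simp only [← toEuclideanCLM_mul_apply]
    rw [← map_stdGaussian_eq e1, ← map_stdGaussian_eq e2,
      integral_map (hCm _).aemeasurable hh.aestronglyMeasurable, integral_map (hCm _).aemeasurable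
        (by exact (hh.comp (hCm _)).aestronglyMeasurable)]
    simp only [← toEuclideanCLM_mul_apply, e3]
  simp only [key, integral_const, probReal_univ, one_smul]

/-- Integrating out the rotation, which is independent of the resampling randomness. -/
theorem integral_eq_integral_rotAverage (hr : 1 ≤ r) (hR : IsHaarFamily Q r R)
    {χ : Type*} [MeasurableSpace χ] {M : Ω → χ} (hM : Measurable M)
    (hRM : IndepFun M (fun ω (p : RotIndex r) => R p.1.1 p.1.2 ω) Q)
    (hh : Measurable h) (hh1 : ∀ x, |h x| ≤ 1) (A : Matrix (Fin r) (Fin r) ℝ)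
    {z : χ → EuclideanSpace ℝ (Fin r)} (hz : Measurable z) :
    ∫ ω, h (toEuclideanCLM (𝕜 := ℝ) (A * trueRotation l fun i j => R i j ω) (z (M ω))) ∂Q =
      ∫ ω, rotAverage Q R l A h (z (M ω)) ∂Q := by
  have := isProbabilityMeasure_rotLaw hR
  have := Measure.isProbabilityMeasure_map (μ := Q) hM.aemeasurable
  have hlaw := (indepFun_iff_map_prod_eq_prod_map_map hM.aemeasurable
    hR.measurable_family.aemeasurable).1 hRM
  have hm : Measurable fun p : χ × ((p : RotIndex r) → Matrix.orthogonalGroup (Fin p.1.1) ℝ) =>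
      h (toEuclideanCLM (𝕜 := ℝ) (A * trueRotation l (extendRot p.2)) (z p.1)) :=
    measurable_rot_apply hh A measurable_snd (hz.comp measurable_fst)
  have e1 : ∀ ω, trueRotation l (fun i j => R i j ω) =
      trueRotation l (extendRot fun p : RotIndex r => R p.1.1 p.1.2 ω) := fun ω =>
    (blockMatrix_extendRot hr jumpSet_ne_zero _ fun i j => R i j ω).symm
  have hint : Integrable (fun p : χ × ((p : RotIndex r) → Matrix.orthogonalGroup (Fin p.1.1) ℝ) =>
      h (toEuclideanCLM (𝕜 := ℝ) (A * trueRotation l (extendRot p.2)) (z p.1)))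
      ((Q.map M).prod (rotLaw Q r R)) :=
    .of_bound hm.aestronglyMeasurable 1 (Eventually.of_forall fun p => hh1 _)
  have hsm : StronglyMeasurable fun m => rotAverage Q R l A h (z m) :=
    hm.stronglyMeasurable.integral_prod_right'
  calc _ = ∫ ω, (fun p : χ × ((p : RotIndex r) → Matrix.orthogonalGroup (Fin p.1.1) ℝ) =>
      h (toEuclideanCLM (𝕜 := ℝ) (A * trueRotation l (extendRot p.2)) (z p.1)))
        (M ω, fun p : RotIndex r => R p.1.1 p.1.2 ω) ∂Q := by simp only [e1]
    _ = ∫ p, h (toEuclideanCLM (𝕜 := ℝ) (A * trueRotation l (extendRot p.2)) (z p.1))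
        ∂((Q.map M).prod (rotLaw Q r R)) := by
      rw [rotLaw, ← hlaw, integral_map (hM.prodMk hR.measurable_family).aemeasurable
        hm.aestronglyMeasurable]
    _ = ∫ m, rotAverage Q R l A h (z m) ∂(Q.map M) := integral_prod _ hint
    _ = _ := integral_map hM.aemeasurable hsm.aestronglyMeasurable

/-- Coupling: both Gaussians are images of the same standard Gaussian vector under `X` and `X'`. -/
theorem abs_integral_gaussian_sub_le {S S' X X' : Matrix (Fin r) (Fin r) ℝ} (hX : X * Xᵀ = S)
    (hX' : X' * X'ᵀ = S') (hh : h ∈ BL1 (EuclideanSpace ℝ (Fin r))) :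
    |∫ z, h z ∂(multivariateGaussian 0 S) - ∫ z, h z ∂(multivariateGaussian 0 S')| ≤
      ‖X - X'‖ * ∫ z, ‖z‖ ∂(stdGaussian (EuclideanSpace ℝ (Fin r))) := by
  have hCm : ∀ X : Matrix (Fin r) (Fin r) ℝ, Measurable (toEuclideanCLM (𝕜 := ℝ) X) := fun X =>
    (toEuclideanCLM (𝕜 := ℝ) X).continuous.measurable
  have hhm := hh.1.continuous.measurable
  have hi : ∀ X : Matrix (Fin r) (Fin r) ℝ, Integrable (fun z => h (toEuclideanCLM (𝕜 := ℝ) X z))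
      (stdGaussian (EuclideanSpace ℝ (Fin r))) := fun X =>
    .of_bound (hhm.comp (hCm X)).aestronglyMeasurable 1 (Eventually.of_forall fun z => hh.2 _)
  have hn : Integrable (fun z => ‖z‖) (stdGaussian (EuclideanSpace ℝ (Fin r))) :=
    IsGaussian.integrable_fun_id.norm
  rw [← map_stdGaussian_eq hX, ← map_stdGaussian_eq hX',
    integral_map (hCm _).aemeasurable hhm.aestronglyMeasurable,
    integral_map (hCm _).aemeasurable hhm.aestronglyMeasurable, ← integral_sub (hi _) (hi _),
    ← integral_const_mul]
  refine abs_integral_le_integral_abs.trans ?_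
  refine integral_mono ((hi _).sub (hi _)).abs (hn.const_mul _) fun z => ?_
  simp only
  rw [← Real.dist_eq]
  refine (hh.1.dist_le_mul _ _).trans ?_
  rw [NNReal.coe_one, one_mul, dist_eq_norm, ← _root_.sub_apply, ← map_sub]
  exact norm_toEuclideanCLM_apply_le _ _

end Averaging

/-! ### One neighbourhood on which all deterministic approximations hold. -/

section GoodEvent

open Matrix
open scoped Matrix.Norms.L2Operator

variable {r : ℕ} {l D : Fin r → ℝ}

/-- Weyl's inequality reduces every requirement on the eigenvalues to the distance of the
covariances; the scaled distance secures the block structure. -/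
theorem exists_good_radius (hr : 1 ≤ r) {Sig V₀ Sigπ V : Matrix (Fin r) (Fin r) ℝ}
    (hV₀ : IsEigDecomp Sig V₀ D) (hV : IsEigDecomp Sigπ V l) (hl0 : ∀ i, 0 ≤ l i) {ε : ℝ}
    (hε : 0 < ε) {η : ℝ} (hη : 0 < η) :
    ∃ δ > 0, ∀ᶠ c : ℝ in atTop, ∀ S U d, IsEigDecomp S U d → specNorm (S - Sig) < δ →
      specNorm (U * diagSqrt D * Uᵀ - V₀ * diagSqrt D * V₀ᵀ) ≤ η ∧
      ∀ Sπ W dπ, IsEigDecomp Sπ W dπ → specNorm (Sπ - Sigπ) < δ →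
        |c * specNorm (Sπ - Sigπ)| < ε / 4 →
        (∃ B ∈ Matrix.orthogonalGroup (Fin r) ℝ, Commute B (diagonal l) ∧
          specNorm (W - V * B) ≤ η) ∧
        ∀ R (θ : EuclideanSpace ℝ (Fin r)) (s : ℝ), ‖s • corrected c ε U d W dπ R θ -
          toEuclideanCLM (𝕜 := ℝ) (frontMatrix U D l * trueRotation l R * Wᵀ) (s • θ)‖ ≤
            η * ‖s • θ‖ := by
  obtain ⟨δ₁, hδ₁, h₁⟩ := exists_front_near (D := D) hr hV.antitone hl0 hη
  obtain ⟨δ₂, hδ₂, h₂⟩ := hV.exists_commute_near hη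
  obtain ⟨δ₃, hδ₃, h₃⟩ := hV₀.exists_sqrt_near hη
  refine ⟨min δ₁ (min δ₂ δ₃), by positivity, ?_⟩
  filter_upwards [eventually_blockRotation_eq hε hV.antitone hl0, eventually_ge_atTop 0]
    with c hc hc0 S U d hU hS
  simp only [specNorm_eq, lt_min_iff] at hS ⊢
  refine ⟨h₃ S U d hU hS.2.2, fun Sπ W dπ hW hSπ hcS => ⟨?_, fun R θ s => ?_⟩⟩
  · obtain ⟨B, hB, hBl, hWB⟩ := h₂ Sπ W dπ hW hSπ.2.1
    exact ⟨B, hB, hBl, hWB.le⟩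
  · rw [corrected, hc dπ fun i => ?_, ← map_smul, ← _root_.sub_apply, ← map_sub]
    · refine (norm_toEuclideanCLM_apply_le _ _).trans ?_
      gcongr
      exact h₁ U W d dπ hU.orthogonal hW.orthogonal
        (fun i => (hU.abs_sub_le hV₀ i).trans_lt hS.1)
        (fun i => (hW.abs_sub_le hV i).trans_lt hSπ.1) R
    · calc c * |dπ i - l i| ≤ c * ‖Sπ - Sigπ‖ := by
            gcongr
            exact hW.abs_sub_le hV i
        _ ≤ ε / 4 := (le_abs_self _).trans hcS.le

end GoodEvent

/-! ### Distance to the limit law for fixed data. -/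

section PointwiseBound

open Matrix

variable {r : ℕ} {l D : Fin r → ℝ} {Ω : Type*} [MeasurableSpace Ω] {Q : Measure Ω}
  [IsProbabilityMeasure Q] {R : (i : ℕ) → ℕ → Ω → Matrix.orthogonalGroup (Fin i) ℝ}

omit [IsProbabilityMeasure Q] in
theorem IsHaarFamily.measurable_trueRotation (hr : 1 ≤ r) (hR : IsHaarFamily Q r R) :
    Measurable fun ω => trueRotation l fun i j => R i j ω := by
  have e : (fun ω => trueRotation l fun i j => R i j ω) = fun ω =>
      trueRotation l (extendRot fun p : RotIndex r => R p.1.1 p.1.2 ω) := funext fun ω =>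
    (blockMatrix_extendRot hr jumpSet_ne_zero _ fun i j => R i j ω).symm
  rw [e]
  exact (measurable_blockMatrix_extendRot _ _).comp hR.measurable_family

theorem mul_diagSqrt_mul_transpose_sq {V S : Matrix (Fin r) (Fin r) ℝ} (hV : IsEigDecomp S V D)
    (hD0 : ∀ i, 0 ≤ D i) : V * diagSqrt D * Vᵀ * (V * diagSqrt D * Vᵀ)ᵀ = V * diagonal D * Vᵀ := by
  have ht : (diagSqrt D)ᵀ = diagSqrt D := by rw [diagSqrt, diagonal_transpose]
  calc _ = V * diagSqrt D * (Vᵀ * V) * diagSqrt D * Vᵀ := by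
        simp only [transpose_mul, transpose_transpose, ht, Matrix.mul_assoc]
    _ = _ := by
        rw [transpose_mul_of_mem hV.orthogonal, Matrix.mul_one, Matrix.mul_assoc V,
          diagSqrt_mul_self D hD0]

/-- Quantitative core, with no limit taken. The two replacements cost `η (L + 1)` and `K η (L + 1)`,
each plus twice the mass of the exceptional set; the limit law costs `K` times the given distance,
and the final change of Gaussian costs `η` times the mean norm. -/
theorem blDist_corrected_le (hr : 1 ≤ r) (hR : IsHaarFamily Q r R)
    {Sig V₀ Sigπ V : Matrix (Fin r) (Fin r) ℝ} (hV₀ : IsEigDecomp Sig V₀ D)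
    (hV : IsEigDecomp Sigπ V l) (hD0 : ∀ i, 0 ≤ D i) (hl0 : ∀ i, 0 ≤ l i)
    (hDl : ∀ i, D i ≠ 0 → l i ≠ 0) {χ : Type*} [MeasurableSpace χ] {M : Ω → χ} (hM : Measurable M)
    (hRM : IndepFun M (fun ω (p : RotIndex r) => R p.1.1 p.1.2 ω) Q)
    {S U : Matrix (Fin r) (Fin r) ℝ} {d : Fin r → ℝ} (hU : IsEigDecomp S U d)
    {T : χ → EuclideanSpace ℝ (Fin r)} (hT : Measurable T)
    {W : χ → Matrix (Fin r) (Fin r) ℝ} (hW : Measurable W)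
    {C : Ω → EuclideanSpace ℝ (Fin r)} (hC : Measurable C) {N : Set Ω} (hN : MeasurableSet N)
    {η e L K : ℝ} (hη : 0 ≤ η) (hL : 0 ≤ L) (hK : 1 ≤ K)
    (hgood : ∀ ω ∉ N, (∃ B ∈ Matrix.orthogonalGroup (Fin r) ℝ, Commute B (diagonal l) ∧
          specNorm (W (M ω) - V * B) ≤ η) ∧
        ‖C ω - toEuclideanCLM (𝕜 := ℝ) (frontMatrix U D l * trueRotation l (fun i j => R i j ω) *
          (W (M ω))ᵀ) (T (M ω))‖ ≤ η * ‖T (M ω)‖)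
    (htail : ∫ x, tailFn L x ∂(multivariateGaussian 0 Sigπ) ≤ e)
    (hsq : specNorm (U * diagSqrt D * Uᵀ - V₀ * diagSqrt D * V₀ᵀ) ≤ η)
    (hKA : specNorm (frontMatrix U D l) ≤ K) :
    blDist Q C (multivariateGaussian 0 Sig) ≤
      η * ((L + 1) * (1 + K) + ∫ z, ‖z‖ ∂(stdGaussian (EuclideanSpace ℝ (Fin r)))) +
      4 * Q.real N + 4 * e +
      (4 + K) * blDist Q (fun ω => T (M ω)) (multivariateGaussian 0 Sigπ) := by
  set A := frontMatrix U D l with hA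
  set b := blDist Q (fun ω => T (M ω)) (multivariateGaussian 0 Sigπ)
  set m := ∫ z, ‖z‖ ∂(stdGaussian (EuclideanSpace ℝ (Fin r)))
  have hm0 : 0 ≤ m := integral_nonneg fun _ => norm_nonneg _
  refine blDist_le fun h hh => ?_
  have hhm := hh.1.continuous.measurable
  have hTm : Measurable fun ω => T (M ω) := hT.comp hM
  have hWm : Measurable fun ω => W (M ω) := hW.comp hM
  -- Errors are proportional to the norm of `T (M ω)`, so large values are discarded as well; their
  -- mass is at most `e + b`.
  set N' := N ∪ {ω | L + 1 < ‖T (M ω)‖} with hN'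
  have hN'm : MeasurableSet N' := hN.union (measurableSet_lt measurable_const hTm.norm)
  have hN'Q : Q.real N' ≤ Q.real N + (e + b) := by
    refine (measureReal_union_le _ _).trans ?_
    gcongr
    exact (measureReal_norm_gt_le (ν := multivariateGaussian 0 Sigπ) hTm L).trans (by gcongr)
  have hRm := hR.measurable_trueRotation hr (l := l)
  set f : EuclideanSpace ℝ (Fin r) → ℝ := rotAverage Q R l A h with hf
  have hf1 : ∀ z, |f z| ≤ 1 := abs_rotAverage_le hR hh.2 A
  have hflip : ∀ z z', |f z - f z'| ≤ K * ‖z - z'‖ := fun z z' =>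
    (abs_rotAverage_sub_le hr hR hh A z z').trans (by
      gcongr
      exact hKA)
  have hK0 : 0 ≤ K := by linarith
  have hfL : LipschitzWith ⟨K, hK0⟩ f := LipschitzWith.of_dist_le_mul fun z z' => by
    rw [Real.dist_eq, dist_eq_norm]
    exact hflip z z'
  have hfm : Measurable f := hfL.continuous.measurable
  -- replace the estimated by the true eigenvalues
  have s1 : |∫ ω, h (C ω) ∂Q - ∫ ω, h (toEuclideanCLM (𝕜 := ℝ) (A * trueRotation l
      fun i j => R i j ω) (toEuclideanCLM (𝕜 := ℝ) (W (M ω))ᵀ (T (M ω)))) ∂Q| ≤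
      η * (L + 1) + 2 * Q.real N' := by
    refine abs_integral_sub_le_of_close (hhm.comp hC) (hhm.comp (measurable_toEuclideanCLM_apply
      (measurable_matrix_mul measurable_const hRm) (measurable_toEuclideanCLM_apply
        (measurable_matrix_transpose hWm) hTm))) (fun _ => hh.2 _) (fun _ => hh.2 _) hN'm
        (by positivity) fun ω hω => ?_
    simp only [hN', Set.mem_union, Set.mem_ofPred_eq, not_or, not_lt] at hω
    simp only [Function.comp_apply]
    rw [← Real.dist_eq, ← toEuclideanCLM_mul_apply]
    refine (hh.1.dist_le_mul _ _).trans ?_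
    rw [NNReal.coe_one, one_mul, dist_eq_norm]
    refine (hgood ω hω.1).2.trans ?_
    gcongr
    exact hω.2
  -- integrate out the rotation
  have s2 := integral_eq_integral_rotAverage (l := l) hr hR hM hRM hhm hh.2 A
    (z := fun x => toEuclideanCLM (𝕜 := ℝ) (W x)ᵀ (T x))
    (measurable_toEuclideanCLM_apply (measurable_matrix_transpose hW) hT)
  -- replace the estimated by the true eigenvectors
  have s3 : |∫ ω, f (toEuclideanCLM (𝕜 := ℝ) (W (M ω))ᵀ (T (M ω))) ∂Q -
      ∫ ω, f (toEuclideanCLM (𝕜 := ℝ) Vᵀ (T (M ω))) ∂Q| ≤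
      K * (η * (L + 1)) + 2 * Q.real N' := by
    refine abs_integral_sub_le_of_close (hfm.comp (measurable_toEuclideanCLM_apply
        (measurable_matrix_transpose hWm) hTm)) (hfm.comp (measurable_toEuclideanCLM_apply
        measurable_const hTm)) (fun _ => hf1 _) (fun _ => hf1 _) hN'm
        (by positivity) fun ω hω => ?_
    simp only [hN', Set.mem_union, Set.mem_ofPred_eq, not_or, not_lt] at hω
    obtain ⟨B, hB, hBl, hWB⟩ := (hgood ω hω.1).1
    refine (abs_rotAverage_sub_le_of_near hr hR hV.antitone hh hB hBl hWB A _).trans ?_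
    gcongr
    · exact hKA
    · exact hω.2
  -- use the limit law
  have hVn : ∀ x : EuclideanSpace ℝ (Fin r), ‖toEuclideanCLM (𝕜 := ℝ) Vᵀ x‖ ≤ ‖x‖ := fun x =>
    (norm_toEuclideanCLM_apply_le _ _).trans
      (mul_le_of_le_one_left (norm_nonneg _) (norm_le_one_of_mem (transpose_mem hV.orthogonal)))
  have s4 : |∫ ω, f (toEuclideanCLM (𝕜 := ℝ) Vᵀ (T (M ω))) ∂Q -
      ∫ z, f (toEuclideanCLM (𝕜 := ℝ) Vᵀ z) ∂(multivariateGaussian 0 Sigπ)| ≤ K * b := by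
    refine abs_integral_sub_le_mul_blDist (fun ω => T (M ω)) (K := ⟨K, hK0⟩)
      (g := fun z => f (toEuclideanCLM (𝕜 := ℝ) Vᵀ z)) hK ?_ fun _ => hf1 _
    refine LipschitzWith.of_dist_le_mul fun z z' => ?_
    rw [Real.dist_eq, dist_eq_norm]
    refine (hflip _ _).trans ?_
    rw [← map_sub]
    exact mul_le_mul_of_nonneg_left (hVn _) hK0
  have s5 := integral_rotAverage_gaussian (A := A) hr hR hV.antitone hl0 hhm hh.2 hV
  rw [hA, frontMatrix_mul_diagonal_mul_transpose U hD0 hl0 hDl, ← hA, ← hf] at s5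
  -- The Gaussian reached so far still depends on the data through `U`; comparing symmetric square
  -- roots takes it to `Sig`.
  have hU' : IsEigDecomp (U * diagonal D * Uᵀ) U D := ⟨hU.orthogonal, hV₀.antitone, rfl⟩
  have s6 := abs_integral_gaussian_sub_le (mul_diagSqrt_mul_transpose_sq hU' hD0)
    ((mul_diagSqrt_mul_transpose_sq hV₀ hD0).trans hV₀.eq.symm) hh
  have s7 : specNorm (U * diagSqrt D * Uᵀ - V₀ * diagSqrt D * V₀ᵀ) * m ≤ η * m := by gcongr
  rw [specNorm_eq] at s7
  rw [s2] at s1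
  rw [s5] at s4
  have hb : 4 * Q.real N' ≤ 4 * (Q.real N + (e + b)) := by linarith
  have t1 := abs_le.1 s1
  have t3 := abs_le.1 s3
  have t4 := abs_le.1 s4
  have t6 := abs_le.1 (s6.trans s7)
  rw [abs_le]
  constructor <;> nlinarith

end PointwiseBound

/-! ### Outer probability on the product and on its sections. -/

section Sections

variable {Ω₁ Ω₂ : Type*} [MeasurableSpace Ω₁] [MeasurableSpace Ω₂] {Q₁ : Measure Ω₁}
  {Q₂ : Measure Ω₂} [IsProbabilityMeasure Q₁] [IsProbabilityMeasure Q₂]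

theorem tendstoInMeasure_zero_iff {α : Type*} [MeasurableSpace α] {μ : Measure α}
    {f : ℕ → α → ℝ} : TendstoInMeasure μ f atTop (fun _ => 0) ↔
      ∀ e : ℝ, 0 < e → Tendsto (fun n => μ {x | e ≤ |f n x|}) atTop (𝓝 0) := by
  simp [tendstoInMeasure_iff_norm]

theorem tendsto_measure_zero_of_le {α : Type*} [MeasurableSpace α] {μ : Measure α}
    {A B : ℕ → Set α} (hB : Tendsto (fun n => μ (B n)) atTop (𝓝 0))
    (h : ∀ᶠ n in atTop, A n ⊆ B n) : Tendsto (fun n => μ (A n)) atTop (𝓝 0) :=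
  tendsto_of_tendsto_of_tendsto_of_le_of_le' tendsto_const_nhds hB
    (Eventually.of_forall fun _ => zero_le) (h.mono fun _ hn => measure_mono hn)

theorem tendsto_measure_union_zero {α : Type*} [MeasurableSpace α] {μ : Measure α}
    {A B : ℕ → Set α} (hA : Tendsto (fun n => μ (A n)) atTop (𝓝 0))
    (hB : Tendsto (fun n => μ (B n)) atTop (𝓝 0)) :
    Tendsto (fun n => μ (A n ∪ B n)) atTop (𝓝 0) := by
  have := hA.add hB
  rw [add_zero] at this
  exact tendsto_of_tendsto_of_tendsto_of_le_of_le tendsto_const_nhds this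
    (fun _ => zero_le) (fun _ => measure_union_le _ _)

-- Markov's inequality for the measure of the sections.
omit [IsProbabilityMeasure Q₁] in
theorem mul_measure_section_le {N : Set (Ω₁ × Ω₂)} (hN : MeasurableSet N) (κ : ℝ) :
    ENNReal.ofReal κ * Q₁ {x | κ ≤ Q₂.real (Prod.mk x ⁻¹' N)} ≤ (Q₁.prod Q₂) N := by
  rw [Measure.prod_apply hN]
  refine le_trans ?_ (mul_meas_ge_le_lintegral (measurable_measure_prodMk_left hN)
    (ENNReal.ofReal κ))
  gcongr with x
  exact fun h => ENNReal.ofReal_le_of_le_toReal h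

omit [IsProbabilityMeasure Q₁] in
theorem tendsto_measure_section {N : ℕ → Set (Ω₁ × Ω₂)} (hN : ∀ n, MeasurableSet (N n))
    (h : Tendsto (fun n => (Q₁.prod Q₂) (N n)) atTop (𝓝 0)) {κ : ℝ} (hκ : 0 < κ) :
    Tendsto (fun n => Q₁ {x | κ ≤ Q₂.real (Prod.mk x ⁻¹' N n)}) atTop (𝓝 0) := by
  have hκ' : ENNReal.ofReal κ ≠ 0 := by simpa using hκ
  have h' := ENNReal.Tendsto.const_mul (a := (ENNReal.ofReal κ)⁻¹) h
    (Or.inr (ENNReal.inv_ne_top.2 hκ'))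
  rw [mul_zero] at h'
  refine tendsto_of_tendsto_of_tendsto_of_le_of_le tendsto_const_nhds h' (fun _ => zero_le)
    fun n => ?_
  simp only
  rw [mul_comm, ← div_eq_mul_inv, ENNReal.le_div_iff_mul_le (Or.inl hκ')
    (Or.inl ENNReal.ofReal_ne_top), mul_comm]
  exact mul_measure_section_le (hN n) κ

theorem measure_prod_le {N : Set (Ω₁ × Ω₂)} (hN : MeasurableSet N) (κ : ℝ) :
    (Q₁.prod Q₂) N ≤ ENNReal.ofReal κ + Q₁ {x | κ ≤ Q₂.real (Prod.mk x ⁻¹' N)} := by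
  set s := {x | κ ≤ Q₂.real (Prod.mk x ⁻¹' N)} with hs
  have hsm : MeasurableSet s :=
    measurableSet_le measurable_const (measurable_measure_prodMk_left hN).ennreal_toReal
  rw [Measure.prod_apply hN]
  calc ∫⁻ x, Q₂ (Prod.mk x ⁻¹' N) ∂Q₁ ≤ ∫⁻ x, (ENNReal.ofReal κ + s.indicator 1 x) ∂Q₁ := by
        refine lintegral_mono fun x => ?_
        by_cases hx : x ∈ s
        · rw [Set.indicator_of_mem hx]
          exact prob_le_one.trans le_add_self
        · rw [Set.indicator_of_notMem hx, add_zero]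
          have hx' : Q₂.real (Prod.mk x ⁻¹' N) < κ := not_le.1 hx
          rw [ENNReal.le_ofReal_iff_toReal_le (measure_ne_top _ _)
            (measureReal_nonneg.trans hx'.le)]
          exact hx'.le
    _ = _ := by
        rw [lintegral_add_left measurable_const, lintegral_indicator_one hsm]
        simp

theorem tendsto_measure_prod_of_section {N : ℕ → Set (Ω₁ × Ω₂)} (hN : ∀ n, MeasurableSet (N n))
    (h : ∀ κ : ℝ, 0 < κ →
      Tendsto (fun n => Q₁ {x | κ ≤ Q₂.real (Prod.mk x ⁻¹' N n)}) atTop (𝓝 0)) :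
    Tendsto (fun n => (Q₁.prod Q₂) (N n)) atTop (𝓝 0) := by
  rw [ENNReal.tendsto_nhds_zero]
  intro e he
  obtain ⟨κ, hκ0, hκe⟩ : ∃ κ : ℝ, 0 < κ ∧ ENNReal.ofReal κ < e / 2 := by
    obtain ⟨c, hc0, hc⟩ := ENNReal.lt_iff_exists_nnreal_btwn.1 (ENNReal.half_pos he.ne')
    exact ⟨c, by exact_mod_cast hc0, by simpa using hc⟩
  filter_upwards [(ENNReal.tendsto_nhds_zero.1 (h κ hκ0)) (e / 2) (ENNReal.half_pos he.ne')]
    with n hn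
  calc _ ≤ _ := measure_prod_le (hN n) κ
    _ ≤ e / 2 + e / 2 := by gcongr
    _ = e := ENNReal.add_halves e

end Sections

/-! ### The supremum part of conditional weak convergence. -/

section Supremum

open Matrix

theorem blDist_corrected_tendsto {Ω₁ Ω₂ : Type*} [MeasurableSpace Ω₁] [MeasurableSpace Ω₂]
    {Q₁ : Measure Ω₁} {Q₂ : Measure Ω₂} [IsProbabilityMeasure Q₁] [IsProbabilityMeasure Q₂]
    {χ₁ χ₂ : ℕ → Type*} [∀ n, MeasurableSpace (χ₂ n)]
    {X : ∀ n, Ω₁ → χ₁ n} {M : ∀ n, Ω₂ → χ₂ n} (hM : ∀ n, Measurable (M n))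
    {r : ℕ} (hr : 1 ≤ r) {Sig Sigπ V₀ V : Matrix (Fin r) (Fin r) ℝ} {D l : Fin r → ℝ}
    (hV₀ : IsEigDecomp Sig V₀ D) (hV : IsEigDecomp Sigπ V l) (hD0 : ∀ i, 0 ≤ D i)
    (hl0 : ∀ i, 0 ≤ l i) (hDl : ∀ i, D i ≠ 0 → l i ≠ 0)
    {θπ : ∀ n, χ₁ n → χ₂ n → EuclideanSpace ℝ (Fin r)}
    {S : ∀ n, χ₁ n → Matrix (Fin r) (Fin r) ℝ}
    {Sπ : ∀ n, χ₁ n → χ₂ n → Matrix (Fin r) (Fin r) ℝ}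
    {U : ∀ n, χ₁ n → Matrix (Fin r) (Fin r) ℝ} {d : ∀ n, χ₁ n → Fin r → ℝ}
    {Uπ : ∀ n, χ₁ n → χ₂ n → Matrix (Fin r) (Fin r) ℝ} {dπ : ∀ n, χ₁ n → χ₂ n → Fin r → ℝ}
    (hU : ∀ n x, IsEigDecomp (S n x) (U n x) (d n x))
    (hUπ : ∀ n x m, IsEigDecomp (Sπ n x m) (Uπ n x m) (dπ n x m))
    (hθπ_meas : ∀ n x, Measurable (θπ n x)) (hUπ_meas : ∀ n x, Measurable (Uπ n x))
    (hθπ : TendstoInMeasure Q₁ (fun (n : ℕ) ω₁ => blDist Q₂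
      (fun ω₂ => √(n : ℝ) • θπ n (X n ω₁) (M n ω₂)) (multivariateGaussian 0 Sigπ))
      atTop (fun _ => 0))
    (hS_cons : TendstoInMeasure Q₁
      (fun n ω₁ => specNorm (S n (X n ω₁) - Sig)) atTop (fun _ => 0))
    (hSπ_cons : TendstoInMeasure (Q₁.prod Q₂)
      (fun n ω => specNorm (Sπ n (X n ω.1) (M n ω.2) - Sigπ)) atTop (fun _ => 0))
    {rate : ℕ → ℝ} (hrate : Tendsto rate atTop atTop)
    (hSπ_rate : TendstoInMeasure (Q₁.prod Q₂)
      (fun n ω => rate n * specNorm (Sπ n (X n ω.1) (M n ω.2) - Sigπ)) atTop (fun _ => 0))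
    {ε : ℝ} (hε : 0 < ε) {R : (i : ℕ) → ℕ → Ω₂ → Matrix.orthogonalGroup (Fin i) ℝ}
    (hR : IsHaarFamily Q₂ r R)
    (hRM : ∀ n, IndepFun (M n) (fun ω₂ (p : RotIndex r) => R p.1.1 p.1.2 ω₂) Q₂)
    (hcorr_meas : ∀ n x, Measurable (fun ω₂ =>
      corrected (rate n) ε (U n x) (d n x) (Uπ n x (M n ω₂)) (dπ n x (M n ω₂))
        (fun i j => R i j ω₂) (θπ n x (M n ω₂)))) :
    TendstoInMeasure Q₁ (fun (n : ℕ) ω₁ => blDist Q₂ (fun ω₂ => √(n : ℝ) •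
        corrected (rate n) ε (U n (X n ω₁)) (d n (X n ω₁))
          (Uπ n (X n ω₁) (M n ω₂)) (dπ n (X n ω₁) (M n ω₂))
          (fun i j => R i j ω₂) (θπ n (X n ω₁) (M n ω₂))) (multivariateGaussian 0 Sig))
      atTop (fun _ => 0) := by
  rw [tendstoInMeasure_zero_iff]
  intro e₀ he₀
  set m := ∫ z, ‖z‖ ∂(stdGaussian (EuclideanSpace ℝ (Fin r))) with hm
  have hm0 : 0 ≤ m := integral_nonneg fun _ => norm_nonneg _
  -- The norm of the front matrix is bounded through `D` and `l` alone, since `U` is orthogonal;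
  -- hence one `K` serves all `n` and all data.
  obtain ⟨K, hK, hKA⟩ : ∃ K : ℝ, 1 ≤ K ∧ ∀ n x, specNorm (frontMatrix (U n x) D l) ≤ K :=
    ⟨_, le_max_left _ _, fun n x => (norm_frontMatrix_le (hU n x).orthogonal).trans
      (le_max_right _ _)⟩
  -- Error budget: the `η` term, the exceptional set, the tail and the given distance contribute at
  -- most `e₀ / 8` each.
  obtain ⟨L, hL, htail⟩ := exists_integral_tailFn_le (multivariateGaussian 0 Sigπ)
    (e := e₀ / 32) (by positivity)
  set c := (L + 1) * (1 + K) + m with hc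
  have hc0 : 0 < c := by positivity
  set η := e₀ / (8 * c) with hη
  have hη0 : 0 < η := by positivity
  obtain ⟨δ, hδ, hgood⟩ := exists_good_radius hr hV₀ hV hl0 hε hη0
  set B : ℕ → Set (Ω₁ × Ω₂) := fun n =>
    {ω | δ ≤ |specNorm (Sπ n (X n ω.1) (M n ω.2) - Sigπ)|} ∪
    {ω | ε / 4 ≤ |rate n * specNorm (Sπ n (X n ω.1) (M n ω.2) - Sigπ)|} with hB
  -- The covariance estimators need not be measurable, so the bad set is replaced by a measurable
  -- hull of equal outer measure before taking sections.
  have hBt : Tendsto (fun n => (Q₁.prod Q₂) (toMeasurable (Q₁.prod Q₂) (B n))) atTop (𝓝 0) := by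
    simp only [measure_toMeasurable]
    exact tendsto_measure_union_zero (tendstoInMeasure_zero_iff.1 hSπ_cons δ hδ)
      (tendstoInMeasure_zero_iff.1 hSπ_rate (ε / 4) (by positivity))
  have hsec := tendsto_measure_section (fun n => measurableSet_toMeasurable (Q₁.prod Q₂) (B n)) hBt
    (κ := e₀ / 32) (by positivity)
  have hbad := tendsto_measure_union_zero (tendsto_measure_union_zero hsec
    (tendstoInMeasure_zero_iff.1 hS_cons δ hδ))
    (tendstoInMeasure_zero_iff.1 hθπ (e₀ / (8 * (4 + K))) (by positivity))
  refine tendsto_measure_zero_of_le hbad ?_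
  filter_upwards [hrate.eventually hgood] with n hn ω₁ hω₁
  by_contra hcon
  simp only [Set.mem_union, Set.mem_ofPred_eq, not_or, not_le] at hcon hω₁
  obtain ⟨⟨hq, hS⟩, hb⟩ := hcon
  rw [abs_of_nonneg (blDist_nonneg _)] at hω₁ hb
  replace hS := (le_abs_self _).trans_lt hS
  obtain ⟨hsq, hgd⟩ := hn _ _ _ (hU n (X n ω₁)) hS
  have hTm : Measurable fun y => √(n : ℝ) • θπ n (X n ω₁) y :=
    (hθπ_meas n (X n ω₁)).const_smul (√(n : ℝ))
  have hCm := (hcorr_meas n (X n ω₁)).const_smul (√(n : ℝ))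
  have key := blDist_corrected_le hr hR hV₀ hV hD0 hl0 hDl (hM n) (hRM n) (hU n (X n ω₁))
    (T := fun y => √(n : ℝ) • θπ n (X n ω₁) y) hTm
    (hUπ_meas n (X n ω₁)) hCm
    (measurable_prodMk_left (x := ω₁) (measurableSet_toMeasurable (Q₁.prod Q₂) (B n))) hη0.le hL hK
    ?_ htail hsq (hKA n (X n ω₁))
  · rw [← hm, ← hc] at key
    have e1 : η * c = e₀ / 8 := by rw [hη]; field_simp
    have e2 : (4 + K) * blDist Q₂ (fun ω₂ => √(n : ℝ) • θπ n (X n ω₁) (M n ω₂))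
        (multivariateGaussian 0 Sigπ) ≤ e₀ / 8 := by
      calc _ ≤ (4 + K) * (e₀ / (8 * (4 + K))) := by gcongr
        _ = e₀ / 8 := by field_simp
    have := hω₁.trans key
    linarith
  · intro ω₂ hω₂
    have hω₂' : (ω₁, ω₂) ∉ B n := fun h => hω₂ (subset_toMeasurable _ _ h)
    simp only [hB, Set.mem_union, Set.mem_ofPred_eq, not_or, not_le] at hω₂'
    have h1 := (le_abs_self _).trans_lt hω₂'.1
    obtain ⟨h2, h3⟩ := hgd _ _ _ (hUπ n (X n ω₁) (M n ω₂)) h1 hω₂'.2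
    exact ⟨h2, h3 _ _ _⟩

end Supremum

/-! ### Measurable majorants and minorants of bounded functions. -/

section MajorantBounds

variable {α : Type*} [MeasurableSpace α] {μ : Measure α} [IsFiniteMeasure μ] {f : α → ℝ}

omit [MeasurableSpace α] in
theorem abs_neg_le_of_abs_le (hf : ∀ x, |f x| ≤ 1) : ∀ x, |-f x| ≤ 1 := fun x => by
  rw [abs_neg]; exact hf x

theorem measurable_majorant (hf : ∀ x, |f x| ≤ 1) : Measurable (majorant μ f) :=
  (isMeasMajorant_majorant μ f 1 hf).measurable

theorem measurable_minorant (hf : ∀ x, |f x| ≤ 1) : Measurable (minorant μ f) :=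
  (measurable_majorant (abs_neg_le_of_abs_le hf)).neg

theorem le_majorant (hf : ∀ x, |f x| ≤ 1) (x : α) : f x ≤ majorant μ f x :=
  (isMeasMajorant_majorant μ f 1 hf).le x

theorem minorant_le (hf : ∀ x, |f x| ≤ 1) (x : α) : minorant μ f x ≤ f x := by
  have := le_majorant (μ := μ) (abs_neg_le_of_abs_le hf) x
  simp only [minorant]
  linarith

theorem minorant_le_majorant (hf : ∀ x, |f x| ≤ 1) (x : α) : minorant μ f x ≤ majorant μ f x :=
  (minorant_le hf x).trans (le_majorant hf x)

theorem majorant_le_ae (hf : ∀ x, |f x| ≤ 1) {u : α → ℝ} (hu : Measurable u)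
    (h : ∀ x, f x ≤ u x) : ∀ᵐ x ∂μ, majorant μ f x ≤ u x :=
  (isMeasMajorant_majorant μ f 1 hf).minimal u hu (Eventually.of_forall h)

theorem le_minorant_ae (hf : ∀ x, |f x| ≤ 1) {u : α → ℝ} (hu : Measurable u)
    (h : ∀ x, u x ≤ f x) : ∀ᵐ x ∂μ, u x ≤ minorant μ f x := by
  filter_upwards [majorant_le_ae (μ := μ) (abs_neg_le_of_abs_le hf) hu.neg
    (fun x => neg_le_neg (h x))] with x hx
  simp only [minorant]
  simp only [Pi.neg_apply] at hx
  linarith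

theorem abs_majorant_le_ae (hf : ∀ x, |f x| ≤ 1) : ∀ᵐ x ∂μ, |majorant μ f x| ≤ 1 := by
  filter_upwards [majorant_le_ae (μ := μ) hf measurable_const (u := fun _ => 1)
    fun x => (abs_le.1 (hf x)).2] with x hx
  exact abs_le.2 ⟨(abs_le.1 (hf x)).1.trans (le_majorant hf x), hx⟩

theorem abs_minorant_le_ae (hf : ∀ x, |f x| ≤ 1) : ∀ᵐ x ∂μ, |minorant μ f x| ≤ 1 := by
  filter_upwards [abs_majorant_le_ae (μ := μ) (abs_neg_le_of_abs_le hf)] with x hx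
  rwa [minorant, abs_neg]

theorem integrable_majorant (hf : ∀ x, |f x| ≤ 1) : Integrable (majorant μ f) μ :=
  .of_bound (measurable_majorant hf).aestronglyMeasurable 1 (abs_majorant_le_ae hf)

theorem integrable_minorant (hf : ∀ x, |f x| ≤ 1) : Integrable (minorant μ f) μ :=
  .of_bound (measurable_minorant hf).aestronglyMeasurable 1 (abs_minorant_le_ae hf)

/-- A bounded function that is close to a measurable one has a small oscillation. -/
theorem majorant_sub_minorant_le_ae (hf : ∀ x, |f x| ≤ 1) {g : α → ℝ} (hg : Measurable g)
    {H : Set α} (hH : MeasurableSet H) {κ : ℝ} (hκ : 0 ≤ κ) (h : ∀ x ∉ H, |f x - g x| ≤ κ) :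
    ∀ᵐ x ∂μ, majorant μ f x - minorant μ f x ≤ 2 * κ + H.indicator (fun _ => 2) x := by
  classical
  have h1 := majorant_le_ae (μ := μ) hf (u := H.piecewise (fun _ => 1) fun x => g x + κ)
    (Measurable.piecewise hH measurable_const (hg.add_const κ)) fun x => by
      by_cases hx : x ∈ H
      · simpa [hx] using (abs_le.1 (hf x)).2
      · simp only [hx, not_false_eq_true, Set.piecewise_eq_of_notMem]
        linarith [(abs_le.1 (h x hx)).2]
  have h2 := le_minorant_ae (μ := μ) hf (u := H.piecewise (fun _ => -1) fun x => g x - κ)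
    (Measurable.piecewise hH measurable_const (hg.sub_const κ)) fun x => by
      by_cases hx : x ∈ H
      · simpa [hx] using (abs_le.1 (hf x)).1
      · simp only [hx, not_false_eq_true, Set.piecewise_eq_of_notMem]
        linarith [(abs_le.1 (h x hx)).1]
  filter_upwards [h1, h2] with x hx1 hx2
  by_cases hx : x ∈ H
  · simp only [hx, Set.piecewise_eq_of_mem, Set.indicator_of_mem] at *
    linarith
  · simp only [hx, not_false_eq_true, Set.piecewise_eq_of_notMem, Set.indicator_of_notMem] at *
    linarith

end MajorantBounds

/-! ### Approximation by measurable functions in outer probability. -/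

section AsympApprox

variable {α : Type*} [MeasurableSpace α] {μ : Measure α}

/-- The sequence `f n` is approximated by measurable functions in outer probability. -/
def AsympApprox (μ : Measure α) (f : ℕ → α → ℝ) : Prop :=
  ∃ g : ℕ → α → ℝ, (∀ n, Measurable (g n)) ∧
    ∀ e : ℝ, 0 < e → Tendsto (fun n => μ {x | e ≤ |f n x - g n x|}) atTop (𝓝 0)

theorem AsympApprox.of_measurable {f : ℕ → α → ℝ} (hf : ∀ n, Measurable (f n)) :
    AsympApprox μ f :=
  ⟨f, hf, fun e he => by simp [he.not_ge]⟩

theorem AsympApprox.of_majorant_sub_minorant [IsFiniteMeasure μ] {f : ℕ → α → ℝ}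
    (hf : ∀ n x, |f n x| ≤ 1)
    (h : ∀ e : ℝ, 0 < e → Tendsto
      (fun n => μ {x | e ≤ majorant μ (f n) x - minorant μ (f n) x}) atTop (𝓝 0)) :
    AsympApprox μ f := by
  refine ⟨fun n => majorant μ (f n), fun n => measurable_majorant (hf n), fun e he => ?_⟩
  refine tendsto_measure_zero_of_le (h e he) (Eventually.of_forall fun n x hx => ?_)
  have h1 := le_majorant (μ := μ) (hf n) x
  have h2 := minorant_le (μ := μ) (hf n) x
  simp only [Set.mem_ofPred_eq] at hx ⊢
  rw [abs_of_nonpos (by linarith)] at hx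
  linarith

/-- The gap between majorant and minorant is nonnegative with vanishing integral, so Markov's
inequality applies; the majorant serves as approximant. -/
theorem AsympMeasurable.asympApprox {S : Type*} [TopologicalSpace S] [IsFiniteMeasure μ]
    {X : ℕ → α → S} (hX : AsympMeasurable μ X) {f : S → ℝ} (hf : Continuous f)
    (hf1 : ∀ s, |f s| ≤ 1) : AsympApprox μ fun n x => f (X n x) := by
  have hb : ∀ n x, |f (X n x)| ≤ 1 := fun n x => hf1 _
  refine AsympApprox.of_majorant_sub_minorant hb fun e he => ?_
  have h1 := hX (BoundedContinuousFunction.ofNormedAddCommGroup f hf 1 hf1)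
  simp only [BoundedContinuousFunction.coe_ofNormedAddCommGroup] at h1
  have h2 : ∀ n, e * μ.real {x | e ≤ majorant μ (fun y => f (X n y)) x -
      minorant μ (fun y => f (X n y)) x} ≤ ∫ a, majorant μ (fun y => f (X n y)) a ∂μ -
      ∫ a, minorant μ (fun y => f (X n y)) a ∂μ := by
    intro n
    rw [← integral_sub (integrable_majorant (hb n)) (integrable_minorant (hb n))]
    exact mul_meas_ge_le_integral_of_nonneg
      (Eventually.of_forall fun x => sub_nonneg.2 (minorant_le_majorant (hb n) x))
      ((integrable_majorant (hb n)).sub (integrable_minorant (hb n))) e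
  have h3 : Tendsto (fun n => μ.real {x | e ≤ majorant μ (fun y => f (X n y)) x -
      minorant μ (fun y => f (X n y)) x}) atTop (𝓝 0) := by
    have h4 := h1.const_mul e⁻¹
    rw [mul_zero] at h4
    refine squeeze_zero (fun _ => measureReal_nonneg) (fun n => ?_) h4
    rw [le_inv_mul_iff₀ he]
    exact h2 n
  have h5 := ENNReal.tendsto_ofReal h3
  simpa [ofReal_measureReal] using h5

theorem AsympApprox.comp_continuous {ι : Type*} [Fintype ι] {f : ι → ℕ → α → ℝ}
    (hf : ∀ i, AsympApprox μ (f i)) {L : ℝ} (hL : ∀ i n x, |f i n x| ≤ L) {F : (ι → ℝ) → ℝ}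
    (hF : Continuous F) : AsympApprox μ fun n x => F fun i => f i n x := by
  choose g hg hgt using hf
  refine ⟨fun n x => F fun i => g i n x,
    fun n => hF.measurable.comp (measurable_pi_iff.2 fun i => hg i n), fun e he => ?_⟩
  have hK : IsCompact (Set.univ.pi fun _ : ι => Set.Icc (-L) L) :=
    isCompact_univ_pi fun _ => isCompact_Icc
  -- The approximants may leave the cube, so the continuity must compare a point of the cube with
  -- any nearby point, inside or outside.
  have huc := hK.uniformContinuousAt_of_continuousAt F (fun x _ => hF.continuousAt)
    (Metric.dist_mem_uniformity he)
  obtain ⟨δ, hδ, hδF⟩ := Metric.mem_uniformity_dist.1 huc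
  have hsum : Tendsto (fun n => ∑ i, μ {x | δ ≤ |f i n x - g i n x|}) atTop (𝓝 0) := by
    simpa using tendsto_finsetSum Finset.univ fun i _ => hgt i δ hδ
  refine tendsto_of_tendsto_of_tendsto_of_le_of_le tendsto_const_nhds hsum (fun _ => zero_le)
    fun n => ?_
  refine (measure_mono fun x hx => ?_).trans (measure_iUnion_fintype_le μ _)
  by_contra hcon
  simp only [Set.mem_iUnion, Set.mem_ofPred_eq, not_exists, not_le] at hcon hx
  have h1 : dist (fun i => f i n x) (fun i => g i n x) < δ := (dist_pi_lt_iff hδ).2 hcon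
  have h2 := hδF h1 (Set.mem_univ_pi.2 fun i => abs_le.1 (hL i n x))
  simp only [Set.mem_ofPred_eq, Real.dist_eq] at h2
  linarith

end AsympApprox

/-! ### Transfer between joint and conditional oscillation. -/

section Product

variable {Ω₁ Ω₂ : Type*} [MeasurableSpace Ω₁] [MeasurableSpace Ω₂] {Q₁ : Measure Ω₁}
  {Q₂ : Measure Ω₂} [IsProbabilityMeasure Q₁] [IsProbabilityMeasure Q₂]

omit [IsProbabilityMeasure Q₁] in
theorem tendsto_measure_fst {A : ℕ → Set Ω₁} (hA : Tendsto (fun n => Q₁ (A n)) atTop (𝓝 0)) :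
    Tendsto (fun n => (Q₁.prod Q₂) {ω | ω.1 ∈ A n}) atTop (𝓝 0) := by
  have : ∀ n, (Q₁.prod Q₂) {ω | ω.1 ∈ A n} = Q₁ (A n) := fun n => by
    have e : {ω : Ω₁ × Ω₂ | ω.1 ∈ A n} = A n ×ˢ Set.univ := by ext; simp
    rw [e, Measure.prod_prod, measure_univ, mul_one]
  simpa only [this] using hA

omit [IsProbabilityMeasure Q₁] in
theorem AsympApprox.fst {f : ℕ → Ω₁ → ℝ} (hf : AsympApprox Q₁ f) :
    AsympApprox (Q₁.prod Q₂) fun n ω => f n ω.1 := by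
  obtain ⟨g, hg, h⟩ := hf
  exact ⟨fun n ω => g n ω.1, fun n => (hg n).comp measurable_fst,
    fun e he => tendsto_measure_fst (Q₂ := Q₂) (h e he)⟩

theorem ae_section_majorant {f : Ω₁ × Ω₂ → ℝ} (hf : ∀ x, |f x| ≤ 1) :
    ∀ᵐ ω₁ ∂Q₁, Integrable (fun ω₂ => majorant (Q₁.prod Q₂) f (ω₁, ω₂)) Q₂ ∧
      Integrable (fun ω₂ => minorant (Q₁.prod Q₂) f (ω₁, ω₂)) Q₂ :=
  (integrable_majorant hf).prod_right_ae.and (integrable_minorant hf).prod_right_ae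

/-- Markov's inequality within almost every section turns a small conditional gap into a small
section measure, and the sections are then integrated. -/
theorem tendsto_measure_majorant_sub_minorant {f : ℕ → Ω₁ × Ω₂ → ℝ} (hf : ∀ n x, |f n x| ≤ 1)
    (h : TendstoInMeasure Q₁ (fun n ω₁ => ∫ ω₂, majorant (Q₁.prod Q₂) (f n) (ω₁, ω₂) ∂Q₂ -
      ∫ ω₂, minorant (Q₁.prod Q₂) (f n) (ω₁, ω₂) ∂Q₂) atTop (fun _ => 0)) {e : ℝ} (he : 0 < e) :
    Tendsto (fun n => (Q₁.prod Q₂)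
      {x | e ≤ majorant (Q₁.prod Q₂) (f n) x - minorant (Q₁.prod Q₂) (f n) x}) atTop (𝓝 0) := by
  refine tendsto_measure_prod_of_section (fun n => measurableSet_le measurable_const
    ((measurable_majorant (hf n)).sub (measurable_minorant (hf n)))) fun κ hκ => ?_
  have h1 := tendstoInMeasure_zero_iff.1 h (e * κ) (by positivity)
  refine tendsto_of_tendsto_of_tendsto_of_le_of_le tendsto_const_nhds h1 (fun _ => zero_le)
    fun n => measure_mono_ae ?_
  filter_upwards [ae_section_majorant (Q₁ := Q₁) (Q₂ := Q₂) (hf n)] with ω₁ hω hκω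
  have hκω' : κ ≤ Q₂.real (Prod.mk ω₁ ⁻¹' {x | e ≤ majorant (Q₁.prod Q₂) (f n) x -
    minorant (Q₁.prod Q₂) (f n) x}) := hκω
  show e * κ ≤ |_|
  rw [← integral_sub hω.1 hω.2]
  refine le_trans ?_ (le_abs_self _)
  refine le_trans (mul_le_mul_of_nonneg_left hκω' he.le) ?_
  exact mul_meas_ge_le_integral_of_nonneg
      (Eventually.of_forall fun x => sub_nonneg.2 (minorant_le_majorant (hf n) _))
      (hω.1.sub hω.2) e

/-- Approximability by measurable functions implies the measurability part of conditional weak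
convergence. -/
theorem tendstoInMeasure_of_approx {f : ℕ → Ω₁ × Ω₂ → ℝ} (hf : ∀ n x, |f n x| ≤ 1)
    (h : ∀ κ : ℝ, 0 < κ → ∀ κ' : ENNReal, 0 < κ' → ∃ g : ℕ → Ω₁ × Ω₂ → ℝ, (∀ n, Measurable (g n)) ∧
      ∀ᶠ n in atTop, (Q₁.prod Q₂) {x | κ ≤ |f n x - g n x|} ≤ κ') :
    TendstoInMeasure Q₁ (fun n ω₁ => ∫ ω₂, majorant (Q₁.prod Q₂) (f n) (ω₁, ω₂) ∂Q₂ -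
      ∫ ω₂, minorant (Q₁.prod Q₂) (f n) (ω₁, ω₂) ∂Q₂) atTop (fun _ => 0) := by
  rw [tendstoInMeasure_zero_iff]
  intro e he
  rw [ENNReal.tendsto_nhds_zero]
  intro e' he'
  -- The gap is at most `2κ` plus `2` on `H`; a conditional gap of `8κ` therefore forces the section
  -- of `H` to have mass at least `3κ`.
  set κ := e / 8 with hκ
  have hκ0 : 0 < κ := by positivity
  have hκE : ENNReal.ofReal (3 * κ) ≠ 0 := by
    rw [Ne, ENNReal.ofReal_eq_zero]
    linarith
  obtain ⟨g, hg, hgn⟩ := h κ hκ0 (ENNReal.ofReal (3 * κ) * e')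
    (ENNReal.mul_pos hκE he'.ne')
  filter_upwards [hgn] with n hn
  set H := toMeasurable (Q₁.prod Q₂) {x | κ ≤ |f n x - g n x|}
  have hHm : MeasurableSet H := measurableSet_toMeasurable _ _
  have hH : ∀ x ∉ H, |f n x - g n x| ≤ κ := fun x hx =>
    (not_le.1 fun h' => hx (subset_toMeasurable _ _ h')).le
  have hae := Measure.ae_ae_of_ae_prod
    (majorant_sub_minorant_le_ae (μ := Q₁.prod Q₂) (hf n) (hg n) hHm hκ0.le hH)
  have key : Q₁ {x | e ≤ |∫ ω₂, majorant (Q₁.prod Q₂) (f n) (x, ω₂) ∂Q₂ -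
      ∫ ω₂, minorant (Q₁.prod Q₂) (f n) (x, ω₂) ∂Q₂|} ≤
      Q₁ {x | 3 * κ ≤ Q₂.real (Prod.mk x ⁻¹' H)} := by
    refine measure_mono_ae ?_
    filter_upwards [hae, ae_section_majorant (Q₁ := Q₁) (Q₂ := Q₂) (hf n)] with ω₁ hω hint he₁
    have he₁' : e ≤ |∫ ω₂, majorant (Q₁.prod Q₂) (f n) (ω₁, ω₂) ∂Q₂ -
      ∫ ω₂, minorant (Q₁.prod Q₂) (f n) (ω₁, ω₂) ∂Q₂| := he₁
    show 3 * κ ≤ Q₂.real (Prod.mk ω₁ ⁻¹' H)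
    have hHs : MeasurableSet (Prod.mk ω₁ ⁻¹' H) := measurable_prodMk_left hHm
    rw [← integral_sub hint.1 hint.2, abs_of_nonneg
      (integral_nonneg fun x => sub_nonneg.2 (minorant_le_majorant (hf n) _))] at he₁'
    have hi : Integrable ((Prod.mk ω₁ ⁻¹' H).indicator fun _ => (2 : ℝ)) Q₂ :=
      (integrable_const _).indicator hHs
    have := integral_mono_ae (hint.1.sub hint.2) ((integrable_const (2 * κ)).add hi) hω
    simp only [Pi.add_apply, Pi.sub_apply] at this
    rw [integral_add (integrable_const _) hi, integral_indicator hHs] at this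
    simp only [integral_const, probReal_univ, smul_eq_mul, one_mul, measureReal_restrict_apply,
      MeasurableSet.univ, Set.univ_inter] at this
    linarith
  have h2 := (mul_measure_section_le (Q₁ := Q₁) (Q₂ := Q₂) hHm (3 * κ)).trans
    ((measure_toMeasurable _).le.trans hn)
  exact key.trans ((ENNReal.mul_le_mul_iff_right hκE ENNReal.ofReal_ne_top).1 h2)

end Product

/-! ### Joint tightness from conditional convergence. -/

section Tightness

variable {Ω₁ Ω₂ : Type*} [MeasurableSpace Ω₁] [MeasurableSpace Ω₂] {Q₁ : Measure Ω₁}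
  {Q₂ : Measure Ω₂} [IsProbabilityMeasure Q₁] [IsProbabilityMeasure Q₂]
  {E : Type*} [NormedAddCommGroup E] [MeasurableSpace E] [BorelSpace E] {ν : Measure E}
  [IsProbabilityMeasure ν] {T : ℕ → Ω₁ → Ω₂ → E}

omit [IsProbabilityMeasure Q₁] [IsProbabilityMeasure Q₂] [BorelSpace E] [IsProbabilityMeasure ν] in
theorem CondWeakConv.blDist_tendsto (h : CondWeakConv Q₁ Q₂ T ν) :
    TendstoInMeasure Q₁ (fun n ω₁ => blDist Q₂ (T n ω₁) ν) atTop (fun _ => 0) :=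
  h.sup_tendsto

omit [BorelSpace E] [IsProbabilityMeasure ν] in
theorem CondWeakConv.asympApprox (h : CondWeakConv Q₁ Q₂ T ν) {g : E → ℝ} (hg : g ∈ BL1 E) :
    AsympApprox (Q₁.prod Q₂) fun n ω => g (T n ω.1 ω.2) :=
  AsympApprox.of_majorant_sub_minorant (fun _ _ => hg.2 _) fun _ he =>
    tendsto_measure_majorant_sub_minorant (fun _ _ => hg.2 _) (h.asymp_meas g hg) he

/-- `T` is measurable only for fixed data, so Fubini does not apply to its tail event. That event is
covered by the measurable set where the minorant of a tail function is at least `1 / 2` and the set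
where majorant and minorant differ by at least `1 / 2`. -/
theorem CondWeakConv.exists_tight (h : CondWeakConv Q₁ Q₂ T ν) (hT : ∀ n ω₁, Measurable (T n ω₁))
    {κ' : ENNReal} (hκ' : 0 < κ') : ∃ L : ℝ, 0 ≤ L ∧
      ∀ᶠ n in atTop, (Q₁.prod Q₂) {ω | L < ‖T n ω.1 ω.2‖} ≤ κ' := by
  obtain ⟨c, hc0, hc⟩ : ∃ c : ℝ, 0 < c ∧ ENNReal.ofReal c < κ' / 2 := by
    obtain ⟨c, hc0, hc⟩ := ENNReal.lt_iff_exists_nnreal_btwn.1 (ENNReal.half_pos hκ'.ne')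
    exact ⟨c, by exact_mod_cast hc0, by simpa using hc⟩
  obtain ⟨L, hL, htail⟩ := exists_integral_tailFn_le ν (e := c / 2) (by positivity)
  refine ⟨L + 2, by positivity, ?_⟩
  set f : ℕ → Ω₁ × Ω₂ → ℝ := fun n ω => tailFn (L + 1) (T n ω.1 ω.2) with hf
  have hf1 : ∀ n x, |f n x| ≤ 1 := fun n x => (tailFn_mem_BL1 (L + 1)).2 _
  have hgap := tendsto_measure_majorant_sub_minorant hf1
    (h.asymp_meas _ (tailFn_mem_BL1 (L + 1))) (e := 1 / 2) (by norm_num)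
  have hbl := tendstoInMeasure_zero_iff.1 h.blDist_tendsto (c / 2) (by positivity)
  filter_upwards [ENNReal.tendsto_nhds_zero.1 hgap (κ' / 4) (ENNReal.div_pos hκ'.ne' (by simp)),
    ENNReal.tendsto_nhds_zero.1 hbl (κ' / 4) (ENNReal.div_pos hκ'.ne' (by simp))] with n hn1 hn2
  -- On `N` the tail function itself is at least `1 / 2`, so the norm exceeds `L + 1`. A section of
  -- mass at least `c` then forces the distance to `ν` to be at least `c / 2`.
  set N := {x | 1 / 2 ≤ minorant (Q₁.prod Q₂) (f n) x} with hN
  have hNm : MeasurableSet N := measurableSet_le measurable_const (measurable_minorant (hf1 n))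
  have hNle : (Q₁.prod Q₂) N ≤ κ' / 2 + κ' / 4 := by
    refine (measure_prod_le hNm c).trans ?_
    gcongr
    refine le_trans (measure_mono fun ω₁ hω => ?_) hn2
    have hω' : c ≤ Q₂.real (Prod.mk ω₁ ⁻¹' N) := hω
    have h1 := measureReal_norm_gt_le (Q := Q₂) (ν := ν) (hT n ω₁) L
    have h2 : Q₂.real (Prod.mk ω₁ ⁻¹' N) ≤ Q₂.real {ω | L + 1 < ‖T n ω₁ ω‖} := by
      refine measureReal_mono fun ω₂ hω₂ => ?_
      have h3 : 1 / 2 ≤ f n (ω₁, ω₂) :=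
        le_trans (show 1 / 2 ≤ minorant (Q₁.prod Q₂) (f n) (ω₁, ω₂) from hω₂)
          (minorant_le (hf1 n) _)
      simp only [hf, tailFn, le_max_iff, le_min_iff] at h3
      rcases h3 with h3 | h3
      · norm_num at h3
      · show L + 1 < ‖T n ω₁ ω₂‖
        linarith [h3.2]
    show c / 2 ≤ |blDist Q₂ (T n ω₁) ν|
    exact le_trans (by linarith) (le_abs_self _)
  calc (Q₁.prod Q₂) {ω | L + 2 < ‖T n ω.1 ω.2‖}
      ≤ (Q₁.prod Q₂) ({x | 1 / 2 ≤ majorant (Q₁.prod Q₂) (f n) x -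
          minorant (Q₁.prod Q₂) (f n) x} ∪ N) := by
        refine measure_mono fun ω hω => ?_
        have h1 : 1 ≤ f n ω := one_le_tailFn (by
          have : L + 2 < ‖T n ω.1 ω.2‖ := hω
          linarith)
        have h2 := le_majorant (μ := Q₁.prod Q₂) (hf1 n) ω
        by_cases h3 : 1 / 2 ≤ minorant (Q₁.prod Q₂) (f n) ω
        · exact Or.inr h3
        · refine Or.inl ?_
          show 1 / 2 ≤ majorant (Q₁.prod Q₂) (f n) ω - minorant (Q₁.prod Q₂) (f n) ω
          linarith
    _ ≤ κ' / 4 + (κ' / 2 + κ' / 4) := (measure_union_le _ _).trans (by gcongr)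
    _ = κ' := by
        rw [add_comm (κ' / 2), ← add_assoc]
        have : κ' / 4 + κ' / 4 = κ' / 2 := by
          rw [← two_mul, ENNReal.div_eq_inv_mul, ENNReal.div_eq_inv_mul, ← mul_assoc,
            show (4 : ENNReal) = 2 * 2 by norm_num,
            ENNReal.mul_inv (Or.inl (by simp)) (Or.inl (by simp)), ← mul_assoc,
            ENNReal.mul_inv_cancel (by simp) (by simp), one_mul]
        rw [this, ENNReal.add_halves]

end Tightness

/-! ### Truncated coordinates as test functions. -/

section Clip

/-- Truncation to `[-1, 1]`. -/
noncomputable def clip (x : ℝ) : ℝ := max (-1) (min 1 x)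

theorem abs_clip_le (x : ℝ) : |clip x| ≤ 1 :=
  abs_le.2 ⟨le_max_left _ _, max_le (by norm_num) (min_le_left _ _)⟩

theorem clip_eq_self {x : ℝ} (h : |x| ≤ 1) : clip x = x := by
  rw [clip, min_eq_right (abs_le.1 h).2, max_eq_right (abs_le.1 h).1]

theorem lipschitzWith_clip : LipschitzWith 1 clip :=
  (LipschitzWith.id.const_min 1).const_max (-1)

variable {r : ℕ}

theorem clip_coord_mem_BL1 {L : ℝ} (hL : 1 ≤ L) (j : Fin r) :
    (fun x : EuclideanSpace ℝ (Fin r) => clip (L⁻¹ * x j)) ∈ BL1 (EuclideanSpace ℝ (Fin r)) := by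
  refine ⟨?_, fun x => abs_clip_le _⟩
  have h : LipschitzWith 1 fun x : EuclideanSpace ℝ (Fin r) => L⁻¹ * x j := by
    refine LipschitzWith.of_dist_le_mul fun x y => ?_
    have h1 : |x j - y j| ≤ ‖x - y‖ := PiLp.norm_apply_le (x - y) j
    have h2 : L⁻¹ ≤ 1 := inv_le_one_of_one_le₀ hL
    have h3 : 0 ≤ L⁻¹ := by positivity
    rw [Real.dist_eq, ← mul_sub, abs_mul, abs_of_nonneg h3, NNReal.coe_one, one_mul, dist_eq_norm]
    nlinarith [abs_nonneg (x j - y j)]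
  have := lipschitzWith_clip.comp h
  rwa [one_mul] at this

theorem smul_clip_eq {L : ℝ} (hL : 1 ≤ L) {x : EuclideanSpace ℝ (Fin r)} (hx : ‖x‖ ≤ L) :
    L • WithLp.toLp 2 (fun j => clip (L⁻¹ * x j)) = x := by
  ext j
  have h1 : |x j| ≤ ‖x‖ := PiLp.norm_apply_le x j
  have hL0 : 0 < L := by linarith
  have h2 : |L⁻¹ * x j| ≤ 1 := by
    rw [abs_mul, abs_of_pos (inv_pos.2 hL0), inv_mul_le_iff₀ hL0]
    linarith
  simp only [PiLp.smul_apply, smul_eq_mul]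
  rw [clip_eq_self h2]
  field_simp

/-- Asymptotic measurability only sees bounded functions; entries of orthogonal matrices lie in
`[-1, 1]`, so truncating them changes nothing. -/
theorem AsympMeasurable.asympApprox_entry {α : Type*} [MeasurableSpace α] {μ : Measure α}
    [IsFiniteMeasure μ] {X : ℕ → α → Matrix (Fin r) (Fin r) ℝ} (hX : AsympMeasurable μ X)
    (hO : ∀ n x, X n x ∈ Matrix.orthogonalGroup (Fin r) ℝ) (i j : Fin r) :
    AsympApprox μ fun n x => X n x i j := by
  have h1 := hX.asympApprox (f := fun A => clip (A i j))
    (lipschitzWith_clip.continuous.comp (by fun_prop)) fun A => abs_clip_le _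
  have h2 : ∀ n x, clip (X n x i j) = X n x i j := fun n x =>
    clip_eq_self (entry_norm_bound_of_unitary (hO n x) i j)
  simpa only [h2] using h1

end Clip

/-! ### The measurability part of conditional weak convergence. -/

section AsympMeas

open Matrix

/-- The map that assembles the corrected estimator from its rescaled coordinates. -/
noncomputable def assemble {r : ℕ} (D l : Fin r → ℝ) (L : ℝ)
    (x : ((Fin r × Fin r) ⊕ (Fin r × Fin r)) ⊕ ((Fin r × Fin r) ⊕ Fin r) → ℝ) :
    EuclideanSpace ℝ (Fin r) :=
  toEuclideanCLM (𝕜 := ℝ) (frontMatrix (Matrix.of fun i j => x (.inl (.inl (i, j)))) D l *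
    (Matrix.of fun i j => x (.inr (.inl (i, j)))) * (Matrix.of fun i j => x (.inl (.inr (i, j))))ᵀ)
    (L • WithLp.toLp 2 fun j => x (.inr (.inr j)))

theorem continuous_assemble {r : ℕ} (D l : Fin r → ℝ) (L : ℝ) :
    Continuous (assemble (r := r) D l L) := by
  have h : ∀ x, assemble (r := r) D l L x = WithLp.toLp 2
    ((frontMatrix (Matrix.of fun i j => x (.inl (.inl (i, j)))) D l *
    (Matrix.of fun i j => x (.inr (.inl (i, j)))) *
      (Matrix.of fun i j => x (.inl (.inr (i, j))))ᵀ) *ᵥ (fun j => L * x (.inr (.inr j)))) :=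
    fun x => rfl
  simp only [funext h, frontMatrix]
  refine (PiLp.continuous_toLp 2 _).comp (Continuous.matrix_mulVec ?_ (by fun_prop))
  have hc : ∀ e : Fin r × Fin r → ((Fin r × Fin r) ⊕ (Fin r × Fin r)) ⊕ ((Fin r × Fin r) ⊕ Fin r),
      Continuous fun x : ((Fin r × Fin r) ⊕ (Fin r × Fin r)) ⊕ ((Fin r × Fin r) ⊕ Fin r) → ℝ =>
        (Matrix.of fun i j => x (e (i, j)) : Matrix (Fin r) (Fin r) ℝ) := fun e =>
    continuous_matrix fun i j => continuous_apply _
  exact (((((hc fun p => .inl (.inl p)).matrix_mul continuous_const).matrix_mul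
    continuous_const).matrix_mul (hc fun p => .inr (.inl p))).matrix_mul
    (hc fun p => .inl (.inr p)).matrix_transpose)

/-- The approximant may depend on `κ` and `κ'`, which permits a fixed truncation level `L`. Outside
a set of small outer measure, the estimator is then near a continuous function of finitely many
bounded approximable coordinates. -/
theorem exists_approx_corrected {Ω₁ Ω₂ : Type*} [MeasurableSpace Ω₁] [MeasurableSpace Ω₂]
    {Q₁ : Measure Ω₁} {Q₂ : Measure Ω₂} [IsProbabilityMeasure Q₁] [IsProbabilityMeasure Q₂]
    {χ₁ χ₂ : ℕ → Type*} [∀ n, MeasurableSpace (χ₂ n)]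
    {X : ∀ n, Ω₁ → χ₁ n} {M : ∀ n, Ω₂ → χ₂ n} (hM : ∀ n, Measurable (M n))
    {r : ℕ} (hr : 1 ≤ r) {Sig Sigπ V₀ V : Matrix (Fin r) (Fin r) ℝ} {D l : Fin r → ℝ}
    (hV₀ : IsEigDecomp Sig V₀ D) (hV : IsEigDecomp Sigπ V l)
    (hl0 : ∀ i, 0 ≤ l i)
    {θπ : ∀ n, χ₁ n → χ₂ n → EuclideanSpace ℝ (Fin r)}
    {S : ∀ n, χ₁ n → Matrix (Fin r) (Fin r) ℝ}
    {Sπ : ∀ n, χ₁ n → χ₂ n → Matrix (Fin r) (Fin r) ℝ}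
    {U : ∀ n, χ₁ n → Matrix (Fin r) (Fin r) ℝ} {d : ∀ n, χ₁ n → Fin r → ℝ}
    {Uπ : ∀ n, χ₁ n → χ₂ n → Matrix (Fin r) (Fin r) ℝ} {dπ : ∀ n, χ₁ n → χ₂ n → Fin r → ℝ}
    (hU : ∀ n x, IsEigDecomp (S n x) (U n x) (d n x))
    (hUπ : ∀ n x m, IsEigDecomp (Sπ n x m) (Uπ n x m) (dπ n x m))
    (hθπ_meas : ∀ n x, Measurable (θπ n x))
    (hθπ : CondWeakConv Q₁ Q₂
      (fun n ω₁ ω₂ => √(n : ℝ) • θπ n (X n ω₁) (M n ω₂)) (multivariateGaussian 0 Sigπ))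
    (hS_cons : TendstoInMeasure Q₁
      (fun n ω₁ => specNorm (S n (X n ω₁) - Sig)) atTop (fun _ => 0))
    (hSπ_cons : TendstoInMeasure (Q₁.prod Q₂)
      (fun n ω => specNorm (Sπ n (X n ω.1) (M n ω.2) - Sigπ)) atTop (fun _ => 0))
    {rate : ℕ → ℝ} (hrate : Tendsto rate atTop atTop)
    (hSπ_rate : TendstoInMeasure (Q₁.prod Q₂)
      (fun n ω => rate n * specNorm (Sπ n (X n ω.1) (M n ω.2) - Sigπ)) atTop (fun _ => 0))
    (hU_asymp : AsympMeasurable Q₁ (fun n ω₁ => U n (X n ω₁)))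
    (hUπ_asymp : AsympMeasurable (Q₁.prod Q₂) (fun n ω => Uπ n (X n ω.1) (M n ω.2)))
    {ε : ℝ} (hε : 0 < ε) {R : (i : ℕ) → ℕ → Ω₂ → Matrix.orthogonalGroup (Fin i) ℝ}
    (hR : IsHaarFamily Q₂ r R) {h : EuclideanSpace ℝ (Fin r) → ℝ}
    (hh : h ∈ BL1 (EuclideanSpace ℝ (Fin r))) {κ : ℝ} (hκ : 0 < κ) {κ' : ENNReal} (hκ' : 0 < κ') :
    ∃ g : ℕ → Ω₁ × Ω₂ → ℝ, (∀ n, Measurable (g n)) ∧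
      ∀ᶠ n : ℕ in atTop, (Q₁.prod Q₂) {ω | κ ≤ |h (√(n : ℝ) •
        corrected (rate n) ε (U n (X n ω.1)) (d n (X n ω.1))
          (Uπ n (X n ω.1) (M n ω.2)) (dπ n (X n ω.1) (M n ω.2))
          (fun i j => R i j ω.2) (θπ n (X n ω.1) (M n ω.2))) - g n ω|} ≤ κ' := by
  have hκ2 : 0 < κ' / 2 := ENNReal.half_pos hκ'.ne'
  obtain ⟨L₀, hL₀, htight⟩ := hθπ.exists_tight
    (fun n ω₁ => ((hθπ_meas n (X n ω₁)).comp (hM n)).const_smul (√(n : ℝ))) hκ2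
  -- The truncation needs `L ≥ 1`, so that dividing by `L` keeps the coordinates Lipschitz with
  -- constant one.
  set L := L₀ + 1 with hLdef
  have hL : 1 ≤ L := by linarith
  have hL0 : 0 < L := by linarith
  -- On norms up to `L` this `η` costs `κ / 4`; with `κ / 2` for the measurable approximation the
  -- total stays below `κ`.
  obtain ⟨δ, hδ, hgood⟩ := exists_good_radius hr hV₀ hV hl0 hε (η := κ / (4 * L)) (by positivity)
  set f : ((Fin r × Fin r) ⊕ (Fin r × Fin r)) ⊕ ((Fin r × Fin r) ⊕ Fin r) → ℕ → Ω₁ × Ω₂ → ℝ :=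
    Sum.elim
      (Sum.elim (fun p n ω => U n (X n ω.1) p.1 p.2) fun p n ω => Uπ n (X n ω.1) (M n ω.2) p.1 p.2)
      (Sum.elim (fun p n ω => trueRotation l (fun i j => R i j ω.2) p.1 p.2) fun j n ω =>
        clip (L⁻¹ * (√(n : ℝ) • θπ n (X n ω.1) (M n ω.2)) j)) with hf
  have hUA : ∀ p : Fin r × Fin r, AsympApprox (Q₁.prod Q₂) fun n ω => U n (X n ω.1) p.1 p.2 :=
    fun p => AsympApprox.fst (f := fun n ω₁ => U n (X n ω₁) p.1 p.2)
      (hU_asymp.asympApprox_entry (fun n ω₁ => (hU n (X n ω₁)).orthogonal) p.1 p.2)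
  have hWA : ∀ p : Fin r × Fin r, AsympApprox (Q₁.prod Q₂) fun n ω =>
      Uπ n (X n ω.1) (M n ω.2) p.1 p.2 := fun p =>
    hUπ_asymp.asympApprox_entry (fun n ω => (hUπ n (X n ω.1) (M n ω.2)).orthogonal) p.1 p.2
  have hRm : ∀ p : Fin r × Fin r, Measurable fun ω : Ω₁ × Ω₂ =>
      trueRotation l (fun i j => R i j ω.2) p.1 p.2 := by
    intro p
    have h1 : Measurable fun ω : Ω₁ × Ω₂ => trueRotation l (fun i j => R i j ω.2) :=
      (hR.measurable_trueRotation hr (l := l)).comp measurable_snd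
    exact (measurable_matrix_entry p.1 p.2).comp h1
  have hRA : ∀ p : Fin r × Fin r, AsympApprox (Q₁.prod Q₂) fun _ ω =>
      trueRotation l (fun i j => R i j ω.2) p.1 p.2 := fun p => .of_measurable fun _ => hRm p
  have hclip : ∀ j : Fin r, AsympApprox (Q₁.prod Q₂) fun (n : ℕ) ω =>
      clip (L⁻¹ * (√(n : ℝ) • θπ n (X n ω.1) (M n ω.2)) j) := fun j =>
    CondWeakConv.asympApprox (g := fun x => clip (L⁻¹ * x j)) hθπ (clip_coord_mem_BL1 hL j)
  have hfA : ∀ i, AsympApprox (Q₁.prod Q₂) (f i) := by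
    rintro ((p | p) | (p | j))
    · exact hUA p
    · exact hWA p
    · exact hRA p
    · exact hclip j
  have hf1 : ∀ i n x, |f i n x| ≤ 1 := by
    rintro ((p | p) | (p | j)) n x
    · exact entry_norm_bound_of_unitary (hU n (X n x.1)).orthogonal p.1 p.2
    · exact entry_norm_bound_of_unitary (hUπ n (X n x.1) (M n x.2)).orthogonal p.1 p.2
    · exact abs_blockMatrix_le hr jumpSet_ne_zero _ _ p.1 p.2
    · exact abs_clip_le _
  obtain ⟨g, hg, hgt⟩ := AsympApprox.comp_continuous hfA hf1
    (hh.1.continuous.comp (continuous_assemble D l L))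
  refine ⟨g, hg, ?_⟩
  have hsmall := tendsto_measure_union_zero (tendsto_measure_union_zero (tendsto_measure_union_zero
    (hgt (κ / 2) (by positivity))
    (tendsto_measure_fst (Q₂ := Q₂) (tendstoInMeasure_zero_iff.1 hS_cons δ hδ)))
    (tendstoInMeasure_zero_iff.1 hSπ_cons δ hδ))
    (tendstoInMeasure_zero_iff.1 hSπ_rate (ε / 4) (by positivity))
  filter_upwards [htight, ENNReal.tendsto_nhds_zero.1 hsmall _ hκ2, hrate.eventually hgood]
    with n hn1 hn2 hn3
  refine le_trans (le_trans (measure_mono fun ω hω => ?_) (measure_union_le _ _))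
    ((add_le_add hn1 hn2).trans (ENNReal.add_halves κ').le)
  by_contra hcon
  simp only [Set.mem_union, Set.mem_ofPred_eq, not_or, not_le, not_lt] at hcon hω
  obtain ⟨hT, ⟨⟨hg1, hS⟩, hSπ⟩, hrt⟩ := hcon
  obtain ⟨-, hgd⟩ := hn3 _ _ _ (hU n (X n ω.1)) ((le_abs_self _).trans_lt hS)
  obtain ⟨-, h3⟩ := hgd _ _ _ (hUπ n (X n ω.1) (M n ω.2)) ((le_abs_self _).trans_lt hSπ) hrt
  have h4 := h3 (fun i j => R i j ω.2) (θπ n (X n ω.1) (M n ω.2)) (√(n : ℝ))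
  have hT' : ‖√(n : ℝ) • θπ n (X n ω.1) (M n ω.2)‖ ≤ L := hT.trans (by linarith)
  -- Within radius `L` the truncation is the identity, so the assembled vector is exactly the
  -- approximating one.
  have h5 : (assemble D l L fun i => f i n ω) = toEuclideanCLM (𝕜 := ℝ)
      (frontMatrix (U n (X n ω.1)) D l * trueRotation l (fun i j => R i j ω.2) *
        (Uπ n (X n ω.1) (M n ω.2))ᵀ) (√(n : ℝ) • θπ n (X n ω.1) (M n ω.2)) := by
    conv_rhs => rw [← smul_clip_eq hL hT']
    rfl
  simp only [Function.comp_apply, h5] at hg1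
  have h6 := hh.1.dist_le_mul (√(n : ℝ) • corrected (rate n) ε (U n (X n ω.1)) (d n (X n ω.1))
          (Uπ n (X n ω.1) (M n ω.2)) (dπ n (X n ω.1) (M n ω.2))
          (fun i j => R i j ω.2) (θπ n (X n ω.1) (M n ω.2))) (toEuclideanCLM (𝕜 := ℝ)
      (frontMatrix (U n (X n ω.1)) D l * trueRotation l (fun i j => R i j ω.2) *
        (Uπ n (X n ω.1) (M n ω.2))ᵀ) (√(n : ℝ) • θπ n (X n ω.1) (M n ω.2)))
  rw [NNReal.coe_one, one_mul, Real.dist_eq, dist_eq_norm] at h6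
  have h7 : κ / (4 * L) * ‖√(n : ℝ) • θπ n (X n ω.1) (M n ω.2)‖ ≤ κ / 4 := by
    calc _ ≤ κ / (4 * L) * L := by gcongr
      _ = κ / 4 := by field_simp
  have h8 := h6.trans (h4.trans h7)
  have h9 := abs_sub_le (h (√(n : ℝ) • corrected (rate n) ε (U n (X n ω.1)) (d n (X n ω.1))
          (Uπ n (X n ω.1) (M n ω.2)) (dπ n (X n ω.1) (M n ω.2))
          (fun i j => R i j ω.2) (θπ n (X n ω.1) (M n ω.2)))) (h (toEuclideanCLM (𝕜 := ℝ)
      (frontMatrix (U n (X n ω.1)) D l * trueRotation l (fun i j => R i j ω.2) *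
        (Uπ n (X n ω.1) (M n ω.2))ᵀ) (√(n : ℝ) • θπ n (X n ω.1) (M n ω.2)))) (g n ω)
  linarith

end AsympMeas

end PermCorr

theorem theorem2 {Ω₁ Ω₂ : Type*} [MeasurableSpace Ω₁] [MeasurableSpace Ω₂]
    (Q₁ : Measure Ω₁) (Q₂ : Measure Ω₂) [IsProbabilityMeasure Q₁] [IsProbabilityMeasure Q₂]
    -- the data `X n` (arbitrary maps) and the resampling randomness `M n` (e.g. a permutation)
    {χ₁ χ₂ : ℕ → Type*} [∀ n, MeasurableSpace (χ₂ n)]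
    (X : ∀ n, Ω₁ → χ₁ n) (M : ∀ n, Ω₂ → χ₂ n) (hM : ∀ n, Measurable (M n))
    -- the limit covariance matrices
    (r : ℕ) (hr : 1 ≤ r) (Sig Sigπ : Matrix (Fin r) (Fin r) ℝ)
    (hSig : Sig.PosSemidef) (hSigπ : Sigπ.PosSemidef)
    -- the permutation estimator, the covariance estimators and their eigenvalue decompositions
    (θπ : ∀ n, χ₁ n → χ₂ n → EuclideanSpace ℝ (Fin r))
    (S : ∀ n, χ₁ n → Matrix (Fin r) (Fin r) ℝ)
    (Sπ : ∀ n, χ₁ n → χ₂ n → Matrix (Fin r) (Fin r) ℝ)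
    (U : ∀ n, χ₁ n → Matrix (Fin r) (Fin r) ℝ) (d : ∀ n, χ₁ n → Fin r → ℝ)
    (Uπ : ∀ n, χ₁ n → χ₂ n → Matrix (Fin r) (Fin r) ℝ) (dπ : ∀ n, χ₁ n → χ₂ n → Fin r → ℝ)
    (hS : ∀ n x, (S n x).PosSemidef) (hSπ : ∀ n x m, (Sπ n x m).PosSemidef)
    (hU : ∀ n x, PermCorr.IsEigDecomp (S n x) (U n x) (d n x))
    (hUπ : ∀ n x m, PermCorr.IsEigDecomp (Sπ n x m) (Uπ n x m) (dπ n x m))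
    (hθπ_meas : ∀ n x, Measurable (θπ n x)) (hUπ_meas : ∀ n x, Measurable (Uπ n x))
    -- asymptotic normality of the permutation estimator
    (hθπ : PermCorr.CondWeakConv Q₁ Q₂
      (fun n ω₁ ω₂ => √(n : ℝ) • θπ n (X n ω₁) (M n ω₂)) (multivariateGaussian 0 Sigπ))
    -- consistency of the covariance estimators
    (hS_cons : TendstoInMeasure Q₁
      (fun n ω₁ => PermCorr.specNorm (S n (X n ω₁) - Sig)) atTop (fun _ => 0))
    (hSπ_cons : TendstoInMeasure (Q₁.prod Q₂)
      (fun n ω => PermCorr.specNorm (Sπ n (X n ω.1) (M n ω.2) - Sigπ)) atTop (fun _ => 0))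
    -- ranks, convergence rate, asymptotic measurability
    (hrank : Sig.rank ≤ Sigπ.rank)
    (rate : ℕ → ℝ) (hrate : Tendsto rate atTop atTop)
    (hSπ_rate : TendstoInMeasure (Q₁.prod Q₂)
      (fun n ω => rate n * PermCorr.specNorm (Sπ n (X n ω.1) (M n ω.2) - Sigπ))
      atTop (fun _ => 0))
    (hU_asymp : PermCorr.AsympMeasurable Q₁ (fun n ω₁ => U n (X n ω₁)))
    (hUπ_asymp : PermCorr.AsympMeasurable (Q₁.prod Q₂)
      (fun n ω => Uπ n (X n ω.1) (M n ω.2)))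
    -- the threshold and the Haar distributed rotations, independent of the resampling randomness
    (ε : ℝ) (hε : 0 < ε)
    (R : (i : ℕ) → ℕ → Ω₂ → Matrix.orthogonalGroup (Fin i) ℝ)
    (hR : PermCorr.IsHaarFamily Q₂ r R)
    (hRM : ∀ n, IndepFun (M n) (fun ω₂ (p : PermCorr.RotIndex r) => R p.1.1 p.1.2 ω₂) Q₂)
    -- for fixed data, the corrected estimator is measurable in the additional randomness
    (hcorr_meas : ∀ n x, Measurable (fun ω₂ =>
      PermCorr.corrected (rate n) ε (U n x) (d n x) (Uπ n x (M n ω₂)) (dπ n x (M n ω₂))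
        (fun i j => R i j ω₂) (θπ n x (M n ω₂)))) :
    PermCorr.CondWeakConv Q₁ Q₂
      (fun n ω₁ ω₂ => √(n : ℝ) •
        PermCorr.corrected (rate n) ε (U n (X n ω₁)) (d n (X n ω₁))
          (Uπ n (X n ω₁) (M n ω₂)) (dπ n (X n ω₁) (M n ω₂))
          (fun i j => R i j ω₂) (θπ n (X n ω₁) (M n ω₂)))
      (multivariateGaussian 0 Sig) := by
  obtain ⟨V₀, D, hV₀⟩ := PermCorr.exists_isEigDecomp hSig
  obtain ⟨V, l, hV⟩ := PermCorr.exists_isEigDecomp hSigπ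
  have hD0 := hV₀.nonneg hSig
  have hl0 := hV.nonneg hSigπ
  -- The rank condition enters here, as an inclusion of the nonzero eigenvalue positions.
  have hDl := PermCorr.eigenvalue_ne_zero_of_rank_le hV₀ hV hSig hSigπ hrank
  refine ⟨?_, fun h hh => ?_⟩
  · exact PermCorr.blDist_corrected_tendsto hM hr hV₀ hV hD0 hl0 hDl hU hUπ hθπ_meas hUπ_meas
      hθπ.blDist_tendsto hS_cons hSπ_cons hrate hSπ_rate hε hR hRM hcorr_meas
  · exact PermCorr.tendstoInMeasure_of_approx (fun _ _ => hh.2 _) fun _ hκ _ hκ' =>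
      PermCorr.exists_approx_corrected hM hr hV₀ hV hl0 hU hUπ hθπ_meas hθπ hS_cons hSπ_cons hrate
        hSπ_rate hU_asymp hUπ_asymp hε hR hh hκ hκ'
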